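/- A directed acyclic graph (DAG) $D$ on a finite vertex set encodes the conditional independence relations "$X$ is independent of $Y$ given $Z$" for all pairwise disjoint vertex sets $X,Y,Z$ such that $Z$ d-separates $X$ from $Y$ in $D$. Two DAGs on the same vertex set are Markov equivalent if they encode the same relations; a Markov equivalence class (MEC) is a class of this equivalence. The CPDAG $G$ of an MEC is the union of the DAGs in the class, and $[G]$ denotes the class; an edge $u-v$ of $G$ is undirected if both $u\to v$ and $v\to u$ belong to the union. Let $m$ be the number of edges of $G$ (an undirected edge counts once). An edge $x\to y$ of a DAG is covered if $\mathrm{Pa}(x)\cup\{x\}=\mathrm{Pa}(y)$. The algorithm \textsc{chickering-enum} takes a CPDAG $G$, chooses any DAG $D_0\in[G]$, sets $\mathrm{vis}:=\{D_0\}$ and calls $\mathrm{enumerate}(D_0)$. A call $\mathrm{enumerate}(D)$ outputs $D$ and then, for each $D'$ obtained by reversing a covered edge of $D$ (in any order), if $D'\notin\mathrm{vis}$ (where $\mathrm{vis}$ is shared by all calls), adds $D'$ to $\mathrm{vis}$ and calls $\mathrm{enumerate}(D')$. The bounded version of \textsc{chickering-enum} reverses every edge at most once along each branch of the recursion: in a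 call for $D$, only those covered edges of $D$ are considered that still have the same direction as in $D_0$. **Theorem.** The following holds for \textsc{chickering-enum} and also for its bounded version. 1. For every MEC, with CPDAG $G$, every $D_0\in[G]$ and every order in which the loops run through the DAGs $D'$, the algorithm terminates and outputs every DAG in $[G]$ exactly once and nothing else. In the bounded version the recursion depth (the initial call having depth $0$) is at most $m$. 2. The algorithm can be implemented with worst-case delay $O(m^3)$: there are a program for a unit-cost random access machine (with increment, decrement, comparison of registers, and indirect access to arrays as its basic operations) and an absolute constant $C$ such that, for every MEC and every list of the edges of its CPDAG $G$ as the input, the program halts, the sequence of its outputs is the output sequence of a run of the algorithm on $G$ (for some choice of $D_0$ and of the loop orders), each DAG being written out as a list of its arcs, and at most $C(m^3+1)$ steps pass from the start to the first output, between any two consecutive outputs, and from the last output to the end. -/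

import Mathlib

namespace Chickering

/-! ## DAGs, d-separation, Markov equivalence, CPDAGs -/

section Graphs

variable {V : Type*}

/-- No directed cycle. In particular there are no loops and no two opposite arcs,
so all edges are directed. -/
def IsDAG (D : Digraph V) : Prop :=
  ∀ v, ¬ Relation.TransGen D.Adj v v

/-- A path: distinct vertices, consecutive ones adjacent by an edge of any direction. -/
def IsPath (D : Digraph V) (p : List V) : Prop :=
  p.Nodup ∧ p.IsChain (fun u v => D.Adj u v ∨ D.Adj v u)

/-- The path `p` is active given `Z`: each collider `a → b ← c` on `p` has a descendant
(possibly itself) in `Z`, and no other inner vertex of `p` lies in `Z`. -/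
def IsActive (D : Digraph V) (Z : Set V) (p : List V) : Prop :=
  ∀ a b c, [a, b, c] <:+: p →
    ((D.Adj a b ∧ D.Adj c b) → ∃ z ∈ Z, Relation.ReflTransGen D.Adj b z) ∧
    (¬ (D.Adj a b ∧ D.Adj c b) → b ∉ Z)

/-- `X` and `Y` are d-separated by `Z` in `D`: no path from `X` to `Y` is active given `Z`. -/
def DSep (D : Digraph V) (X Y Z : Set V) : Prop :=
  ∀ x ∈ X, ∀ y ∈ Y, ∀ p : List V, IsPath D p → p.head? = some x → p.getLast? = some y →
    ¬ IsActive D Z p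

/-- `D` and `D'` encode the same conditional independence relations. -/
def MarkovEquiv (D D' : Digraph V) : Prop :=
  ∀ X Y Z : Set V, Disjoint X Y → Disjoint X Z → Disjoint Y Z →
    (DSep D X Y Z ↔ DSep D' X Y Z)

/-- `M` is a Markov equivalence class: all DAGs that are Markov equivalent to some DAG. -/
def IsMEC (M : Set (Digraph V)) : Prop :=
  ∃ D, IsDAG D ∧ M = {D' | IsDAG D' ∧ MarkovEquiv D D'}

/-- The CPDAG of a class: the union of its members. An edge `u - v` is undirected
if both arcs are present. -/
def cpdag (M : Set (Digraph V)) : Digraph V := sSup M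

/-- The number of edges, where an undirected edge counts once. -/
noncomputable def edgeCount (G : Digraph V) : ℕ :=
  {e : Sym2 V | ∃ u v, G.Adj u v ∧ e = s(u, v)}.ncard

/-- The set of parents. -/
def parents (D : Digraph V) (v : V) : Set V := {u | D.Adj u v}

/-- The edge `x → y` of `D` is covered. -/
def Covered (D : Digraph V) (x y : V) : Prop :=
  D.Adj x y ∧ parents D x ∪ {x} = parents D y

/-- `D` with the arc `x → y` replaced by `y → x`. -/
def reverseEdge (D : Digraph V) (x y : V) : Digraph V where
  Adj a b := (D.Adj a b ∧ ¬ (a = x ∧ b = y)) ∨ (a = y ∧ b = x)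

end Graphs

/-! ## The algorithm chickering-enum -/

section Algorithm

variable {V : Type*}

/-- `D'` is one of the DAGs over which the loop in the call for `D` ranges, if the algorithm
was started at `D₀`: it arises from `D` by reversing a covered edge. If `once` is set, every edge
may be reversed at most once along a branch of the recursion; that is, only edges that still
have the direction that they have in `D₀` may be reversed. -/
def Candidate (once : Bool) (D₀ D D' : Digraph V) : Prop :=
  ∃ x y, Covered D x y ∧ (once = true → D₀.Adj x y) ∧ D' = reverseEdge D x y

/-- `order D` lists, without repetition, what the loop in the call for `D` ranges over. -/
def IsOrder (once : Bool) (D₀ : Digraph V) (M : Set (Digraph V))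
    (order : Digraph V → List (Digraph V)) : Prop :=
  ∀ D ∈ M, (order D).Nodup ∧ ∀ D', D' ∈ order D ↔ Candidate once D₀ D D'

/-- `Loop order L vis out vis' d`: the for-each loop over the list `L`, entered with the visited
set `vis`, outputs the list `out`, leaves the visited set `vis'`, and nests recursive calls at most
`d` deep (`d` is the exact maximum). A call for `D` outputs `D` and runs the loop over `order D`. -/
inductive Loop (order : Digraph V → List (Digraph V)) :
    List (Digraph V) → Set (Digraph V) → List (Digraph V) → Set (Digraph V) → ℕ → Prop
  | nil (vis : Set (Digraph V)) : Loop order [] vis [] vis 0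
  | skip {D : Digraph V} {L out : List (Digraph V)} {vis vis' : Set (Digraph V)} {d : ℕ} :
      D ∈ vis → Loop order L vis out vis' d → Loop order (D :: L) vis out vis' d
  | call {D : Digraph V} {L out₁ out₂ : List (Digraph V)} {vis vis₁ vis₂ : Set (Digraph V)}
      {d₁ d₂ : ℕ} :
      D ∉ vis →
      Loop order (order D) (insert D vis) out₁ vis₁ d₁ →
      Loop order L vis₁ out₂ vis₂ d₂ →
      Loop order (D :: L) vis ((D :: out₁) ++ out₂) vis₂ (max (d₁ + 1) d₂)

/-- chickering-enum, started at `D₀` with visited set `{D₀}`, terminates, outputs the list `out`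
in this order, and has recursion depth `d` (the initial call has depth `0`). -/
def Run (order : Digraph V → List (Digraph V)) (D₀ : Digraph V)
    (out : List (Digraph V)) (d : ℕ) : Prop :=
  ∃ rest vis, Loop order (order D₀) {D₀} rest vis d ∧ out = D₀ :: rest

end Algorithm

/-! ## A random access machine

Structured programs over finitely many registers and arrays of natural numbers, with unit cost.
The only arithmetic is adding or subtracting one; hence no number ever exceeds the sum of the
largest number in the input or the program and the number of steps made so far: the machine
works with words of logarithmic length. -/

section Machine

/-- The state of the machine. `time` counts the steps; `buf` is what was written since the
last completed output; `outs` lists the completed outputs, each with its completion time. -/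
structure State where
  reg : ℕ → ℕ
  arr : ℕ → ℕ → ℕ
  time : ℕ
  buf : List ℕ
  outs : List (ℕ × List ℕ)

/-- Instructions. Their arguments are names of registers, except that `c` is a constant and
`a` is the name of an array. -/
inductive Instr where
  | skip
  | const (x c : ℕ)
  | copy (x y : ℕ)
  | inc (x : ℕ)
  | dec (x : ℕ)
  | load (x a i : ℕ)
  | store (a i x : ℕ)
  | emit (x : ℕ)
  | finish

/-- `x := v` -/
def State.setReg (s : State) (x v : ℕ) : State :=
  { s with reg := Function.update s.reg x v }

/-- `a[i] := v` -/
def State.setArr (s : State) (a i v : ℕ) : State :=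
  { s with arr := Function.update s.arr a (Function.update (s.arr a) i v) }

/-- One step of the clock. -/
def State.tick (s : State) : State := { s with time := s.time + 1 }

/-- The effect of an instruction, which takes one step. -/
def Instr.exec (s : State) : Instr → State
  | .skip => s.tick
  | .const x c => (s.setReg x c).tick
  | .copy x y => (s.setReg x (s.reg y)).tick
  | .inc x => (s.setReg x (s.reg x + 1)).tick
  | .dec x => (s.setReg x (s.reg x - 1)).tick
  | .load x a i => (s.setReg x (s.arr a (s.reg i))).tick
  | .store a i x => (s.setArr a (s.reg i) (s.reg x)).tick
  | .emit x => { s.tick with buf := s.buf ++ [s.reg x] }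
  | .finish => { s.tick with buf := [], outs := s.outs ++ [(s.time + 1, s.buf)] }

/-- Comparisons of two registers. -/
inductive Test where
  | eq (x y : ℕ)
  | lt (x y : ℕ)

/-- The truth value of a comparison. -/
def Test.Holds (s : State) : Test → Prop
  | .eq x y => s.reg x = s.reg y
  | .lt x y => s.reg x < s.reg y

/-- Programs. -/
inductive Prog where
  | instr (I : Instr)
  | seq (P Q : Prog)
  | cond (b : Test) (P Q : Prog)
  | loop (b : Test) (P : Prog)

/-- `Exec P s s'`: the program `P`, started in `s`, halts in `s'`. Each evaluation of a
comparison takes one step. -/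
inductive Exec : Prog → State → State → Prop
  | instr (I : Instr) (s : State) : Exec (.instr I) s (I.exec s)
  | seq {P Q : Prog} {s s₁ s₂ : State} :
      Exec P s s₁ → Exec Q s₁ s₂ → Exec (.seq P Q) s s₂
  | cond_true {b : Test} {P Q : Prog} {s s' : State} :
      b.Holds s → Exec P s.tick s' → Exec (.cond b P Q) s s'
  | cond_false {b : Test} {P Q : Prog} {s s' : State} :
      ¬ b.Holds s → Exec Q s.tick s' → Exec (.cond b P Q) s s'
  | loop_true {b : Test} {P : Prog} {s s₁ s₂ : State} :
      b.Holds s → Exec P s.tick s₁ → Exec (.loop b P) s₁ s₂ → Exec (.loop b P) s s₂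
  | loop_false {b : Test} {P : Prog} {s : State} :
      ¬ b.Holds s → Exec (.loop b P) s s.tick

/-- `es` lists every edge of `G` exactly once: a directed edge `u → v` as `(u, v, true)`, an
undirected edge `u - v` as `(u, v, false)` or `(v, u, false)`. -/
def IsEdgeList {n : ℕ} (G : Digraph (Fin n)) (es : List (Fin n × Fin n × Bool)) : Prop :=
  es.Pairwise (fun e f => s(e.1, e.2.1) ≠ s(f.1, f.2.1)) ∧
  (∀ e ∈ es, G.Adj e.1 e.2.1 ∧ (e.2.2 = true ↔ ¬ G.Adj e.2.1 e.1)) ∧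
  ∀ u v, G.Adj u v → ∃ e ∈ es, s(e.1, e.2.1) = s(u, v)

/-- The initial state on the input graph with vertices `0, …, n - 1` and the edge list `es`:
registers `0` and `1` hold the numbers of vertices and of edges, arrays `0`, `1`, `2` hold the two
endpoints and the kind (`1` for directed, `0` for undirected) of the edges, and everything else
is `0`. -/
def initialState (n : ℕ) (es : List (Fin n × Fin n × Bool)) : State where
  reg := fun r => if r = 0 then n else if r = 1 then es.length else 0
  arr := fun a i =>
    match es[i]? with
    | none => 0
    | some e => if a = 0 then e.1.val else if a = 1 then e.2.1.val
        else if a = 2 then e.2.2.toNat else 0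
  time := 0
  buf := []
  outs := []

/-- The word `w` is a list `u₁ v₁ u₂ v₂ …` of the arcs `uᵢ → vᵢ` of `D`, each exactly once. -/
def IsWordOf {n : ℕ} (D : Digraph (Fin n)) (w : List ℕ) : Prop :=
  ∃ arcs : List (Fin n × Fin n), arcs.Nodup ∧ (∀ u v, (u, v) ∈ arcs ↔ D.Adj u v) ∧
    w = arcs.flatMap (fun e => [e.1.val, e.2.val])

/-- The delay is at most `B`: at most `B` steps pass from the start to the first output, between
two consecutive outputs, and from the last output to the end. -/
def DelayAtMost (s : State) (B : ℕ) : Prop :=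
  (0 :: (s.outs.map Prod.fst ++ [s.time])).IsChain (fun t t' => t' ≤ t + B)

/-- On the input `es`, the program `P` halts, outputs exactly the graphs in the list `out`, in
this order, and has delay at most `B`. -/
def OutputsWithDelay {n : ℕ} (P : Prog) (es : List (Fin n × Fin n × Bool))
    (out : List (Digraph (Fin n))) (B : ℕ) : Prop :=
  ∃ s : State, Exec P (initialState n es) s ∧
    List.Forall₂ IsWordOf out (s.outs.map Prod.snd) ∧ DelayAtMost s B

end Machine

end Chickering

namespace Chickering

/-! ### DAGs, d-separation, and what Markov equivalence determines -/

section GraphTheory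

variable {V : Type*} {D D' : Digraph V}

/-! Completeness of the enumeration rests on Chickering's theorem. Markov equivalent DAGs share
skeleton and v-structures (`MarkovEquiv.similar`): nonadjacent vertices are separated by the parents
of one of them, and a separator of the ends of a path a - b - c avoids b if b is a collider and
contains b otherwise. Conversely, let two different DAGs share skeleton and v-structures. Let y be
the topologically first vertex of the first DAG that is entered by an arc reversed in the second,
and x the last tail of such an arc. Then x → y is covered (`exists_covered_of_ne`). Reversing a
covered edge preserves acyclicity and all d-separations (`Covered.markovEquiv`), so any member of a
class is reached from any other by covered reversals, each of which repairs a differing edge. The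
set visited by the algorithm is closed under the reversals considered, hence it is the whole class.
On such a chain from the start to a target no edge is turned twice, so the bounded version misses
nothing either; there every nested call raises the number of edges that differ from the start by
one, which bounds the depth.

For the implementation, a starting DAG is found in the manner of Dor and Tarsi by repeatedly
eliminating a possible sink x: no living directed edge leaves x, and whenever a living undirected
edge joins x to y, the vertex y is adjacent to all other living neighbours of x. A sink of the
living part of any member of the class qualifies (`Elim.exists_not_bad`), so the elimination never
gets stuck. There are m rounds of quadratic cost, and this is the only cubic part.

In the search a DAG is a vector of m bits, the edges reversed relative to the start. A trie of the
vectors found makes lookup and insertion linear, so a single step of the depth-first search (deal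
with one edge, or return from a call) costs O(m). Returning through many calls may take long without
finding anything, so the DAGs found enter a queue, from which one is released every m + 1 steps.
Each DAG accounts for exactly m + 1 steps, m edges and one return; the potential `Config.left` turns
this into the identity "steps made + steps left = (m + 1) · DAGs found". Hence the queue is never
empty when a release is due, and it is exhausted exactly when the search stops. As the queue keeps
the order, the outputs are those of a run of the algorithm. -/

theorem IsDAG.irrefl (hD : IsDAG D) (v : V) : ¬ D.Adj v v :=
  fun h => hD v (.single h)

theorem IsDAG.asymm (hD : IsDAG D) {u v : V} (h : D.Adj u v) : ¬ D.Adj v u :=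
  fun h' => hD u (.tail (.single h) h')

/-- A finite DAG has a topological numbering. -/
theorem IsDAG.exists_rank [Finite V] (hD : IsDAG D) :
    ∃ ρ : V → ℕ, ∀ u v, D.Adj u v → ρ u < ρ v :=
  ⟨fun v => {u | Relation.TransGen D.Adj u v}.ncard, fun u _ h =>
    Set.ncard_lt_ncard ⟨fun _ hw => hw.tail h, fun hs => hD u (hs (.single h))⟩
      (Set.toFinite _)⟩

theorem IsDAG.of_rank (ρ : V → ℕ) (h : ∀ u v, D.Adj u v → ρ u < ρ v) : IsDAG D := by
  intro v hv
  have key : ∀ w, Relation.TransGen D.Adj v w → ρ v < ρ w := by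
    intro w hw
    induction hw with
    | single h' => exact h _ _ h'
    | tail _ h' ih => exact ih.trans (h _ _ h')
  exact lt_irrefl _ (key v hv)

/-- Adjacency in the skeleton. -/
def Adjacent (D : Digraph V) (u v : V) : Prop := D.Adj u v ∨ D.Adj v u

theorem Adjacent.symm {u v : V} (h : Adjacent D u v) : Adjacent D v u := Or.symm h

/-- `a → b ← c` with `a` and `c` distinct and not adjacent. -/
def VStruct (D : Digraph V) (a b c : V) : Prop :=
  D.Adj a b ∧ D.Adj c b ∧ a ≠ c ∧ ¬ Adjacent D a c

/-- Same skeleton and same v-structures. -/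
structure Similar (D D' : Digraph V) : Prop where
  skel : ∀ u v, Adjacent D u v ↔ Adjacent D' u v
  vstr : ∀ a b c, VStruct D a b c ↔ VStruct D' a b c

theorem Similar.symm (h : Similar D D') : Similar D' D :=
  ⟨fun u v => (h.skel u v).symm, fun a b c => (h.vstr a b c).symm⟩

theorem Similar.trans {D'' : Digraph V} (h : Similar D D') (h' : Similar D' D'') :
    Similar D D'' :=
  ⟨fun u v => (h.skel u v).trans (h'.skel u v), fun a b c => (h.vstr a b c).trans (h'.vstr a b c)⟩

theorem MarkovEquiv.refl (D : Digraph V) : MarkovEquiv D D := fun _ _ _ _ _ _ => Iff.rfl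

theorem MarkovEquiv.symm (h : MarkovEquiv D D') : MarkovEquiv D' D :=
  fun X Y Z a b c => (h X Y Z a b c).symm

theorem MarkovEquiv.trans {D'' : Digraph V} (h : MarkovEquiv D D') (h' : MarkovEquiv D' D'') :
    MarkovEquiv D D'' :=
  fun X Y Z a b c => (h X Y Z a b c).trans (h' X Y Z a b c)

/-! ### Active walks -/

/-- The condition on an inner vertex `b` of an active walk, between `a` and `c`. -/
def TripleOK (D : Digraph V) (Z : Set V) (a b c : V) : Prop :=
  ((D.Adj a b ∧ D.Adj c b) → ∃ z ∈ Z, Relation.ReflTransGen D.Adj b z) ∧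
    (¬ (D.Adj a b ∧ D.Adj c b) → b ∉ Z)

theorem isActive_cons {Z : Set V} {a b c : V} {l : List V} :
    IsActive D Z (a :: b :: c :: l) ↔ TripleOK D Z a b c ∧ IsActive D Z (b :: c :: l) := by
  constructor
  · intro h
    refine ⟨h a b c ⟨[], l, by simp⟩, fun x y z hi => h x y z (hi.trans ?_)⟩
    exact List.infix_cons List.infix_rfl
  · rintro ⟨h, h'⟩ x y z hi
    rcases List.infix_cons_iff.1 hi with hp | hi
    · simp only [List.cons_prefix_cons] at hp
      obtain ⟨rfl, rfl, rfl, -⟩ := hp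
      exact h
    · exact h' x y z hi

theorem isActive_short {Z : Set V} {l : List V} (h : l.length ≤ 2) : IsActive D Z l := by
  intro a b c hi
  have := hi.length_le
  simp at this
  omega

theorem IsActive.of_infix {Z : Set V} {l l' : List V} (h : IsActive D Z l') (hi : l <:+: l') :
    IsActive D Z l := fun a b c h' => h a b c (h'.trans hi)

theorem IsActive.reverse {Z : Set V} {l : List V} (h : IsActive D Z l) :
    IsActive D Z l.reverse := by
  intro a b c hi
  have h' := h c b a (by simpa using List.reverse_infix.2 hi)
  rwa [and_comm (a := D.Adj c b)] at h'

theorem isChain_adjacent_reverse {l : List V} (h : l.IsChain (Adjacent D)) :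
    l.reverse.IsChain (Adjacent D) := by
  rw [List.isChain_reverse]
  exact h.imp fun _ _ h => h.symm

/-- An active walk that starts with a forward arc leads forward to its end or to `Z`. -/
theorem active_descend {Z : Set V} {y : V} (l : List V) : ∀ {a b : V}, D.Adj a b →
    (a :: b :: l).IsChain (Adjacent D) → IsActive D Z (a :: b :: l) →
    (a :: b :: l).getLast? = some y →
    Relation.TransGen D.Adj a y ∨ ∃ z ∈ Z, Relation.TransGen D.Adj a z := by
  induction l with
  | nil =>
    intro a b hab _ _ hl
    simp at hl
    subst hl
    exact .inl (.single hab)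
  | cons c l ih =>
    intro a b hab hch hact hl
    rw [isActive_cons] at hact
    rw [List.isChain_cons_cons] at hch
    by_cases hcb : D.Adj c b
    · obtain ⟨z, hz, h⟩ := hact.1.1 ⟨hab, hcb⟩
      exact .inr ⟨z, hz, Relation.TransGen.head' hab h⟩
    · have hbc : D.Adj b c := ((List.isChain_cons_cons.1 hch.2).1).resolve_right hcb
      rcases ih hbc hch.2 hact.2 (by simpa using hl) with h | ⟨z, hz, h⟩
      · exact .inl (.head hab h)
      · exact .inr ⟨z, hz, .head hab h⟩

/-- The part of an active walk between two visits of `b` can be cut out. -/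
theorem active_cut (hD : IsDAG D) {Z : Set V} {b : V} {l₂ l₃ : List V} : ∀ l₁ : List V,
    (l₁ ++ b :: (l₂ ++ b :: l₃)).IsChain (Adjacent D) → IsActive D Z (l₁ ++ b :: (l₂ ++ b :: l₃)) →
    IsActive D Z (l₁ ++ b :: l₃)
  | [], _, h => h.of_infix ⟨b :: l₂, [], by simp⟩
  | [a], hch, h => by
    cases l₃ with
    | nil => exact isActive_short (by simp)
    | cons c l₃ =>
      refine isActive_cons.2 ⟨?_, h.of_infix ⟨a :: b :: l₂, [], by simp⟩⟩
      have hab : Adjacent D a b := by simp at hch; exact hch.1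
      rcases List.eq_nil_or_concat l₂ with rfl | ⟨l', e, he⟩
      · simp only [List.cons_append, List.nil_append, List.isChain_cons_cons] at hch
        exact absurd hch.2.1 (by simp [Adjacent, hD.irrefl])
      · have h1 : TripleOK D Z e b c := h e b c ⟨a :: b :: l', l₃, by simp [he]⟩
        obtain ⟨d, l'', hd⟩ : ∃ d l'', l₂ = d :: l'' := by
          cases l₂ with
          | nil => simp at he
          | cons d l => exact ⟨d, l, rfl⟩
        have h2 : TripleOK D Z a b d := h a b d ⟨[], l'' ++ b :: c :: l₃, by simp [hd]⟩
        constructor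
        -- New collider a → b ← c. If the removed detour enters b from d, then b was a collider
        -- already. Otherwise the detour leaves b forward, and since it cannot lead forward back to
        -- b, it leads forward into Z.
        · rintro ⟨h3, h4⟩
          by_cases hdb : D.Adj d b
          · exact h2.1 ⟨h3, hdb⟩
          · have hinf : b :: d :: (l'' ++ [b]) <:+: [a] ++ b :: (l₂ ++ b :: c :: l₃) :=
              ⟨[a], c :: l₃, by simp [hd]⟩
            have hch' := hch.infix hinf
            have hbd : D.Adj b d := (List.isChain_cons_cons.1 hch').1.resolve_right hdb
            rcases active_descend (y := b) _ hbd hch' (h.of_infix hinf)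
              (by simp [List.getLast?_cons, List.getLast?_append]) with h5 | ⟨z, hz, h5⟩
            · exact absurd h5 (hD b)
            · exact ⟨z, hz, h5.to_reflTransGen⟩
        -- If b is no collider after the cut, then it was no collider on one of its two visits,
        -- namely on the side whose arc does not point into b.
        · intro h3
          by_cases h4 : D.Adj a b
          · exact h1.2 fun h5 => h3 ⟨h4, h5.2⟩
          · exact h2.2 fun h5 => h4 h5.1
  | [a, a'], hch, h => by
    refine isActive_cons.2 ⟨h a a' b ⟨[], l₂ ++ b :: l₃, by simp⟩, ?_⟩
    exact active_cut hD [a'] (List.isChain_cons_cons.1 hch).2 (isActive_cons.1 h).2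
  | a :: a' :: a'' :: l, hch, h => by
    refine isActive_cons.2 ⟨h a a' a'' ⟨[], l ++ b :: (l₂ ++ b :: l₃), by simp⟩, ?_⟩
    exact active_cut hD (a' :: a'' :: l) (List.isChain_cons_cons.1 hch).2 (isActive_cons.1 h).2

theorem isChain_cut {R : V → V → Prop} {b : V} {l₁ l₂ l₃ : List V}
    (h : (l₁ ++ b :: (l₂ ++ b :: l₃)).IsChain R) : (l₁ ++ b :: l₃).IsChain R := by
  rw [List.isChain_split] at h ⊢
  refine ⟨h.1, ?_⟩
  exact h.2.infix ⟨b :: l₂, [], by simp⟩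

/-- An active walk contains an active path with the same ends. -/
theorem exists_active_path (hD : IsDAG D) {Z : Set V} {x y : V} (N : ℕ) : ∀ p : List V,
    p.length ≤ N → p.IsChain (Adjacent D) → IsActive D Z p → p.head? = some x →
    p.getLast? = some y → ∃ q, IsPath D q ∧ IsActive D Z q ∧ q.head? = some x ∧
      q.getLast? = some y := by
  induction N with
  | zero => intro p hp _ _ hh; cases p <;> simp_all
  | succ N ih =>
    intro p hp hch hact hx hy
    by_cases hn : p.Nodup
    · exact ⟨p, ⟨hn, hch⟩, hact, hx, hy⟩
    · obtain ⟨b, hb⟩ := List.exists_duplicate_iff_not_nodup.2 hn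
      obtain ⟨l₁, l', rfl, h1⟩ : ∃ l₁ l', p = l₁ ++ b :: l' ∧ b ∈ l' := by
        clear * - hb
        induction hb with
        | cons_mem h => exact ⟨[], _, rfl, h⟩
        | @cons_duplicate c l _ ih =>
          obtain ⟨l₁, l', rfl, h⟩ := ih
          exact ⟨c :: l₁, l', rfl, h⟩
      obtain ⟨l₂, l₃, rfl⟩ := List.append_of_mem h1
      refine ih (l₁ ++ b :: l₃) ?_ (isChain_cut hch) (active_cut hD _ hch hact) ?_ ?_
      · simp at hp ⊢; omega
      · cases l₁ <;> simpa using hx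
      · simpa [List.getLast?_append, List.getLast?_cons] using hy

/-! ### The Bayes ball -/

/-- `Ball D Z x v s`: an active walk leads from `x` to `v`, arriving along an arc into `v`
if `s` is true, and along an arc out of `v` (or without any step) otherwise. -/
inductive Ball (D : Digraph V) (Z : Set V) (x : V) : V → Bool → Prop
  | start : Ball D Z x x false
  | forward {b c : V} {s : Bool} : Ball D Z x b s → b ∉ Z → D.Adj b c → Ball D Z x c true
  | back {b c : V} : Ball D Z x b false → b ∉ Z → D.Adj c b → Ball D Z x c false
  | collide {b c : V} : Ball D Z x b true → (∃ z ∈ Z, Relation.ReflTransGen D.Adj b z) →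
      D.Adj c b → Ball D Z x c false

/-- The flag of the last arc and the direction of the next one decide whether b is a collider, so
activity at b supplies the premise of exactly the rule that is needed to move on. -/
theorem ball_of_active (hD : IsDAG D) {Z : Set V} {x y : V} (l : List V) : ∀ {a b : V} {s : Bool},
    Ball D Z x b s → (if s then D.Adj a b else D.Adj b a) →
    (a :: b :: l).IsChain (Adjacent D) → IsActive D Z (a :: b :: l) →
    (b :: l).getLast? = some y → ∃ s, Ball D Z x y s := by
  induction l with
  | nil =>
    intro a b s hb _ _ _ hl
    simp at hl
    subst hl
    exact ⟨s, hb⟩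
  | cons c l ih =>
    intro a b s hb hs hch hact hl
    rw [isActive_cons] at hact
    have hch' := (List.isChain_cons_cons.1 hch).2
    have hl' : (c :: l).getLast? = some y := by simpa using hl
    rcases (List.isChain_cons_cons.1 hch').1 with hbc | hcb
    · have hbZ : b ∉ Z := hact.1.2 fun h => hD.asymm hbc h.2
      exact ih (hb.forward hbZ hbc) (by simpa using hbc) hch' hact.2 hl'
    · cases s with
      | true =>
        exact ih (hb.collide (hact.1.1 ⟨by simpa using hs, hcb⟩) hcb) (by simpa using hcb) hch'
          hact.2 hl'
      | false =>
        have hbZ : b ∉ Z := hact.1.2 fun h => hD.asymm h.1 (by simpa using hs)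
        exact ih (hb.back hbZ hcb) (by simpa using hcb) hch' hact.2 hl'

/-- The walk is built from the position of the ball back to x, so that each move is a cons. Only the
direction of its first arc has to be remembered, because the condition on the next triple depends on
nothing else. -/
theorem Ball.exists_walk (hD : IsDAG D) {Z : Set V} {x y : V} {s : Bool} (h : Ball D Z x y s) :
    y = x ∨ ∃ a l, (if s then D.Adj a y else D.Adj y a) ∧
      (y :: a :: l).IsChain (Adjacent D) ∧ IsActive D Z (y :: a :: l) ∧
      (y :: a :: l).getLast? = some x := by
  have ext : ∀ {b c : V} {s t : Bool}, (b = x ∨ ∃ a l, (if s then D.Adj a b else D.Adj b a) ∧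
      (b :: a :: l).IsChain (Adjacent D) ∧ IsActive D Z (b :: a :: l) ∧
      (b :: a :: l).getLast? = some x) → (if t then D.Adj b c else D.Adj c b) →
      (∀ a, (if s then D.Adj a b else D.Adj b a) → TripleOK D Z c b a) →
      c = x ∨ ∃ a l, (if t then D.Adj a c else D.Adj c a) ∧
      (c :: a :: l).IsChain (Adjacent D) ∧ IsActive D Z (c :: a :: l) ∧
      (c :: a :: l).getLast? = some x := by
    intro b c s t hb ht hok
    have hadj : Adjacent D c b := by
      cases t
      · exact .inl (by simpa using ht)
      · exact .inr (by simpa using ht)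
    rcases hb with rfl | ⟨a, l, h1, h2, h3, h4⟩
    · exact .inr ⟨b, [], ht, by simpa using hadj, isActive_short (by simp), by simp⟩
    · exact .inr ⟨b, a :: l, ht, List.isChain_cons_cons.2 ⟨hadj, h2⟩,
        isActive_cons.2 ⟨hok a h1, h3⟩, by simpa using h4⟩
  induction h with
  | start => exact .inl rfl
  | @forward b c s _ hb h ih =>
    exact ext ih (by simpa using h) fun a _ =>
      ⟨fun h' => absurd h (hD.asymm h'.1), fun _ => hb⟩
  | @back b c _ hb h ih =>
    exact ext ih (by simpa using h) fun a ha =>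
      ⟨fun h' => absurd h'.2 (hD.asymm (by simpa using ha)), fun _ => hb⟩
  | @collide b c _ hz h ih =>
    exact ext ih (by simpa using h) fun a ha =>
      ⟨fun _ => hz, fun h' => absurd ⟨h, by simpa using ha⟩ h'⟩

/-- Balls follow walks, and `exists_active_path` shortens these to paths. Disjointness of X and Z
enters because the ball treats its start like an inner vertex that must avoid Z, whereas the ends of
a path are not tested. -/
theorem dsep_iff_ball (hD : IsDAG D) {X Y Z : Set V} (hXZ : Disjoint X Z) :
    DSep D X Y Z ↔ ∀ x ∈ X, ∀ y ∈ Y, ∀ s, ¬ Ball D Z x y s := by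
  constructor
  · intro h x hx y hy s hb
    have hw : ∃ p : List V, p.IsChain (Adjacent D) ∧ IsActive D Z p ∧ p.head? = some y ∧
        p.getLast? = some x := by
      rcases hb.exists_walk hD with rfl | ⟨a, l, -, h1, h2, h3⟩
      · exact ⟨[y], by simp, isActive_short (by simp), rfl, rfl⟩
      · exact ⟨_, h1, h2, rfl, h3⟩
    obtain ⟨p, h1, h2, h3, h4⟩ := hw
    obtain ⟨q, hq, hqa, hqx, hqy⟩ := exists_active_path hD _ p.reverse le_rfl
      (isChain_adjacent_reverse h1) h2.reverse (by simpa using h4) (by simpa using h3)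
    exact h x hx y hy q hq hqx hqy hqa
  · intro h x hx y hy p hp hpx hpy hact
    have hxZ : x ∉ Z := fun hz => Set.disjoint_left.1 hXZ hx hz
    have hch : p.IsChain (Adjacent D) := hp.2
    match p, hpx with
    | [_], rfl =>
      simp at hpy
      subst hpy
      exact h _ hx _ hy _ .start
    | x :: b :: l, rfl =>
      rcases (List.isChain_cons_cons.1 hch).1 with hb | hb
      · obtain ⟨s, hs⟩ := ball_of_active hD l (Ball.start.forward hxZ hb) (by simpa using hb)
          hch hact (by simpa using hpy)
        exact h _ hx _ hy _ hs
      · obtain ⟨s, hs⟩ := ball_of_active hD l (Ball.start.back hxZ hb) (by simpa using hb)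
          hch hact (by simpa using hpy)
        exact h _ hx _ hy _ hs

/-! ### Markov equivalent DAGs are similar -/

theorem dsep_symm {X Y Z : Set V} (h : DSep D X Y Z) : DSep D Y X Z := by
  intro y hy x hx p hp hpy hpx hact
  refine h x hx y hy p.reverse ⟨List.nodup_reverse.2 hp.1, ?_⟩ (by simpa using hpx)
    (by simpa using hpy) hact.reverse
  exact isChain_adjacent_reverse hp.2

/-- An active path leaving x forward would lead forward to y or to a parent of x, and the latter
closes a cycle. A path leaving x backward is blocked at its second vertex, which is a parent of x
and not a collider. -/
theorem dsep_parents (hD : IsDAG D) {x y : V} (hxy : x ≠ y) (hn : ¬ Adjacent D x y)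
    (hr : ¬ Relation.TransGen D.Adj x y) : DSep D {x} {y} (parents D x) := by
  rintro _ rfl _ rfl p hp hpx hpy hact
  have hch : p.IsChain (Adjacent D) := hp.2
  match p, hpx with
  | [_], rfl => simp at hpy; exact hxy hpy
  | [x, b], rfl =>
    simp at hpy
    subst hpy
    exact hn (by simpa using hch)
  | x :: b :: c :: l, rfl =>
    rcases (List.isChain_cons_cons.1 hch).1 with hb | hb
    · rcases active_descend _ hb hch hact hpy with h | ⟨z, hz, h⟩
      · exact hr h
      · exact hD x (h.tail hz)
    · exact (isActive_cons.1 hact).1.2 (fun h => hD.asymm hb h.1) hb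

/-- By acyclicity one of the two vertices is not an ancestor of the other; its parents separate
them. -/
theorem exists_separator (hD : IsDAG D) {x y : V} (hxy : x ≠ y) (hn : ¬ Adjacent D x y) :
    ∃ Z : Set V, x ∉ Z ∧ y ∉ Z ∧ DSep D {x} {y} Z := by
  by_cases hr : Relation.TransGen D.Adj x y
  · refine ⟨parents D y, fun h => hn (.inl h), hD.irrefl y, dsep_symm ?_⟩
    exact dsep_parents hD hxy.symm (fun h => hn h.symm) fun h => hD x (hr.trans h)
  · exact ⟨parents D x, hD.irrefl x, fun h => hn (.inr h), dsep_parents hD hxy hn hr⟩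

theorem not_dsep_of_adjacent {x y : V} {Z : Set V} (hxy : x ≠ y) (h : Adjacent D x y) :
    ¬ DSep D {x} {y} Z := fun hs =>
  hs x rfl y rfl [x, y] ⟨by simp [hxy], by simpa [Adjacent] using h⟩ rfl rfl (isActive_short (by simp))

theorem MarkovEquiv.dsep_singleton (h : MarkovEquiv D D') {x y : V} {Z : Set V} (hxy : x ≠ y)
    (hx : x ∉ Z) (hy : y ∉ Z) : DSep D {x} {y} Z ↔ DSep D' {x} {y} Z :=
  h {x} {y} Z (by simpa using hxy) (by simpa using hx) (by simpa using hy)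

theorem MarkovEquiv.adjacent (hD : IsDAG D) (hD' : IsDAG D') (h : MarkovEquiv D D') {u v : V}
    (huv : Adjacent D u v) : Adjacent D' u v := by
  by_contra hn
  have hne : u ≠ v := by
    rintro rfl
    exact hD.irrefl u (huv.elim id id)
  obtain ⟨Z, hu, hv, hs⟩ := exists_separator hD' hne hn
  exact not_dsep_of_adjacent hne huv ((h.dsep_singleton hne hu hv).2 hs)

/-- A set Z separating a and c cannot contain the collider b, since b would open the path a, b, c.
If b were no collider in the other DAG, the same path would be open there because b is not in Z. -/
theorem MarkovEquiv.vStruct (hD : IsDAG D) (hD' : IsDAG D') (h : MarkovEquiv D D') {a b c : V}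
    (hv : VStruct D a b c) : VStruct D' a b c := by
  obtain ⟨hab, hcb, hac, hn⟩ := hv
  have hab' := h.adjacent hD hD' (.inl hab)
  have hcb' := h.adjacent hD hD' (.inl hcb)
  have hn' : ¬ Adjacent D' a c := fun h' => hn (h.symm.adjacent hD' hD h')
  have hnab : a ≠ b := fun e => hD.irrefl b (e ▸ hab)
  have hncb : c ≠ b := fun e => hD.irrefl b (e ▸ hcb)
  have hnd : [a, b, c].Nodup := by simp [hnab, hac, hncb.symm]
  obtain ⟨Z, ha, hc, hs⟩ := exists_separator hD hac hn
  have hs' := (h.dsep_singleton hac ha hc).1 hs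
  have hb : b ∉ Z := by
    intro hb
    refine hs a rfl c rfl [a, b, c] ⟨hnd, by simp [hab, hcb]⟩ rfl rfl ?_
    exact isActive_cons.2 ⟨⟨fun _ => ⟨b, hb, .refl⟩, fun h' => absurd ⟨hab, hcb⟩ h'⟩,
      isActive_short (by simp)⟩
  by_contra hnv
  refine hs' a rfl c rfl [a, b, c] ⟨hnd, ?_⟩ rfl rfl ?_
  · have : [a, b, c].IsChain (Adjacent D') := by simp [hab', hcb'.symm]
    exact this
  · exact isActive_cons.2 ⟨⟨fun h' => absurd ⟨h'.1, h'.2, hac, hn'⟩ hnv, fun _ => hb⟩,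
      isActive_short (by simp)⟩

theorem MarkovEquiv.similar (hD : IsDAG D) (hD' : IsDAG D') (h : MarkovEquiv D D') :
    Similar D D' where
  skel _ _ := ⟨h.adjacent hD hD', h.symm.adjacent hD' hD⟩
  vstr _ _ _ := ⟨h.vStruct hD hD', h.symm.vStruct hD' hD⟩

/-! ### Reversing a covered edge -/

/-- A cycle must use the new arc y → x, hence contains a way from x to y. Its last arc comes from a
parent w ≠ x of y, and w is also a parent of x: this closes a cycle in the original DAG. -/
theorem Covered.isDAG_reverse (hD : IsDAG D) {x y : V} (h : Covered D x y) :
    IsDAG (reverseEdge D x y) := by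
  have hpa : ∀ w, D.Adj w y → w ≠ x → D.Adj w x := by
    intro w hw hne
    have : w ∈ parents D x ∪ {x} := h.2 ▸ hw
    exact this.resolve_right hne
  have keyx : ∀ v, Relation.TransGen (reverseEdge D x y).Adj x v → v ≠ y := by
    have : ∀ v, Relation.TransGen (reverseEdge D x y).Adj x v →
        Relation.TransGen D.Adj x v ∧ v ≠ y := by
      intro v hv
      induction hv with
      | @single c h' =>
        rcases h' with h' | ⟨rfl, rfl⟩
        · exact ⟨.single h'.1, fun e => h'.2 ⟨rfl, e⟩⟩
        · exact absurd h.1 (hD.irrefl _)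
      | @tail b c _ h' ih =>
        rcases h' with h' | ⟨rfl, rfl⟩
        · refine ⟨ih.1.tail h'.1, ?_⟩
          rintro rfl
          exact hD x (ih.1.tail (hpa b h'.1 fun e => hD x (e ▸ ih.1)))
        · exact absurd rfl ih.2
    exact fun v hv => (this v hv).2
  intro v hv
  have hsub : ∀ u w, Relation.TransGen (reverseEdge D x y).Adj u w →
      Relation.TransGen D.Adj u w ∨
        (Relation.ReflTransGen (reverseEdge D x y).Adj u y ∧
          Relation.ReflTransGen (reverseEdge D x y).Adj x w) := by
    intro u w huw
    induction huw with
    | single h' =>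
      rcases h' with h' | ⟨rfl, rfl⟩
      · exact .inl (.single h'.1)
      · exact .inr ⟨.refl, .refl⟩
    | @tail b c hub h' ih =>
      rcases ih with ih | ih
      · rcases h' with h' | ⟨rfl, rfl⟩
        · exact .inl (ih.tail h'.1)
        · exact .inr ⟨hub.to_reflTransGen, .refl⟩
      · exact .inr ⟨ih.1, ih.2.tail h'⟩
  rcases hsub v v hv with h' | ⟨h1, h2⟩
  · exact hD v h'
  · rcases (h2.trans h1).cases_head with e | ⟨c, hc, hcy⟩
    · exact hD.irrefl y (e ▸ h.1)
    · exact keyx y (Relation.TransGen.head' hc hcy) rfl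

theorem Covered.reverse (hD : IsDAG D) {x y : V} (h : Covered D x y) :
    Covered (reverseEdge D x y) y x := by
  have hxy : x ≠ y := fun e => hD.irrefl y (e ▸ h.1)
  refine ⟨.inr ⟨rfl, rfl⟩, ?_⟩
  have h2 : ∀ w, (D.Adj w x ∨ w = x) ↔ D.Adj w y := fun w => by
    have := Set.ext_iff.1 h.2 w
    simpa [parents, or_comm] using this
  have h3 := hD.asymm h.1
  ext w
  simp only [parents, reverseEdge, Set.mem_union, Set.mem_ofPred_eq, Set.mem_singleton_iff]
  have := h2 w
  have := hD.irrefl x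
  by_cases hw : w = x <;> by_cases hw' : w = y <;> simp_all

theorem reverseEdge_reverseEdge (hD : IsDAG D) {x y : V} (h : D.Adj x y) :
    reverseEdge (reverseEdge D x y) y x = D := by
  have h3 := hD.asymm h
  ext a b
  simp only [reverseEdge]
  by_cases h1 : a = x ∧ b = y
  · obtain ⟨rfl, rfl⟩ := h1; simp [h]
  · by_cases h2 : a = y ∧ b = x
    · obtain ⟨rfl, rfl⟩ := h2; simp [h3]; grind
    · simp [h1, h2]

end GraphTheory

/-! ### Covered reversals preserve the class; Chickering's theorem -/

section GraphTheory

variable {V : Type*} {D D' : Digraph V}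

/-- What a ball reaching a vertex in `D` tells about the balls in the DAG with the covered edge
`p → q` reversed. -/
def BallInv (D D' : Digraph V) (Z : Set V) (x p q : V) (v : V) (s : Bool) : Prop :=
  (v ≠ p → v ≠ q → Ball D' Z x v s) ∧
  (v = p → s = true → Ball D' Z x p true ∧ Ball D' Z x q true) ∧
  (v = p → s = false → Ball D' Z x p false ∨ (Ball D' Z x p true ∧ Ball D' Z x q false ∧ q ∉ Z) ∨
    (Ball D' Z x p true ∧ Ball D' Z x q true ∧ ∃ z ∈ Z, Relation.ReflTransGen D.Adj q z)) ∧
  (v = q → s = true → (Ball D' Z x p true ∧ Ball D' Z x q true) ∨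
    (Ball D' Z x p false ∧ Ball D' Z x q false ∧ p ∉ Z) ∨
    (Ball D' Z x p true ∧ Ball D' Z x q false ∧ q ∉ Z)) ∧
  (v = q → s = false → Ball D' Z x q false)

/-- Apart from each other, p and q have the same parents in both DAGs, so a ball coming from such a
parent can be sent into either of them. The alternatives in `BallInv` record which arrivals at p and
q are available in the new DAG when the arc between them has been used; they are chosen so that
every next move can be imitated from each of them. -/
theorem ballInv_of_ball (hD : IsDAG D) {Z : Set V} {x p q : V} (hcov : Covered D p q) {v : V}
    {s : Bool} (h : Ball D Z x v s) : BallInv D (reverseEdge D p q) Z x p q v s := by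
  have hpq := hcov.1
  have hne : p ≠ q := fun e => hD.irrefl q (e ▸ hpq)
  have hqp := hD.asymm hpq
  have hpa : ∀ w, D.Adj w q ↔ D.Adj w p ∨ w = p := fun w => by
    have := Set.ext_iff.1 hcov.2 w
    simpa [parents, or_comm] using this.symm
  have hadj : ∀ a b, (reverseEdge D p q).Adj a b ↔
    (D.Adj a b ∧ ¬ (a = p ∧ b = q)) ∨ (a = q ∧ b = p) := fun _ _ => Iff.rfl
  -- A directed path that reaches p from w and then uses p → q can go from w to q at once, since w
  -- is also a parent of q. Only a path starting at p loses its first arc, whence the second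
  -- alternative.
  have hdesc : ∀ w z, Relation.ReflTransGen D.Adj w z →
      Relation.ReflTransGen (reverseEdge D p q).Adj w z ∨
        (w = p ∧ Relation.ReflTransGen (reverseEdge D p q).Adj q z) := by
    intro w z hw
    induction hw using Relation.ReflTransGen.head_induction_on with
    | refl => exact .inl .refl
    | @head a c h' hcz ih =>
      rcases ih with ih | ⟨rfl, ih⟩
      · by_cases hac : a = p ∧ c = q
        · obtain ⟨rfl, rfl⟩ := hac
          exact .inr ⟨rfl, ih⟩
        · exact .inl (.head (.inl ⟨h', hac⟩) ih)
      · exact .inl (.head (.inl ⟨(hpa _).2 (.inl h'), fun e => hD.irrefl _ (e.1 ▸ h')⟩) ih)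
  have hAn : ∀ w, (∃ z ∈ Z, Relation.ReflTransGen D.Adj w z) →
      (∃ z ∈ Z, Relation.ReflTransGen (reverseEdge D p q).Adj w z) ∨ (w = p ∧
      ∃ z ∈ Z, Relation.ReflTransGen (reverseEdge D p q).Adj q z) := by
    rintro w ⟨z, hz, hw⟩
    rcases hdesc w z hw with h | h
    · exact .inl ⟨z, hz, h⟩
    · exact .inr ⟨h.1, z, hz, h.2⟩
  have hAnq : (∃ z ∈ Z, Relation.ReflTransGen D.Adj q z) →
      ∃ z ∈ Z, Relation.ReflTransGen (reverseEdge D p q).Adj q z := fun h =>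
    (hAn q h).resolve_right fun h' => hne h'.1.symm
  have hpp := hD.irrefl p
  have hqq := hD.irrefl q
  have F : ∀ {b c s}, Ball (reverseEdge D p q) Z x b s → b ∉ Z → (reverseEdge D p q).Adj b c →
      Ball (reverseEdge D p q) Z x c true := Ball.forward
  have K : ∀ {b c}, Ball (reverseEdge D p q) Z x b false → b ∉ Z → (reverseEdge D p q).Adj c b →
      Ball (reverseEdge D p q) Z x c false := Ball.back
  have C : ∀ {b c}, Ball (reverseEdge D p q) Z x b true →
      (∃ z ∈ Z, Relation.ReflTransGen (reverseEdge D p q).Adj b z) → (reverseEdge D p q).Adj c b →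
      Ball (reverseEdge D p q) Z x c false := Ball.collide
  have A1 : ∀ w, D.Adj w p → (reverseEdge D p q).Adj w p := fun w hw =>
    .inl ⟨hw, fun e => hpp (e.1 ▸ hw)⟩
  have A2 : ∀ w, D.Adj w p → (reverseEdge D p q).Adj w q := fun w hw =>
    .inl ⟨(hpa w).2 (.inl hw), fun e => hpp (e.1 ▸ hw)⟩
  have A3 : (reverseEdge D p q).Adj q p := .inr ⟨rfl, rfl⟩
  have A4 : ∀ w, D.Adj p w → w ≠ q → (reverseEdge D p q).Adj p w := fun w hw h =>
    .inl ⟨hw, fun e => h e.2⟩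
  have A5 : ∀ w, D.Adj q w → (reverseEdge D p q).Adj q w := fun w hw =>
    .inl ⟨hw, fun e => hne e.1.symm⟩
  have A6 : ∀ u w, D.Adj u w → u ≠ p → (reverseEdge D p q).Adj u w := fun u w hw h =>
    .inl ⟨hw, fun e => h e.1⟩
  have B0 : Ball (reverseEdge D p q) Z x x false := .start
  clear hadj hdesc hcov
  induction h with
  | start =>
    refine ⟨fun _ _ => B0, ?_, ?_, ?_, ?_⟩ <;> grind
  | @forward b c s hb hbZ h ih =>
    obtain ⟨i1, i2, i3, i4, i5⟩ := ih
    clear hAn hAnq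
    by_cases hbp : b = p
    · subst hbp
      refine ⟨?_, ?_, ?_, ?_, ?_⟩ <;> grind
    · by_cases hbq : b = q
      · subst hbq
        refine ⟨?_, ?_, ?_, ?_, ?_⟩ <;> grind
      · refine ⟨?_, ?_, ?_, ?_, ?_⟩ <;> grind
  | @back b c hb hbZ h ih =>
    obtain ⟨i1, i2, i3, i4, i5⟩ := ih
    clear hAn
    by_cases hbp : b = p
    · subst hbp
      refine ⟨?_, ?_, ?_, ?_, ?_⟩ <;> grind
    · by_cases hbq : b = q
      · subst hbq
        refine ⟨?_, ?_, ?_, ?_, ?_⟩ <;> grind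
      · refine ⟨?_, ?_, ?_, ?_, ?_⟩ <;> grind
  | @collide b c hb hbZ h ih =>
    obtain ⟨i1, i2, i3, i4, i5⟩ := ih
    have hAb := hAn b hbZ
    clear hAn
    by_cases hbp : b = p
    · subst hbp
      refine ⟨?_, ?_, ?_, ?_, ?_⟩ <;> grind
    · by_cases hbq : b = q
      · subst hbq
        refine ⟨?_, ?_, ?_, ?_, ?_⟩ <;> grind
      · refine ⟨?_, ?_, ?_, ?_, ?_⟩ <;> grind

theorem exists_ball_reverse (hD : IsDAG D) {Z : Set V} {x p q : V} (hcov : Covered D p q) {v : V}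
    {s : Bool} (h : Ball D Z x v s) : ∃ s, Ball (reverseEdge D p q) Z x v s := by
  obtain ⟨i1, i2, i3, i4, i5⟩ := ballInv_of_ball hD hcov h
  by_cases hp : v = p
  · cases s <;> grind
  · by_cases hq : v = q
    · cases s <;> grind
    · exact ⟨s, i1 hp hq⟩

/-- The reversal can be undone by another covered reversal, so transporting balls in one direction
gives both implications. -/
theorem Covered.markovEquiv (hD : IsDAG D) {p q : V} (h : Covered D p q) :
    MarkovEquiv D (reverseEdge D p q) := by
  intro X Y Z _ hXZ _
  rw [dsep_iff_ball hD hXZ, dsep_iff_ball (h.isDAG_reverse hD) hXZ]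
  constructor
  · intro H x hx y hy s hb
    obtain ⟨t, ht⟩ := exists_ball_reverse (h.isDAG_reverse hD) (h.reverse hD) hb
    rw [reverseEdge_reverseEdge hD h.1] at ht
    exact H x hx y hy t ht
  · intro H x hx y hy s hb
    obtain ⟨t, ht⟩ := exists_ball_reverse hD h hb
    exact H x hx y hy t ht

/-! ### Chickering's theorem -/

/-- Two different similar DAGs differ in an edge that is covered in the first. -/
theorem exists_covered_of_ne [Finite V] (hD : IsDAG D) (hD' : IsDAG D') (hs : Similar D D')
    (hne : D ≠ D') : ∃ x y, Covered D x y ∧ D'.Adj y x := by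
  obtain ⟨ρ, hρ⟩ := hD.exists_rank
  have hdiff : ∃ y x, D.Adj x y ∧ D'.Adj y x := by
    by_contra hn
    push Not at hn
    apply hne
    ext a b
    constructor
    · intro h
      exact ((hs.skel a b).1 (.inl h)).resolve_right (hn b a h)
    · intro h
      exact ((hs.skel a b).2 (.inl h)).resolve_right fun h' => hn a b h' h
  -- Here y is the topologically first head of a differing arc, so all arcs with earlier heads agree
  -- (`hmin`); x is then the last tail of a differing arc into y.
  obtain ⟨y, ⟨x₀, hx₀⟩, hy⟩ := Set.exists_min_image {y | ∃ x, D.Adj x y ∧ D'.Adj y x} ρ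
    (Set.toFinite _) hdiff
  obtain ⟨x, ⟨hxy, hyx⟩, hx⟩ := Set.exists_max_image {x | D.Adj x y ∧ D'.Adj y x} ρ
    (Set.toFinite _) ⟨x₀, hx₀⟩
  have hmin : ∀ u w, D.Adj u w → ρ w < ρ y → D'.Adj u w := fun u w h hlt =>
    ((hs.skel u w).1 (.inl h)).resolve_right fun h' =>
      absurd (hy w ⟨u, h, h'⟩) (not_le.2 hlt)
  refine ⟨x, y, ⟨hxy, ?_⟩, hyx⟩
  ext w
  simp only [parents, Set.mem_union, Set.mem_ofPred_eq, Set.mem_singleton_iff]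
  constructor
  · rintro (hw | rfl)
    · have hw' := hmin w x hw (hρ _ _ hxy)
      have hwy : Adjacent D w y := by
        by_contra hn
        have hne : w ≠ y := by
          rintro rfl
          exact hD.asymm hxy hw
        have := (hs.vstr w x y).2 ⟨hw', hyx, hne, fun h => hn ((hs.skel w y).2 h)⟩
        exact hD.asymm hxy this.2.1
      refine hwy.resolve_right fun h => ?_
      have := hρ _ _ hw
      have := hρ _ _ hxy
      have := hρ _ _ h
      omega
    · exact hxy
  · intro hw
    by_cases hwx : w = x
    · exact .inr hwx
    refine .inl ?_
    have hadj : Adjacent D w x := by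
      by_contra hn
      have := (hs.vstr w y x).1 ⟨hw, hxy, hwx, hn⟩
      exact hD'.asymm hyx this.2.1
    -- If x → w, then w lies after x, so by the choice of x the arc w → y agrees; x → w agrees
    -- because its head precedes y. Together with y → x this is a cycle in the second DAG.
    refine hadj.resolve_right fun hxw => ?_
    have hwy' : D'.Adj w y := by
      refine ((hs.skel w y).1 (.inl hw)).resolve_right fun h => ?_
      exact absurd (hx w ⟨hw, h⟩) (not_le.2 (hρ _ _ hxw))
    have hxw' := hmin x w hxw (hρ _ _ hw)
    exact hD' x (((Relation.TransGen.single hxw').tail hwy').tail hyx)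

/-- The edges of `D'` that are oriented differently in `D`. -/
def diffEdges (D D' : Digraph V) : Set (Sym2 V) :=
  {e | ∃ u v, D'.Adj u v ∧ ¬ D.Adj u v ∧ e = s(u, v)}

/-- Similar DAGs are connected by a sequence of reversals of covered edges, each of which
reverses an edge that still differs. -/
theorem Similar.induction_covered [Finite V] {P : Digraph V → Prop} (hD : IsDAG D)
    (hD' : IsDAG D') (hs : Similar D D') (h0 : P D)
    (step : ∀ E x y, IsDAG E → Similar E D' → P E → Covered E x y → D'.Adj y x →
      P (reverseEdge E x y)) : P D' := by
  obtain ⟨k, hk⟩ : ∃ k, (diffEdges D' D).ncard = k := ⟨_, rfl⟩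
  induction k using Nat.strong_induction_on generalizing D with
  | _ k ih =>
    by_cases hne : D = D'
    · exact hne ▸ h0
    obtain ⟨x, y, hcov, hyx⟩ := exists_covered_of_ne hD hD' hs hne
    have hd := hcov.isDAG_reverse hD
    have hsim := (hcov.markovEquiv hD).similar hD hd
    refine ih _ ?_ hd (hsim.symm.trans hs) (step D x y hD hs h0 hcov hyx) rfl
    rw [← hk]
    -- The edge between x and y stops differing, and no other edge changes.
    refine Set.ncard_lt_ncard ⟨?_, ?_⟩ (Set.toFinite _)
    · rintro e ⟨u, v, h1, h2, rfl⟩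
      rcases h1 with h1 | ⟨rfl, rfl⟩
      · exact ⟨u, v, h1.1, h2, rfl⟩
      · exact absurd hyx h2
    · intro h
      obtain ⟨u, v, h1, h2, h3⟩ := h ⟨x, y, hcov.1, hD'.asymm hyx, rfl⟩
      rcases Sym2.eq_iff.1 h3 with ⟨rfl, rfl⟩ | ⟨rfl, rfl⟩
      · rcases h1 with h1 | ⟨h1, -⟩
        · exact h1.2 ⟨rfl, rfl⟩
        · exact hD.irrefl x (by rw [h1] at hcov; exact absurd hcov.1 (hD.irrefl _))
      · exact h2 hyx

/-- The hard direction of the Verma–Pearl criterion comes for free: equivalence is transported along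
a chain of covered reversals. -/
theorem Similar.markovEquiv [Finite V] (hD : IsDAG D) (hD' : IsDAG D') (hs : Similar D D') :
    MarkovEquiv D D' :=
  Similar.induction_covered (P := fun E => MarkovEquiv D E) hD hD' hs (MarkovEquiv.refl D)
    fun _ _ _ hE _ hP hcov _ => hP.trans (hcov.markovEquiv hE)

theorem IsMEC.isDAG {M : Set (Digraph V)} (hM : IsMEC M) (hD : D ∈ M) : IsDAG D := by
  obtain ⟨D₁, -, rfl⟩ := hM
  exact hD.1

theorem IsMEC.nonempty {M : Set (Digraph V)} (hM : IsMEC M) : M.Nonempty := by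
  obtain ⟨D₁, h, rfl⟩ := hM
  exact ⟨D₁, h, MarkovEquiv.refl _⟩

theorem IsMEC.mem_of_markovEquiv {M : Set (Digraph V)} (hM : IsMEC M) (hD : D ∈ M)
    (hD' : IsDAG D') (h : MarkovEquiv D D') : D' ∈ M := by
  obtain ⟨D₁, -, rfl⟩ := hM
  exact ⟨hD', hD.2.trans h⟩

theorem IsMEC.similar {M : Set (Digraph V)} (hM : IsMEC M) (hD : D ∈ M) (hD' : D' ∈ M) :
    Similar D D' := by
  obtain ⟨D₁, -, rfl⟩ := hM
  exact (hD.2.symm.trans hD'.2).similar hD.1 hD'.1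

theorem IsMEC.mem_of_similar [Finite V] {M : Set (Digraph V)} (hM : IsMEC M) (hD : D ∈ M)
    (hD' : IsDAG D') (h : Similar D D') : D' ∈ M :=
  hM.mem_of_markovEquiv hD hD' (h.markovEquiv (hM.isDAG hD) hD')

theorem IsMEC.reverse_mem {M : Set (Digraph V)} (hM : IsMEC M) (hD : D ∈ M) {x y : V}
    (h : Covered D x y) : reverseEdge D x y ∈ M :=
  hM.mem_of_markovEquiv hD (h.isDAG_reverse (hM.isDAG hD)) (h.markovEquiv (hM.isDAG hD))

end GraphTheory

/-! ### Correctness of the recursion: termination, completeness, depth -/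

section Correctness

variable {V : Type*}

/-- The last clause is what completeness needs: when the loop ends, every graph that some call has
looped over is visited, whichever call visited it. -/
theorem loop_spec {order : Digraph V → List (Digraph V)} {L out : List (Digraph V)}
    {vis vis' : Set (Digraph V)} {d : ℕ} (h : Loop order L vis out vis' d) :
    out.Nodup ∧ (∀ D ∈ out, D ∉ vis) ∧ vis' = vis ∪ {D | D ∈ out} ∧ (∀ D ∈ L, D ∈ vis') ∧
      ∀ D ∈ out, ∀ E ∈ order D, E ∈ vis' := by
  induction h with
  | nil vis => simp
  | @skip D L out vis vis' d hD _ ih =>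
    obtain ⟨h1, h2, h3, h4, h5⟩ := ih
    refine ⟨h1, h2, h3, ?_, h5⟩
    intro E hE
    rcases List.mem_cons.1 hE with rfl | hE
    · rw [h3]; exact .inl hD
    · exact h4 E hE
  | @call D L out₁ out₂ vis vis₁ vis₂ d₁ d₂ hD _ _ ih₁ ih₂ =>
    obtain ⟨a1, a2, a3, a4, a5⟩ := ih₁
    obtain ⟨b1, b2, b3, b4, b5⟩ := ih₂
    have hsub : ∀ E ∈ vis₁, E ∈ vis₂ := fun E hE => by rw [b3]; exact .inl hE
    have hD₁ : D ∈ vis₁ := by rw [a3]; exact .inl (.inl rfl)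
    have hvis : ∀ E ∈ vis, E ∈ vis₁ := fun E hE => by rw [a3]; exact .inl (.inr hE)
    have hout₁ : ∀ E ∈ out₁, E ∈ vis₁ := fun E hE => by rw [a3]; exact .inr hE
    refine ⟨?_, ?_, ?_, ?_, ?_⟩
    · rw [List.nodup_append, List.nodup_cons]
      refine ⟨⟨fun h => a2 D h (.inl rfl), a1⟩, b1, ?_⟩
      rintro E hE F hF rfl
      refine b2 E hF ?_
      rcases List.mem_cons.1 hE with rfl | hE
      · exact hD₁
      · exact hout₁ E hE
    · intro E hE hv
      rcases List.mem_append.1 hE with hE | hE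
      · rcases List.mem_cons.1 hE with rfl | hE
        · exact hD hv
        · exact a2 E hE (.inr hv)
      · exact b2 E hE (hvis E hv)
    · rw [b3, a3]
      ext E
      simp
      tauto
    · intro E hE
      rcases List.mem_cons.1 hE with rfl | hE
      · exact hsub _ hD₁
      · exact b4 E hE
    · intro E hE F hF
      rcases List.mem_append.1 hE with hE | hE
      · rcases List.mem_cons.1 hE with rfl | hE
        · exact hsub _ (a4 F hF)
        · exact hsub _ (a5 E hE F hF)
      · exact b5 E hE F hF

/-- The loops terminate on a finite set that is closed under `order`. -/
theorem exists_loop {order : Digraph V → List (Digraph V)} {M : Set (Digraph V)} (hM : M.Finite)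
    (hcl : ∀ D ∈ M, ∀ E ∈ order D, E ∈ M) (k : ℕ) : ∀ (vis : Set (Digraph V)),
    (M \ vis).ncard ≤ k → ∀ L : List (Digraph V), (∀ D ∈ L, D ∈ M) →
      ∃ out vis' d, Loop order L vis out vis' d := by
  induction k with
  | zero =>
    intro vis hk L
    have hsub : M ⊆ vis := by
      rw [Nat.le_zero, Set.ncard_eq_zero (hM.subset Set.sdiff_subset)] at hk
      exact Set.sdiff_eq_empty.1 hk
    induction L with
    | nil => exact fun _ => ⟨_, _, _, .nil vis⟩
    | cons D L ih =>
      intro hL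
      obtain ⟨out, vis', d, h⟩ := ih fun E hE => hL E (.tail _ hE)
      exact ⟨_, _, _, .skip (hsub (hL D (.head _))) h⟩
  | succ k ihk =>
    intro vis hk L
    -- A call adds an unvisited member of M, so the outer induction covers its body. The rest of the
    -- loop runs with a larger visited set, for which the bound still holds, and is covered by the
    -- inner induction.
    induction L generalizing vis with
    | nil => exact fun _ => ⟨_, _, _, .nil vis⟩
    | cons D L ih =>
      intro hL
      by_cases hD : D ∈ vis
      · obtain ⟨out, vis', d, h⟩ := ih vis hk fun E hE => hL E (.tail _ hE)
        exact ⟨_, _, _, .skip hD h⟩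
      · have hDM := hL D (.head _)
        have hlt : (M \ insert D vis).ncard < (M \ vis).ncard := by
          refine Set.ncard_lt_ncard ⟨fun E hE => ⟨hE.1, fun h => hE.2 (.inr h)⟩, fun h => ?_⟩
            (hM.subset Set.sdiff_subset)
          exact (h ⟨hDM, hD⟩).2 (.inl rfl)
        obtain ⟨out₁, vis₁, d₁, h₁⟩ := ihk (insert D vis) (by omega) (order D) (hcl D hDM)
        have hsub : (M \ vis₁).ncard ≤ k + 1 := by
          refine (Set.ncard_le_ncard ?_ (hM.subset Set.sdiff_subset)).trans (hlt.le.trans hk)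
          rw [(loop_spec h₁).2.2.1]
          exact fun E hE => ⟨hE.1, fun h => hE.2 (.inl h)⟩
        obtain ⟨out₂, vis₂, d₂, h₂⟩ := ih vis₁ hsub fun E hE => hL E (.tail _ hE)
        exact ⟨_, _, _, .call hD h₁ h₂⟩

/-- If every member of a loop lies one level higher than the call and levels are at most `m`,
then the nesting is bounded. -/
theorem loop_depth_le {order : Digraph V → List (Digraph V)} {M : Set (Digraph V)} {m : ℕ}
    {lev : Digraph V → ℕ} (hlev : ∀ D ∈ M, lev D ≤ m)
    (hcl : ∀ D ∈ M, ∀ E ∈ order D, E ∈ M ∧ lev E = lev D + 1)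
    {L out : List (Digraph V)} {vis vis' : Set (Digraph V)} {d : ℕ}
    (h : Loop order L vis out vis' d) :
    ∀ k ≤ m, (∀ D ∈ L, D ∈ M ∧ lev D = k + 1) → d + k ≤ m := by
  induction h with
  | nil vis => intro k hk _; omega
  | skip _ _ ih => exact fun k hk hL => ih k hk fun E hE => hL E (.tail _ hE)
  | @call D L _ _ _ _ _ d₁ d₂ _ _ _ ih₁ ih₂ =>
    intro k hk hL
    obtain ⟨hD, hDl⟩ := hL D (.head _)
    have h1 := ih₁ (k + 1) (hDl ▸ hlev D hD) fun E hE => by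
      rw [← hDl]; exact hcl D hD E hE
    have h2 := ih₂ k hk fun E hE => hL E (.tail _ hE)
    omega

theorem finite_digraph [Finite V] (M : Set (Digraph V)) : M.Finite := by
  have : Finite (Digraph V) :=
    Finite.of_injective (fun D : Digraph V => D.Adj) fun D D' h => by
      cases D; cases D'; simpa using h
  exact Set.toFinite M

variable {once : Bool} {D₀ : Digraph V} {M : Set (Digraph V)}
  {order : Digraph V → List (Digraph V)}

theorem Candidate.mem (hM : IsMEC M) {D D' : Digraph V} (hD : D ∈ M)
    (h : Candidate once D₀ D D') : D' ∈ M := by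
  obtain ⟨x, y, hcov, -, rfl⟩ := h
  exact hM.reverse_mem hD hcov

theorem IsOrder.exists_run [Finite V] (hM : IsMEC M) (hD₀ : D₀ ∈ M)
    (ho : IsOrder once D₀ M order) : ∃ out d, Run order D₀ out d := by
  have hcl : ∀ D ∈ M, ∀ E ∈ order D, E ∈ M := fun D hD E hE =>
    (((ho D hD).2 E).1 hE).mem hM hD
  obtain ⟨out, vis', d, h⟩ := exists_loop (finite_digraph M) hcl _ {D₀} le_rfl (order D₀)
    (hcl D₀ hD₀)
  exact ⟨_, d, out, vis', h, rfl⟩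

/-- The output is closed under the reversals considered, so a chain of covered reversals from the
start to any member of the class stays inside it. -/
theorem IsOrder.run_spec [Finite V] (hM : IsMEC M) (hD₀ : D₀ ∈ M)
    (ho : IsOrder once D₀ M order) {out : List (Digraph V)} {d : ℕ} (hr : Run order D₀ out d) :
    out.Nodup ∧ ∀ D, D ∈ out ↔ D ∈ M := by
  obtain ⟨rest, vis, h, rfl⟩ := hr
  obtain ⟨h1, h2, h3, h4, h5⟩ := loop_spec h
  have hmem : ∀ D, D ∈ vis ↔ D ∈ D₀ :: rest := by simp [h3]
  have hcl : ∀ D ∈ D₀ :: rest, ∀ E ∈ order D, E ∈ D₀ :: rest := by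
    intro D hD E hE
    rw [← hmem]
    rcases List.mem_cons.1 hD with rfl | hD
    · exact h4 E hE
    · exact h5 D hD E hE
  refine ⟨List.nodup_cons.2 ⟨fun h => h2 _ h rfl, h1⟩, fun D => ⟨?_, fun hD => ?_⟩⟩
  · -- everything written lies in the class
    have key : ∀ {L out : List (Digraph V)} {vis vis' : Set (Digraph V)} {d : ℕ},
        Loop order L vis out vis' d → (∀ D ∈ L, D ∈ M) → ∀ D ∈ out, D ∈ M := by
      intro L out vis vis' d h
      induction h with
      | nil vis => simp
      | skip _ _ ih => exact fun hL => ih fun E hE => hL E (.tail _ hE)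
      | @call D L _ _ _ _ _ _ _ _ _ _ ih₁ ih₂ =>
        intro hL E hE
        have hD := hL D (.head _)
        rcases List.mem_append.1 hE with hE | hE
        · rcases List.mem_cons.1 hE with rfl | hE
          · exact hD
          · exact ih₁ (fun F hF => (((ho D hD).2 F).1 hF).mem hM hD) E hE
        · exact ih₂ (fun F hF => hL F (.tail _ hF)) E hE
    intro hD
    rcases List.mem_cons.1 hD with rfl | hD
    · exact hD₀
    · exact key h (fun E hE => (((ho D₀ hD₀).2 E).1 hE).mem hM hD₀) D hD
  -- Along the chain every arc comes from the start or from the target. An arc about to be reversed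
  -- opposes the target, hence still has its initial direction, so the bounded version considers it
  -- too.
  · have := Similar.induction_covered (D := D₀) (D' := D)
      (P := fun E => (E ∈ D₀ :: rest ∧ E ∈ M) ∧ ∀ u v, E.Adj u v → D₀.Adj u v ∨ D.Adj u v)
      (hM.isDAG hD₀) (hM.isDAG hD) (hM.similar hD₀ hD)
      ⟨⟨List.mem_cons_self, hD₀⟩, fun _ _ h => .inl h⟩ ?_
    · exact this.1.1
    · rintro E x y - - ⟨⟨hE, hEM⟩, hsub⟩ hcov hyx
      refine ⟨⟨?_, hM.reverse_mem hEM hcov⟩, ?_⟩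
      · refine hcl E hE _ (((ho E hEM).2 _).2 ⟨x, y, hcov, fun _ => ?_, rfl⟩)
        exact (hsub x y hcov.1).resolve_right ((hM.isDAG hD).asymm hyx)
      · rintro u v (h | ⟨rfl, rfl⟩)
        · exact hsub u v h.1
        · exact .inr hyx

theorem cpdag_adj {u v : V} : (cpdag M).Adj u v ↔ ∃ D ∈ M, D.Adj u v := by
  simp [cpdag, Digraph.sSup_adj]

/-- The level of a DAG is the number of its edges that differ from the start. A reversal allowed in
the bounded version adds one such edge and removes none. -/
theorem IsOrder.depth_le [Finite V] (hM : IsMEC M) (hD₀ : D₀ ∈ M)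
    (ho : IsOrder true D₀ M order) {out : List (Digraph V)} {d : ℕ} (hr : Run order D₀ out d) :
    d ≤ edgeCount (cpdag M) := by
  obtain ⟨rest, vis, h, rfl⟩ := hr
  have hlev : ∀ D ∈ M, (diffEdges D₀ D).ncard ≤ edgeCount (cpdag M) := by
    refine fun D hD => Set.ncard_le_ncard ?_ (Set.toFinite _)
    rintro e ⟨u, v, h1, -, rfl⟩
    exact ⟨u, v, cpdag_adj.2 ⟨D, hD, h1⟩, rfl⟩
  have hcl : ∀ D ∈ M, ∀ E ∈ order D,
      E ∈ M ∧ (diffEdges D₀ E).ncard = (diffEdges D₀ D).ncard + 1 := by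
    intro D hD E hE
    have hc := ((ho D hD).2 E).1 hE
    refine ⟨hc.mem hM hD, ?_⟩
    obtain ⟨x, y, hcov, hxy, rfl⟩ := hc
    have hxy := hxy rfl
    have hdag := hM.isDAG hD
    have h0 := (hM.isDAG hD₀).asymm hxy
    have heq : diffEdges D₀ (reverseEdge D x y) = insert s(x, y) (diffEdges D₀ D) := by
      ext e
      constructor
      · rintro ⟨u, v, h1, h2, rfl⟩
        rcases h1 with h1 | ⟨rfl, rfl⟩
        · exact .inr ⟨u, v, h1.1, h2, rfl⟩
        · exact .inl Sym2.eq_swap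
      · rintro (rfl | ⟨u, v, h1, h2, rfl⟩)
        · exact ⟨y, x, .inr ⟨rfl, rfl⟩, h0, Sym2.eq_swap⟩
        · exact ⟨u, v, .inl ⟨h1, fun e => h2 (e.1 ▸ e.2 ▸ hxy)⟩, h2, rfl⟩
    rw [heq, Set.ncard_insert_of_notMem _ (Set.toFinite _)]
    rintro ⟨u, v, h1, h2, h3⟩
    rcases Sym2.eq_iff.1 h3 with ⟨rfl, rfl⟩ | ⟨rfl, rfl⟩
    · exact h2 hxy
    · exact hdag.asymm hcov.1 h1
  have h0 : (diffEdges D₀ D₀).ncard = 0 := by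
    rw [Set.ncard_eq_zero (Set.toFinite _)]
    ext e
    simp only [diffEdges, Set.mem_ofPred_eq, Set.mem_empty_iff_false, iff_false]
    rintro ⟨u, v, h1, h2, -⟩
    exact h2 h1
  refine loop_depth_le hlev hcl h 0 (Nat.zero_le _) fun E hE => ?_
  have := hcl D₀ hD₀ E hE
  rwa [h0] at this

end Correctness

/-! ## Programs with bounded loops

A sublanguage of `Prog` whose only loops run a register from `0` to the number of edges in
register `1`. Such a program is a total function on memories with a syntactic bound on its
running time. -/

section BoundedPrograms

/-- A state without clock and completed outputs. -/
structure Mem where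
  reg : ℕ → ℕ
  arr : ℕ → ℕ → ℕ
  buf : List ℕ

def State.mem (s : State) : Mem := ⟨s.reg, s.arr, s.buf⟩

def Mem.setReg (μ : Mem) (x v : ℕ) : Mem := { μ with reg := Function.update μ.reg x v }

def Mem.setArr (μ : Mem) (a i v : ℕ) : Mem :=
  { μ with arr := Function.update μ.arr a (Function.update (μ.arr a) i v) }

@[simp] theorem Mem.setReg_reg (μ : Mem) (x v y : ℕ) :
    (μ.setReg x v).reg y = if y = x then v else μ.reg y := by
  simp [Mem.setReg, Function.update_apply]

@[simp] theorem Mem.setReg_arr (μ : Mem) (x v : ℕ) : (μ.setReg x v).arr = μ.arr := rfl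

@[simp] theorem Mem.setReg_buf (μ : Mem) (x v : ℕ) : (μ.setReg x v).buf = μ.buf := rfl

@[simp] theorem Mem.setArr_reg (μ : Mem) (a i v : ℕ) : (μ.setArr a i v).reg = μ.reg := rfl

@[simp] theorem Mem.setArr_buf (μ : Mem) (a i v : ℕ) : (μ.setArr a i v).buf = μ.buf := rfl

@[simp] theorem Mem.setArr_arr (μ : Mem) (a i v b : ℕ) :
    (μ.setArr a i v).arr b = if b = a then Function.update (μ.arr a) i v else μ.arr b := by
  simp only [Mem.setArr, Function.update_apply]

theorem Mem.ite_reg (c : Prop) [Decidable c] (μ ν : Mem) (x : ℕ) :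
    (if c then μ else ν).reg x = if c then μ.reg x else ν.reg x := by split_ifs <;> rfl

theorem Mem.ite_arr (c : Prop) [Decidable c] (μ ν : Mem) (a : ℕ) :
    (if c then μ else ν).arr a = if c then μ.arr a else ν.arr a := by split_ifs <;> rfl

/-- The truth value of a comparison in a memory. -/
def Test.On (μ : Mem) : Test → Prop
  | .eq x y => μ.reg x = μ.reg y
  | .lt x y => μ.reg x < μ.reg y

instance (μ : Mem) : (b : Test) → Decidable (b.On μ)
  | .eq x y => inferInstanceAs (Decidable (μ.reg x = μ.reg y))
  | .lt x y => inferInstanceAs (Decidable (μ.reg x < μ.reg y))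

/-- Programs with bounded loops. -/
inductive Code where
  | skip
  | const (x c : ℕ)
  | copy (x y : ℕ)
  | inc (x : ℕ)
  | dec (x : ℕ)
  | load (x a i : ℕ)
  | store (a i x : ℕ)
  | emit (x : ℕ)
  | seq (P Q : Code)
  | ite (b : Test) (P Q : Code)
  | rep (i : ℕ) (P : Code)

infixr:60 " ;; " => Code.seq

namespace Code

/-- Compilation. -/
def toProg : Code → Prog
  | skip => .instr .skip
  | const x c => .instr (.const x c)
  | copy x y => .instr (.copy x y)
  | inc x => .instr (.inc x)
  | dec x => .instr (.dec x)
  | load x a i => .instr (.load x a i)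
  | store a i x => .instr (.store a i x)
  | emit x => .instr (.emit x)
  | seq P Q => .seq P.toProg Q.toProg
  | ite b P Q => .cond b P.toProg Q.toProg
  | rep i P => .seq (.instr (.const i 0)) (.loop (.lt i 1) (.seq P.toProg (.instr (.inc i))))

/-- The effect on the memory. -/
def run : Code → Mem → Mem
  | skip, μ => μ
  | const x c, μ => μ.setReg x c
  | copy x y, μ => μ.setReg x (μ.reg y)
  | inc x, μ => μ.setReg x (μ.reg x + 1)
  | dec x, μ => μ.setReg x (μ.reg x - 1)
  | load x a i, μ => μ.setReg x (μ.arr a (μ.reg i))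
  | store a i x, μ => μ.setArr a (μ.reg i) (μ.reg x)
  | emit x, μ => { μ with buf := μ.buf ++ [μ.reg x] }
  | seq P Q, μ => Q.run (P.run μ)
  | ite b P Q, μ => if b.On μ then P.run μ else Q.run μ
  | rep i P, μ => (fun ν => (P.run ν).setReg i ((P.run ν).reg i + 1))^[μ.reg 1] (μ.setReg i 0)

/-- A bound on the running time with `m` edges. -/
def cost (m : ℕ) : Code → ℕ
  | seq P Q => P.cost m + Q.cost m
  | ite _ P Q => max (P.cost m) (Q.cost m) + 1
  | rep _ P => m * (P.cost m + 2) + 2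
  | _ => 1

/-- The registers that may change. -/
def writes : Code → List ℕ
  | const x _ => [x]
  | copy x _ => [x]
  | inc x => [x]
  | dec x => [x]
  | load x _ _ => [x]
  | seq P Q => P.writes ++ Q.writes
  | ite _ P Q => P.writes ++ Q.writes
  | rep i P => i :: P.writes
  | _ => []

/-- The arrays that may change. -/
def stores : Code → List ℕ
  | store a _ _ => [a]
  | seq P Q => P.stores ++ Q.stores
  | ite _ P Q => P.stores ++ Q.stores
  | rep _ P => P.stores
  | _ => []

/-- Nothing is written out. -/
def silent : Code → Bool
  | emit _ => false
  | seq P Q => P.silent && Q.silent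
  | ite _ P Q => P.silent && Q.silent
  | rep _ P => P.silent
  | _ => true

/-- Loop variables and the number of edges are not overwritten in loops. -/
def WF : Code → Bool
  | seq P Q => P.WF && Q.WF && !(P.writes.contains 1)
  | ite _ P Q => P.WF && Q.WF
  | rep i P => P.WF && (i != 1) && !(P.writes.contains i) && !(P.writes.contains 1)
  | _ => true

/-- The memory `ν` differs from `μ` only where `P` may write. -/
structure Agree (P : Code) (μ ν : Mem) : Prop where
  reg : ∀ x ∉ P.writes, ν.reg x = μ.reg x
  arr : ∀ a ∉ P.stores, ν.arr a = μ.arr a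
  buf : P.silent = true → ν.buf = μ.buf

theorem Agree.rfl {P : Code} {μ : Mem} : Agree P μ μ := ⟨fun _ _ => .refl _, fun _ _ => .refl _, fun _ => .refl _⟩

theorem Agree.trans {P : Code} {μ ν ξ : Mem} (h : Agree P μ ν) (h' : Agree P ν ξ) : Agree P μ ξ :=
  ⟨fun x hx => (h'.reg x hx).trans (h.reg x hx), fun x hx => (h'.arr x hx).trans (h.arr x hx),
    fun hs => (h'.buf hs).trans (h.buf hs)⟩

theorem Agree.mono {P Q : Code} {μ ν : Mem} (h : Agree P μ ν) (h₁ : P.writes ⊆ Q.writes)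
    (h₂ : P.stores ⊆ Q.stores) (h₃ : Q.silent = true → P.silent = true) : Agree Q μ ν :=
  ⟨fun x hx => h.reg x fun h => hx (h₁ h), fun x hx => h.arr x fun h => hx (h₂ h),
    fun hs => h.buf (h₃ hs)⟩

theorem agree_setReg {P : Code} {μ : Mem} {x v : ℕ} (h : x ∈ P.writes) :
    Agree P μ (μ.setReg x v) :=
  ⟨fun y hy => by
    have : y ≠ x := fun e => hy (e ▸ h)
    simp [Mem.setReg, this], fun _ _ => .refl _, fun _ => .refl _⟩

/-- The frame rule. As `writes` and `stores` are computed from the syntax, later claims that a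
register or an array survives a piece of code are settled by `decide`. -/
theorem agree_run (P : Code) : ∀ μ, Agree P μ (P.run μ) := by
  induction P with
  | skip => exact fun μ => .rfl
  | const x c => exact fun μ => agree_setReg (by simp [writes])
  | copy x y => exact fun μ => agree_setReg (by simp [writes])
  | inc x => exact fun μ => agree_setReg (by simp [writes])
  | dec x => exact fun μ => agree_setReg (by simp [writes])
  | load x a i => exact fun μ => agree_setReg (by simp [writes])
  | store a i x =>
    refine fun μ => ⟨fun _ _ => .refl _, fun b hb => ?_, fun _ => .refl _⟩
    have : b ≠ a := by simpa [stores] using hb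
    simp [run, Mem.setArr, this]
  | emit x => exact fun μ => ⟨fun _ _ => .refl _, fun _ _ => .refl _, fun h => by simp [silent] at h⟩
  | seq P Q ihP ihQ =>
    intro μ
    refine ((ihP μ).mono ?_ ?_ ?_).trans ((ihQ (P.run μ)).mono ?_ ?_ ?_) <;>
      simp +contextual [writes, stores, silent]
  | ite b P Q ihP ihQ =>
    intro μ
    by_cases h : b.On μ
    · simp only [run, h, if_true]
      refine (ihP μ).mono ?_ ?_ ?_ <;> simp +contextual [writes, stores, silent]
    · simp only [run, h, if_false]
      refine (ihQ μ).mono ?_ ?_ ?_ <;> simp +contextual [writes, stores, silent]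
  | rep i P ih =>
    intro μ
    have key : ∀ k ν, Agree (rep i P) ν
        ((fun ν => (P.run ν).setReg i ((P.run ν).reg i + 1))^[k] ν) := by
      intro k
      induction k with
      | zero => exact fun ν => .rfl
      | succ k ihk =>
        intro ν
        rw [Function.iterate_succ_apply]
        refine Agree.trans (Agree.trans ((ih ν).mono ?_ ?_ ?_) (agree_setReg ?_)) (ihk _) <;>
          simp +contextual [writes, stores, silent]
    exact (agree_setReg (by simp [writes])).trans (key _ _)

/-- The rule for bounded loops. -/
theorem rep_induction {i : ℕ} {P : Code} (hw : (rep i P).WF = true) (μ : Mem)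
    (Inv : ℕ → Mem → Prop) (h0 : Inv 0 (μ.setReg i 0))
    (hs : ∀ k < μ.reg 1, ∀ ν, Agree (rep i P) μ ν → ν.reg i = k → Inv k ν →
      Inv (k + 1) ((P.run ν).setReg i (k + 1))) : Inv (μ.reg 1) ((rep i P).run μ) := by
  simp only [WF, Bool.and_eq_true, bne_iff_ne, ne_eq, Bool.not_eq_true', List.contains_eq_mem,
    decide_eq_false_iff_not] at hw
  obtain ⟨⟨⟨-, hi1⟩, hiP⟩, h1P⟩ := hw
  have key : ∀ k ≤ μ.reg 1,
      Agree (rep i P) μ ((fun ν => (P.run ν).setReg i ((P.run ν).reg i + 1))^[k] (μ.setReg i 0)) ∧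
      ((fun ν => (P.run ν).setReg i ((P.run ν).reg i + 1))^[k] (μ.setReg i 0)).reg i = k ∧
      Inv k ((fun ν => (P.run ν).setReg i ((P.run ν).reg i + 1))^[k] (μ.setReg i 0)) := by
    intro k
    induction k with
    | zero => exact fun _ => ⟨agree_setReg (by simp [writes]), by simp [Mem.setReg], h0⟩
    | succ k ih =>
      intro hk
      obtain ⟨h1, h2, h3⟩ := ih (by omega)
      rw [Function.iterate_succ_apply']
      set ν := (fun ν => (P.run ν).setReg i ((P.run ν).reg i + 1))^[k] (μ.setReg i 0)
      have hi : (P.run ν).reg i = k := by rw [(agree_run P ν).reg i hiP, h2]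
      refine ⟨h1.trans (((agree_run P ν).mono ?_ ?_ ?_).trans (agree_setReg ?_)), ?_, ?_⟩
      · simp [writes]
      · simp [stores]
      · simp [silent]
      · simp [writes]
      · simp [Mem.setReg, hi]
      · simp only [hi]
        exact hs k (by omega) ν h1 h2 h3
  exact (key _ le_rfl).2.2

theorem holds_iff (b : Test) (s : State) : b.Holds s ↔ b.On s.mem := by cases b <;> rfl

/-- Compiled programs compute `run` within time `cost`. -/
theorem exec_toProg (P : Code) (hw : P.WF = true) : ∀ s : State, ∃ s', Exec P.toProg s s' ∧
    s'.mem = P.run s.mem ∧ s'.outs = s.outs ∧ s'.time ≤ s.time + P.cost (s.reg 1) := by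
  induction P with
  | skip => exact fun s => ⟨_, .instr _ _, rfl, rfl, le_rfl⟩
  | const x c => exact fun s => ⟨_, .instr _ _, rfl, rfl, le_rfl⟩
  | copy x y => exact fun s => ⟨_, .instr _ _, rfl, rfl, le_rfl⟩
  | inc x => exact fun s => ⟨_, .instr _ _, rfl, rfl, le_rfl⟩
  | dec x => exact fun s => ⟨_, .instr _ _, rfl, rfl, le_rfl⟩
  | load x a i => exact fun s => ⟨_, .instr _ _, rfl, rfl, le_rfl⟩
  | store a i x => exact fun s => ⟨_, .instr _ _, rfl, rfl, le_rfl⟩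
  | emit x => exact fun s => ⟨_, .instr _ _, rfl, rfl, le_rfl⟩
  | seq P Q ihP ihQ =>
    simp only [WF, Bool.and_eq_true, Bool.not_eq_true', List.contains_eq_mem,
      decide_eq_false_iff_not] at hw
    intro s
    obtain ⟨s₁, h1, h2, h3, h4⟩ := ihP hw.1.1 s
    obtain ⟨s₂, g1, g2, g3, g4⟩ := ihQ hw.1.2 s₁
    have hr1 : s₁.reg 1 = s.reg 1 :=
      (congrArg (fun μ => μ.reg 1) h2).trans ((agree_run P _).reg 1 hw.2)
    refine ⟨s₂, .seq h1 g1, by rw [g2, h2]; rfl, g3.trans h3, ?_⟩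
    rw [hr1] at g4
    simp only [cost]
    omega
  | ite b P Q ihP ihQ =>
    simp only [WF, Bool.and_eq_true] at hw
    intro s
    by_cases h : b.On s.mem
    · obtain ⟨s', h1, h2, h3, h4⟩ := ihP hw.1 s.tick
      refine ⟨s', .cond_true ((holds_iff b s).2 h) h1, ?_, h3, ?_⟩
      · simp only [run, h, if_true]; exact h2
      · simp only [State.tick] at h4
        simp only [cost]
        omega
    · obtain ⟨s', h1, h2, h3, h4⟩ := ihQ hw.2 s.tick
      refine ⟨s', .cond_false (fun h' => h ((holds_iff b s).1 h')) h1, ?_, h3, ?_⟩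
      · simp only [run, h, if_false]; exact h2
      · simp only [State.tick] at h4
        simp only [cost]
        omega
  | rep i P ih =>
    simp only [WF, Bool.and_eq_true, bne_iff_ne, ne_eq, Bool.not_eq_true', List.contains_eq_mem,
      decide_eq_false_iff_not] at hw
    obtain ⟨⟨⟨hwP, hi1⟩, hiP⟩, h1P⟩ := hw
    intro s
    -- After each iteration the loop is entered again with a larger value in register `i`; hence the
    -- induction is on the number k of iterations left, over all states.
    have key : ∀ k, ∀ s : State, s.reg i + k = s.reg 1 →
        ∃ s', Exec (.loop (.lt i 1) (.seq P.toProg (.instr (.inc i)))) s s' ∧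
          s'.mem = (fun ν => (P.run ν).setReg i ((P.run ν).reg i + 1))^[k] s.mem ∧
          s'.outs = s.outs ∧ s'.time ≤ s.time + (k * (P.cost (s.reg 1) + 2) + 1) := by
      intro k
      induction k with
      | zero =>
        intro s hs
        refine ⟨_, .loop_false ?_, rfl, rfl, ?_⟩
        · simp only [Test.Holds]; omega
        · simp [State.tick]
      | succ k ihk =>
        intro s hs
        obtain ⟨s₁, h1, h2, h3, h4⟩ := ih hwP s.tick
        have hr : ∀ x, s₁.reg x = (P.run s.mem).reg x := fun x => congrArg (fun μ => μ.reg x) h2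
        have hr1 : s₁.reg 1 = s.reg 1 := by rw [hr, (agree_run P _).reg 1 h1P]; rfl
        have hri : s₁.reg i = s.reg i := by rw [hr, (agree_run P _).reg i hiP]; rfl
        obtain ⟨s₂, g1, g2, g3, g4⟩ := ihk (Instr.exec s₁ (.inc i)) (by
          have : (1 : ℕ) ≠ i := fun e => hi1 e.symm
          simp only [Instr.exec, State.tick, State.setReg, Function.update_self,
            Function.update_of_ne this]
          omega)
        have g5 : (Instr.exec s₁ (.inc i)).reg 1 = s.reg 1 := by
          have : (1 : ℕ) ≠ i := fun e => hi1 e.symm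
          simp only [Instr.exec, State.tick, State.setReg, Function.update_of_ne this, hr1]
        refine ⟨s₂, .loop_true ?_ (.seq h1 (.instr _ _)) g1, ?_, ?_, ?_⟩
        · simp only [Test.Holds]; omega
        · rw [g2, Function.iterate_succ_apply]
          congr 1
          show _ = (P.run s.tick.mem).setReg i ((P.run s.tick.mem).reg i + 1)
          rw [← h2]
          rfl
        · rw [g3]; exact h3
        -- The 2 charged per iteration pays for the test and the increment, the final 1 for the
        -- failing test.
        · rw [g5] at g4
          simp only [Instr.exec, State.tick, State.setReg] at g4 h4
          rw [add_mul]
          omega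
    obtain ⟨s', h1, h2, h3, h4⟩ := key (s.reg 1) (Instr.exec s (.const i 0)) (by
      have : (1 : ℕ) ≠ i := fun e => hi1 e.symm
      simp [Instr.exec, State.tick, State.setReg, Function.update_of_ne this])
    have g5 : (Instr.exec s (.const i 0)).reg 1 = s.reg 1 := by
      have : (1 : ℕ) ≠ i := fun e => hi1 e.symm
      simp only [Instr.exec, State.tick, State.setReg, Function.update_of_ne this]
    refine ⟨s', .seq (.instr _ _) h1, h2, h3, ?_⟩
    rw [g5] at h4
    simp only [Instr.exec, State.tick, State.setReg] at h4
    simp only [cost]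
    omega

end Code

end BoundedPrograms

/-! ## Registers and arrays of the program -/

section Names

notation "rM" => (1 : ℕ)
notation "rZero" => (2 : ℕ)
notation "rOne" => (3 : ℕ)
notation "rRun" => (4 : ℕ)
notation "rCur" => (5 : ℕ)
notation "rDepth" => (6 : ℕ)
notation "rCount" => (7 : ℕ)
notation "rFresh" => (8 : ℕ)
notation "rWrite" => (9 : ℕ)
notation "rRead" => (10 : ℕ)
notation "rStamp" => (11 : ℕ)
notation "rRound" => (12 : ℕ)
notation "rK" => (13 : ℕ)
notation "rE" => (14 : ℕ)
notation "rR" => (15 : ℕ)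
notation "rX" => (16 : ℕ)
notation "rY" => (17 : ℕ)
notation "rA" => (18 : ℕ)
notation "rB" => (19 : ℕ)
notation "rQ" => (20 : ℕ)
notation "rFlag" => (21 : ℕ)
notation "rNew" => (22 : ℕ)
notation "rNode" => (23 : ℕ)

notation "aTail" => (0 : ℕ)
notation "aHead" => (1 : ℕ)
notation "aKind" => (2 : ℕ)
notation "aRev" => (3 : ℕ)
notation "aTrie" => (4 : ℕ)
notation "aStack" => (5 : ℕ)
notation "aQueue" => (6 : ℕ)
notation "aMark" => (7 : ℕ)
notation "aDead" => (8 : ℕ)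
notation "aBad" => (9 : ℕ)

end Names

/-! ### Code that eliminates one vertex, and its effect -/

section Extension

/-- Edge `i` of the edge list with tails `t` and heads `h` joins `u` and `v`. -/
def Joins (t h : ℕ → ℕ) (i u v : ℕ) : Prop := (t i = u ∧ h i = v) ∨ (t i = v ∧ h i = u)

theorem exists_lt_succ_iff {p : ℕ → Prop} {k : ℕ} :
    (∃ i < k + 1, p i) ↔ (∃ i < k, p i) ∨ p k := by
  constructor
  · rintro ⟨i, hi, h⟩
    rcases Nat.lt_succ_iff_lt_or_eq.1 hi with hi | rfl
    · exact .inl ⟨i, hi, h⟩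
    · exact .inr h
  · rintro (⟨i, hi, h⟩ | h)
    · exact ⟨i, by omega, h⟩
    · exact ⟨k, by omega, h⟩

open Code

/-- Mark the vertex in `rY` and its neighbours with a new stamp. -/
def markAdjacent : Code :=
  .inc rStamp ;; .store aMark rY rStamp ;;
  .rep rK (
    .load rA aTail rK ;; .load rB aHead rK ;;
    .ite (.eq rA rY) (.store aMark rB rStamp) .skip ;;
    .ite (.eq rB rY) (.store aMark rA rStamp) .skip)

/-- Since no mark exceeds the old stamp, the incremented stamp is new and the array of marks never
has to be cleared. -/
theorem run_markAdjacent (μ : Mem) (hμ : ∀ v, μ.arr aMark v ≤ μ.reg rStamp) :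
    (markAdjacent.run μ).reg rStamp = μ.reg rStamp + 1 ∧
    ∀ v, (markAdjacent.run μ).arr aMark v ≤ μ.reg rStamp + 1 ∧
      ((markAdjacent.run μ).arr aMark v = μ.reg rStamp + 1 ↔
        v = μ.reg rY ∨ ∃ i < μ.reg rM, Joins (μ.arr aTail) (μ.arr aHead) i (μ.reg rY) v) := by
  refine rep_induction (by decide) _ (fun k ν => ν.reg rStamp = μ.reg rStamp + 1 ∧
    ∀ v, ν.arr aMark v ≤ μ.reg rStamp + 1 ∧ (ν.arr aMark v = μ.reg rStamp + 1 ↔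
      v = μ.reg rY ∨ ∃ i < k, Joins (μ.arr aTail) (μ.arr aHead) i (μ.reg rY) v)) ?_ ?_
  · simp [run]
    intro v
    have := hμ v
    rw [Function.update_apply]
    split_ifs with h
    · simp [h]
    · simp [h]; omega
  · intro k hk ν hA hi ⟨h1, h2⟩
    have e0 := hA.arr aTail (by decide)
    have e1 := hA.arr aHead (by decide)
    have e2 := hA.reg rY (by decide)
    simp [run] at e0 e1 e2
    simp only [exists_lt_succ_iff]
    generalize μ.arr aTail = t at *
    generalize μ.arr aHead = h at *
    generalize μ.reg rY = y at *
    generalize μ.reg rStamp + 1 = S at *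
    simp [run, Test.On, e0, e1, e2, hi, h1, Mem.ite_arr, Mem.ite_reg, Joins]
    intro v
    obtain ⟨h3, h4⟩ := h2 v
    simp only [Joins] at h4
    generalize (∃ i < k, t i = y ∧ h i = v ∨ t i = v ∧ h i = y) = E at *
    simp only [Function.update_apply, ite_apply]
    grind

/-- Some edge joins `u` and `v`. -/
def Joined (m : ℕ) (t h : ℕ → ℕ) (u v : ℕ) : Prop := ∃ i < m, Joins t h i u v

/-- Declare the vertex in `rX` bad if it has a living neighbour without the current stamp. -/
def checkNeighbours : Code :=
  .rep rK (.load rQ aDead rK ;; .ite (.eq rQ rZero) (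
    .load rA aTail rK ;; .load rB aHead rK ;;
    .ite (.eq rA rX) (.load rQ aMark rB ;;
      .ite (.eq rQ rStamp) .skip (.store aBad rX rRound)) .skip ;;
    .ite (.eq rB rX) (.load rQ aMark rA ;;
      .ite (.eq rQ rStamp) .skip (.store aBad rX rRound)) .skip) .skip)

theorem run_checkNeighbours (μ : Mem) (hz : μ.reg rZero = 0)
    (hb : ∀ v, μ.arr aBad v ≤ μ.reg rRound) (v : ℕ) :
    (checkNeighbours.run μ).arr aBad v ≤ μ.reg rRound ∧
      ((checkNeighbours.run μ).arr aBad v = μ.reg rRound ↔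
        μ.arr aBad v = μ.reg rRound ∨ (v = μ.reg rX ∧ ∃ j < μ.reg rM, μ.arr aDead j = 0 ∧
          ((μ.arr aTail j = v ∧ μ.arr aMark (μ.arr aHead j) ≠ μ.reg rStamp) ∨
          (μ.arr aHead j = v ∧ μ.arr aMark (μ.arr aTail j) ≠ μ.reg rStamp)))) := by
  refine rep_induction (by decide) _ (fun k ν => ν.arr aBad v ≤ μ.reg rRound ∧
      (ν.arr aBad v = μ.reg rRound ↔
        μ.arr aBad v = μ.reg rRound ∨ (v = μ.reg rX ∧ ∃ j < k, μ.arr aDead j = 0 ∧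
          ((μ.arr aTail j = v ∧ μ.arr aMark (μ.arr aHead j) ≠ μ.reg rStamp) ∨
          (μ.arr aHead j = v ∧ μ.arr aMark (μ.arr aTail j) ≠ μ.reg rStamp))))) ?_ ?_
  · simp [hb]
  · intro k hk ν hA hi ⟨h1, h2⟩
    have e0 := hA.arr aTail (by decide)
    have e1 := hA.arr aHead (by decide)
    have e2 := hA.arr aMark (by decide)
    have e3 := hA.arr aDead (by decide)
    have e4 := hA.reg rX (by decide)
    have e5 := hA.reg rStamp (by decide)
    have e6 := hA.reg rRound (by decide)
    have e7 := hA.reg rZero (by decide)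
    rw [hz] at e7
    simp only [exists_lt_succ_iff]
    generalize μ.arr aTail = t at *
    generalize μ.arr aHead = h at *
    generalize μ.arr aMark = mk at *
    generalize μ.arr aDead = dd at *
    generalize μ.reg rX = x at *
    generalize μ.reg rStamp = S at *
    generalize μ.reg rRound = R at *
    simp [run, Test.On, e0, e1, e2, e3, e4, e5, e6, e7, hi, Mem.ite_arr, Mem.ite_reg]
    generalize (∃ i < k, _) = E at *
    simp only [Function.update_apply, ite_apply]
    grind

/-- The end `x` of the living edge `e`, whose other end is `y`, shows that `x` cannot be the next
vertex to eliminate; `out` says that a directed edge `e` leaves `x`. -/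
def EndBad (m : ℕ) (t h kd dd : ℕ → ℕ) (e x y : ℕ) (out : Bool) : Prop :=
  (kd e = 1 ∧ out = true) ∨ (kd e ≠ 1 ∧ ∃ j < m, dd j = 0 ∧
    ((t j = x ∧ ¬ (h j = y ∨ Joined m t h y (h j))) ∨
      (h j = x ∧ ¬ (t j = y ∨ Joined m t h y (t j)))))

/-- Check the end of the edge `rE` that is listed in array `a`; the other end is in `b`. -/
def checkEnd (a b : ℕ) (out : Bool) : Code :=
  .load rX a rE ;; .load rY b rE ;; .load rQ aKind rE ;;
  .ite (.eq rQ rOne) (if out then .store aBad rX rRound else .skip)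
    (markAdjacent ;; checkNeighbours)

/-- A directed edge disqualifies at most its tail, and at once. An undirected edge requires the
living neighbours of one end to be compared with the marks set around the other end. The bounds on
the stamps are carried along because the next check relies on them. -/
theorem run_checkEnd {a b : ℕ} (out : Bool) (μ : Mem) (hz : μ.reg rZero = 0) (ho : μ.reg rOne = 1)
    (hm : ∀ v, μ.arr aMark v ≤ μ.reg rStamp) (hb : ∀ v, μ.arr aBad v ≤ μ.reg rRound) :
    (∀ v, ((checkEnd a b out).run μ).arr aMark v ≤ ((checkEnd a b out).run μ).reg rStamp) ∧
    ∀ v, ((checkEnd a b out).run μ).arr aBad v ≤ μ.reg rRound ∧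
      (((checkEnd a b out).run μ).arr aBad v = μ.reg rRound ↔
        μ.arr aBad v = μ.reg rRound ∨ (v = μ.arr a (μ.reg rE) ∧
          EndBad (μ.reg rM) (μ.arr aTail) (μ.arr aHead) (μ.arr aKind) (μ.arr aDead)
            (μ.reg rE) (μ.arr a (μ.reg rE)) (μ.arr b (μ.reg rE)) out)) := by
  by_cases hk : μ.arr aKind (μ.reg rE) = 1
  · cases out
    · simp [checkEnd, run, Test.On, ho, hk, hm, hb, EndBad]
    · simp [checkEnd, run, Test.On, ho, hk, hm, EndBad]
      intro v
      have := hb v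
      simp only [Function.update_apply]
      split_ifs <;> simp_all
  · set μ₁ := (Code.load rQ aKind rE).run ((Code.load rY b rE).run ((Code.load rX a rE).run μ))
      with hμ₁
    have hrun : (checkEnd a b out).run μ = checkNeighbours.run (markAdjacent.run μ₁) := by
      simp [checkEnd, run, Test.On, ho, hk, hμ₁]
    rw [hrun]
    have r : ∀ z, z ≠ rX → z ≠ rY → z ≠ rQ → μ₁.reg z = μ.reg z := by
      intro z h1 h2 h3
      simp [hμ₁, run, h1, h2, h3]
    have r₁ : μ₁.arr = μ.arr := by simp [hμ₁, run]
    have rx : μ₁.reg rX = μ.arr a (μ.reg rE) := by simp [hμ₁, run]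
    have ry : μ₁.reg rY = μ.arr b (μ.reg rE) := by simp [hμ₁, run]
    obtain ⟨g1, g2⟩ := run_markAdjacent μ₁ (by rw [r₁, r _ (by decide) (by decide) (by decide)]; exact hm)
    set μ₂ := markAdjacent.run μ₁ with hμ₂
    have hA := agree_run markAdjacent μ₁
    rw [← hμ₂] at hA
    have q : ∀ z ∉ markAdjacent.writes, z ≠ rX → z ≠ rY → z ≠ rQ → μ₂.reg z = μ.reg z :=
      fun z h0 h1 h2 h3 => (hA.reg z h0).trans (r z h1 h2 h3)
    have q₁ : ∀ z ∉ markAdjacent.stores, μ₂.arr z = μ.arr z :=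
      fun z h0 => (hA.arr z h0).trans (by rw [r₁])
    have qx : μ₂.reg rX = μ.arr a (μ.reg rE) := (hA.reg _ (by decide)).trans rx
    have hR : μ₂.reg rRound = μ.reg rRound := q _ (by decide) (by decide) (by decide) (by decide)
    have hA' := agree_run checkNeighbours μ₂
    have key := run_checkNeighbours μ₂
      ((q _ (by decide) (by decide) (by decide) (by decide)).trans hz)
      (by rw [hR, q₁ _ (by decide)]; exact hb)
    constructor
    · intro v
      rw [hA'.arr _ (by decide), hA'.reg _ (by decide), g1]
      exact (g2 v).1
    · intro v
      have h1 := key v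
      rw [hR, q₁ aBad (by decide), qx, q₁ aDead (by decide), q₁ aTail (by decide),
        q₁ aHead (by decide), g1, q rM (by decide) (by decide) (by decide) (by decide)] at h1
      have h2 : ∀ w, μ₂.arr aMark w ≠ μ₁.reg rStamp + 1 ↔ ¬ (w = μ.arr b (μ.reg rE) ∨
          Joined (μ.reg rM) (μ.arr aTail) (μ.arr aHead) (μ.arr b (μ.reg rE)) w) := by
        intro w
        rw [ne_eq, (g2 w).2, ry, r₁, r rM (by decide) (by decide) (by decide)]
        rfl
      simp only [h2] at h1
      refine ⟨h1.1, h1.2.trans ?_⟩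
      simp only [EndBad, hk, false_and, false_or, not_false_eq_true, true_and, ne_eq]
      constructor
      · rintro (h | ⟨rfl, h⟩)
        · exact .inl h
        · exact .inr ⟨rfl, h⟩
      · rintro (h | ⟨rfl, h⟩)
        · exact .inl h
        · exact .inr ⟨rfl, h⟩

/-- The vertex `x` cannot be the next vertex to eliminate. -/
def VertexBad (m : ℕ) (t h kd dd : ℕ → ℕ) (x : ℕ) : Prop :=
  ∃ e < m, dd e = 0 ∧ ((x = t e ∧ EndBad m t h kd dd e (t e) (h e) true) ∨
    (x = h e ∧ EndBad m t h kd dd e (h e) (t e) false))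

/-- Check both ends of the edge `rE` if it is living. -/
def scanEdge : Code :=
  .load rQ aDead rE ;;
  .ite (.eq rQ rZero) (checkEnd aTail aHead true ;; checkEnd aHead aTail false) .skip

theorem run_scanEdge (μ : Mem) (hz : μ.reg rZero = 0) (ho : μ.reg rOne = 1)
    (hm : ∀ v, μ.arr aMark v ≤ μ.reg rStamp) (hb : ∀ v, μ.arr aBad v ≤ μ.reg rRound) :
    (∀ v, (scanEdge.run μ).arr aMark v ≤ (scanEdge.run μ).reg rStamp) ∧
    ∀ v, (scanEdge.run μ).arr aBad v ≤ μ.reg rRound ∧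
      ((scanEdge.run μ).arr aBad v = μ.reg rRound ↔ μ.arr aBad v = μ.reg rRound ∨
        (μ.arr aDead (μ.reg rE) = 0 ∧
        ((v = μ.arr aTail (μ.reg rE) ∧ EndBad (μ.reg rM) (μ.arr aTail) (μ.arr aHead) (μ.arr aKind)
        (μ.arr aDead) (μ.reg rE) (μ.arr aTail (μ.reg rE)) (μ.arr aHead (μ.reg rE)) true) ∨
      (v = μ.arr aHead (μ.reg rE) ∧ EndBad (μ.reg rM) (μ.arr aTail) (μ.arr aHead) (μ.arr aKind)
        (μ.arr aDead) (μ.reg rE) (μ.arr aHead (μ.reg rE)) (μ.arr aTail (μ.reg rE)) false)))) := by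
  by_cases hd : μ.arr aDead (μ.reg rE) = 0
  · set ν₁ := (Code.load rQ aDead rE).run μ with hν₁
    have r : ∀ z, z ≠ rQ → ν₁.reg z = μ.reg z := by
      intro z h1
      simp [hν₁, run, h1]
    have r₁ : ν₁.arr = μ.arr := by simp [hν₁, run]
    obtain ⟨a1, a2⟩ := run_checkEnd (a := aTail) (b := aHead) true ν₁
      ((r _ (by decide)).trans hz) ((r _ (by decide)).trans ho)
      (by rw [r₁, r _ (by decide)]; exact hm) (by rw [r₁, r _ (by decide)]; exact hb)
    have hA₁ := agree_run (checkEnd aTail aHead true) ν₁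
    have hrun : scanEdge.run μ =
        (checkEnd aHead aTail false).run ((checkEnd aTail aHead true).run ν₁) := by
      simp [scanEdge, run, Test.On, hd, hz, hν₁]
    rw [hrun]
    clear hrun
    generalize (checkEnd aTail aHead true).run ν₁ = ν₂ at *
    have q : ∀ z ∉ (checkEnd aTail aHead true).writes, z ≠ rQ → ν₂.reg z = μ.reg z :=
      fun z h0 h1 => (hA₁.reg z h0).trans (r z h1)
    have q₁ : ∀ z ∉ (checkEnd aTail aHead true).stores, ν₂.arr z = μ.arr z :=
      fun z h0 => (hA₁.arr z h0).trans (by rw [r₁])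
    have hR : ν₂.reg rRound = μ.reg rRound := q _ (by decide) (by decide)
    obtain ⟨b1, b2⟩ := run_checkEnd (a := aHead) (b := aTail) false ν₂
      ((q _ (by decide) (by decide)).trans hz) ((q _ (by decide) (by decide)).trans ho) a1
      (by rw [hR, ← r rRound (by decide)]; exact fun v => (a2 v).1)
    refine ⟨b1, fun v => ?_⟩
    have c1 := b2 v
    have c2 := a2 v
    rw [r rRound (by decide), r₁, r rE (by decide), r rM (by decide)] at c2
    rw [hR, q₁ aHead (by decide), q₁ aTail (by decide), q₁ aKind (by decide),
      q₁ aDead (by decide), q rE (by decide) (by decide), q rM (by decide) (by decide)] at c1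
    refine ⟨c1.1, ?_⟩
    rw [c1.2, c2.2]
    simp only [hd, true_and]
    tauto
  · have hrun : scanEdge.run μ = (Code.load rQ aDead rE).run μ := by
      simp [scanEdge, run, Test.On, hd, hz]
    rw [hrun]
    simp [run, hd]
    exact ⟨hm, hb⟩

/-- Find all bad vertices. -/
def scan : Code := .inc rRound ;; .rep rE scanEdge

/-- Raising `rRound` makes the verdicts of earlier rounds obsolete, since they are smaller numbers.
The loop only adds verdicts and leaves the arrays that they depend on untouched, so they accumulate
edge by edge. -/
theorem run_scan (μ : Mem) (hz : μ.reg rZero = 0) (ho : μ.reg rOne = 1)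
    (hm : ∀ v, μ.arr aMark v ≤ μ.reg rStamp) (hb : ∀ v, μ.arr aBad v ≤ μ.reg rRound) :
    (scan.run μ).reg rRound = μ.reg rRound + 1 ∧
    (∀ v, (scan.run μ).arr aMark v ≤ (scan.run μ).reg rStamp) ∧
    ∀ v, (scan.run μ).arr aBad v ≤ μ.reg rRound + 1 ∧
      ((scan.run μ).arr aBad v = μ.reg rRound + 1 ↔
        VertexBad (μ.reg rM) (μ.arr aTail) (μ.arr aHead) (μ.arr aKind) (μ.arr aDead) v) := by
  have h0 : (scan.run μ).reg rRound = ((Code.inc rRound).run μ).reg rRound :=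
    (agree_run (.rep rE _) ((Code.inc rRound).run μ)).reg rRound (by decide)
  refine ⟨h0.trans (by simp [run]), ?_⟩
  refine rep_induction (by decide) ((Code.inc rRound).run μ) (fun k ν =>
    (∀ v, ν.arr aMark v ≤ ν.reg rStamp) ∧
    ∀ v, ν.arr aBad v ≤ μ.reg rRound + 1 ∧ (ν.arr aBad v = μ.reg rRound + 1 ↔
      ∃ e < k, μ.arr aDead e = 0 ∧
      ((v = μ.arr aTail e ∧ EndBad (μ.reg rM) (μ.arr aTail) (μ.arr aHead) (μ.arr aKind)
        (μ.arr aDead) e (μ.arr aTail e) (μ.arr aHead e) true) ∨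
      (v = μ.arr aHead e ∧ EndBad (μ.reg rM) (μ.arr aTail) (μ.arr aHead) (μ.arr aKind)
        (μ.arr aDead) e (μ.arr aHead e) (μ.arr aTail e) false)))) ?_ ?_
  · simp [run, hm]
    intro v
    have := hb v
    omega
  · intro k hk ν hA hi ⟨h1, h2⟩
    have e0 := hA.arr aTail (by decide)
    have e1 := hA.arr aHead (by decide)
    have e2 := hA.arr aKind (by decide)
    have e3 := hA.arr aDead (by decide)
    have e4 := hA.reg rRound (by decide)
    have e5 := hA.reg rZero (by decide)
    have e6 := hA.reg rOne (by decide)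
    have e7 := hA.reg rM (by decide)
    simp [run] at e0 e1 e2 e3 e4 e5 e6 e7
    rw [hz] at e5
    rw [ho] at e6
    simp only [exists_lt_succ_iff]
    obtain ⟨b1, b2⟩ := run_scanEdge ν e5 e6 h1 (by rw [e4]; exact fun v => (h2 v).1)
    rw [hi, e0, e1, e2, e3, e4, e7] at b2
    simp only [Mem.setReg_arr, Mem.setReg_reg, if_neg (show ¬ (rStamp = rE) by decide)]
    refine ⟨b1, fun v => ⟨(b2 v).1, ?_⟩⟩
    rw [(b2 v).2, (h2 v).2]

/-- Choose an end `rX` of a living edge that is not bad, if there is one. -/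
def pick : Code :=
  .const rFlag 0 ;; .rep rE (.load rQ aDead rE ;; .ite (.eq rQ rZero) (
    .load rA aTail rE ;; .load rQ aBad rA ;;
    .ite (.eq rQ rRound) .skip (.const rFlag 1 ;; .copy rX rA) ;;
    .load rA aHead rE ;; .load rQ aBad rA ;;
    .ite (.eq rQ rRound) .skip (.const rFlag 1 ;; .copy rX rA)) .skip)

/-- A later find overwrites an earlier one; it matters only that `rX` ends with some good vertex on
a living edge whenever there is one. -/
theorem run_pick (μ : Mem) (hz : μ.reg rZero = 0) :
    ((pick.run μ).reg rFlag = 1 ∧ μ.arr aBad ((pick.run μ).reg rX) ≠ μ.reg rRound ∧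
      ∃ e < μ.reg rM, μ.arr aDead e = 0 ∧
        (μ.arr aTail e = (pick.run μ).reg rX ∨ μ.arr aHead e = (pick.run μ).reg rX)) ∨
    ((pick.run μ).reg rFlag = 0 ∧ ∀ e < μ.reg rM, μ.arr aDead e = 0 →
      μ.arr aBad (μ.arr aTail e) = μ.reg rRound ∧ μ.arr aBad (μ.arr aHead e) = μ.reg rRound) := by
  refine rep_induction (by decide) ((Code.const rFlag 0).run μ) (fun k ν =>
    (ν.reg rFlag = 1 ∧ μ.arr aBad (ν.reg rX) ≠ μ.reg rRound ∧
      ∃ e < k, μ.arr aDead e = 0 ∧ (μ.arr aTail e = ν.reg rX ∨ μ.arr aHead e = ν.reg rX)) ∨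
    (ν.reg rFlag = 0 ∧ ∀ e < k, μ.arr aDead e = 0 →
      μ.arr aBad (μ.arr aTail e) = μ.reg rRound ∧
        μ.arr aBad (μ.arr aHead e) = μ.reg rRound)) ?_ ?_
  · simp [run]
  · intro k hk ν hA hi h
    have e0 := hA.arr aTail (by decide)
    have e1 := hA.arr aHead (by decide)
    have e2 := hA.arr aBad (by decide)
    have e3 := hA.arr aDead (by decide)
    have e4 := hA.reg rRound (by decide)
    have e5 := hA.reg rZero (by decide)
    simp [run] at e0 e1 e2 e3 e4 e5
    rw [hz] at e5
    simp only [exists_lt_succ_iff]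
    simp [run, Test.On, e0, e1, e2, e3, e4, e5, hi, Mem.ite_arr, Mem.ite_reg]
    generalize μ.arr aTail = t at *
    generalize μ.arr aHead = hd at *
    generalize μ.arr aBad = bd at *
    generalize μ.arr aDead = dd at *
    generalize μ.reg rRound = R at *
    clear hA
    by_cases h1 : dd k = 0 <;> by_cases h2 : bd (t k) = R <;> by_cases h3 : bd (hd k) = R <;>
      simp [h1, h2, h3] <;> grind

/-- Direct the edge `rE` into the chosen vertex if it is living and has that end. -/
def orientEdge : Code :=
  .load rQ aDead rE ;; .ite (.eq rQ rZero) (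
    .load rA aTail rE ;; .load rB aHead rE ;;
    .ite (.eq rA rX) (.store aTail rE rB ;; .store aHead rE rA ;; .store aDead rE rOne)
      (.ite (.eq rB rX) (.store aDead rE rOne) .skip)) .skip

/-- Direct the living edges at the chosen vertex into it. -/
def orient : Code := .ite (.eq rFlag rOne) (.rep rE orientEdge) .skip

theorem run_orient (μ : Mem) (hz : μ.reg rZero = 0) (ho : μ.reg rOne = 1)
    (hf : μ.reg rFlag = 1) (j : ℕ) (hj : j < μ.reg rM) :
    (μ.arr aDead j = 0 → μ.arr aTail j = μ.reg rX →
      (orient.run μ).arr aTail j = μ.arr aHead j ∧ (orient.run μ).arr aHead j = μ.arr aTail j ∧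
      (orient.run μ).arr aDead j = 1) ∧
    (μ.arr aDead j = 0 → μ.arr aTail j ≠ μ.reg rX → μ.arr aHead j = μ.reg rX →
      (orient.run μ).arr aTail j = μ.arr aTail j ∧ (orient.run μ).arr aHead j = μ.arr aHead j ∧
      (orient.run μ).arr aDead j = 1) ∧
    ((μ.arr aDead j ≠ 0 ∨ (μ.arr aTail j ≠ μ.reg rX ∧ μ.arr aHead j ≠ μ.reg rX)) →
      (orient.run μ).arr aTail j = μ.arr aTail j ∧ (orient.run μ).arr aHead j = μ.arr aHead j ∧
      (orient.run μ).arr aDead j = μ.arr aDead j) := by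
  have hrun : orient.run μ = (Code.rep rE orientEdge).run μ := by
    rw [orient, run, if_pos (by simp [Test.On, hf, ho])]
  rw [hrun]
  -- The invariant follows the single edge j: it is untouched until the loop reaches it, and final
  -- afterwards, because each iteration changes only its own edge.
  have := rep_induction (i := rE) (P := orientEdge) (by decide) μ (fun k ν =>
    (k ≤ j → ν.arr aTail j = μ.arr aTail j ∧ ν.arr aHead j = μ.arr aHead j ∧
      ν.arr aDead j = μ.arr aDead j) ∧ (j < k →
    (μ.arr aDead j = 0 → μ.arr aTail j = μ.reg rX →
      ν.arr aTail j = μ.arr aHead j ∧ ν.arr aHead j = μ.arr aTail j ∧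
      ν.arr aDead j = 1) ∧
    (μ.arr aDead j = 0 → μ.arr aTail j ≠ μ.reg rX → μ.arr aHead j = μ.reg rX →
      ν.arr aTail j = μ.arr aTail j ∧ ν.arr aHead j = μ.arr aHead j ∧
      ν.arr aDead j = 1) ∧
    ((μ.arr aDead j ≠ 0 ∨ (μ.arr aTail j ≠ μ.reg rX ∧ μ.arr aHead j ≠ μ.reg rX)) →
      ν.arr aTail j = μ.arr aTail j ∧ ν.arr aHead j = μ.arr aHead j ∧
      ν.arr aDead j = μ.arr aDead j))) ?_ ?_
  · exact this.2 hj
  · simp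
  · intro k hk ν hA hi ⟨h1, h2⟩
    have e0 := hA.reg rX (by decide)
    have e1 := hA.reg rZero (by decide)
    have e2 := hA.reg rOne (by decide)
    rw [hz] at e1
    rw [ho] at e2
    clear hA
    by_cases hjk : j = k
    · subst hjk
      obtain ⟨f1, f2, f3⟩ := h1 le_rfl
      clear h1 h2
      by_cases g1 : μ.arr aDead j = 0 <;> by_cases g2 : μ.arr aTail j = μ.reg rX <;>
        by_cases g3 : μ.arr aHead j = μ.reg rX <;>
        simp [orientEdge, run, Test.On, e0, e1, e2, hi, f1, f2, f3, g1, g2, g3]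
    · have hx : (orientEdge.run ν).arr aTail j = ν.arr aTail j ∧
          (orientEdge.run ν).arr aHead j = ν.arr aHead j ∧
          (orientEdge.run ν).arr aDead j = ν.arr aDead j := by
        by_cases g1 : ν.arr aDead k = 0 <;> by_cases g2 : ν.arr aTail k = μ.reg rX <;>
          by_cases g3 : ν.arr aHead k = μ.reg rX <;>
          simp [orientEdge, run, Test.On, e0, e1, e2, hi, g1, g2, g3, hjk]
      simp only [Mem.setReg_arr, hx]
      refine ⟨fun h => h1 (by omega), fun h => h2 (by omega)⟩

end Extension

/-! ### Elimination never gets stuck and creates no new v-structure -/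

section Extension

open Code

/-- The orientation computed so far: living edges have `dd i = 0`, the edges at the vertices
already eliminated are directed according to the order of elimination. -/
structure Elim (m : ℕ) (t₀ h₀ kd t h dd : ℕ → ℕ) : Prop where
  arcs : ∀ i < m, (t i = t₀ i ∧ h i = h₀ i) ∨ (kd i ≠ 1 ∧ t i = h₀ i ∧ h i = t₀ i)
  rank : ∃ (τ : ℕ → ℕ) (T : ℕ), (∀ v, τ v ≤ T) ∧
    (∀ i < m, dd i ≠ 0 ↔ τ (t i) < T ∨ τ (h i) < T) ∧ ∀ i < m, dd i ≠ 0 → τ (h i) < τ (t i)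
  vstr : ∀ i < m, ∀ j < m, dd i ≠ 0 → dd j ≠ 0 → h i = h j → t i ≠ t j →
    ¬ Joined m t₀ h₀ (t i) (t j) → kd i = 1 ∧ kd j = 1

theorem Elim.joins_iff {m : ℕ} {t₀ h₀ kd t h dd : ℕ → ℕ} (H : Elim m t₀ h₀ kd t h dd) {i : ℕ}
    (hi : i < m) (u v : ℕ) : Joins t h i u v ↔ Joins t₀ h₀ i u v := by
  rcases H.arcs i hi with ⟨h1, h2⟩ | ⟨-, h1, h2⟩
  · simp only [Joins, h1, h2]
  · simp only [Joins, h1, h2]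
    tauto

theorem Elim.joined_iff {m : ℕ} {t₀ h₀ kd t h dd : ℕ → ℕ} (H : Elim m t₀ h₀ kd t h dd)
    (u v : ℕ) : Joined m t h u v ↔ Joined m t₀ h₀ u v :=
  exists_congr fun _ => and_congr_right fun hi => H.joins_iff hi u v

theorem Joins.symm {t h : ℕ → ℕ} {i u v : ℕ} (H : Joins t h i u v) : Joins t h i v u := Or.symm H

theorem directed_of_not_bad {m : ℕ} {t h kd dd : ℕ → ℕ} {x : ℕ}
    (hx : ¬ VertexBad m t h kd dd x) {e : ℕ} (he : e < m) (hd : dd e = 0) (hk : kd e = 1) :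
    t e ≠ x := fun hte => hx ⟨e, he, hd, .inl ⟨hte.symm, .inl ⟨hk, rfl⟩⟩⟩

/-- This is the Dor–Tarsi condition on a sink x. The case distinctions arise only because each of
the two edges may be listed in either direction. -/
theorem joined_of_not_bad {m : ℕ} {t h kd dd : ℕ → ℕ} {x : ℕ} (hx : ¬ VertexBad m t h kd dd x)
    {e j y w : ℕ} (he : e < m) (hd : dd e = 0) (hk : kd e ≠ 1) (hy : Joins t h e x y)
    (hj : j < m) (hdj : dd j = 0) (hw : Joins t h j x w) : w = y ∨ Joined m t h y w := by
  by_contra hn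
  apply hx
  refine ⟨e, he, hd, ?_⟩
  rcases hy with ⟨rfl, rfl⟩ | ⟨rfl, rfl⟩
  · refine .inl ⟨rfl, .inr ⟨hk, j, hj, hdj, ?_⟩⟩
    rcases hw with ⟨h1, rfl⟩ | ⟨rfl, h1⟩
    · exact .inl ⟨h1, hn⟩
    · exact .inr ⟨h1, hn⟩
  · refine .inr ⟨rfl, .inr ⟨hk, j, hj, hdj, ?_⟩⟩
    rcases hw with ⟨h1, rfl⟩ | ⟨rfl, h1⟩
    · exact .inl ⟨h1, hn⟩
    · exact .inr ⟨h1, hn⟩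

/-- Eliminating a vertex that is not bad. -/
theorem Elim.step {m : ℕ} {t₀ h₀ kd t h dd t' h' dd' : ℕ → ℕ} {x : ℕ}
    (H : Elim m t₀ h₀ kd t h dd) (hx : ¬ VertexBad m t h kd dd x)
    (hend : ∃ e < m, dd e = 0 ∧ (t e = x ∨ h e = x)) (hloop : ∀ i < m, t₀ i ≠ h₀ i)
    (h1 : ∀ j < m, dd j = 0 → t j = x → t' j = h j ∧ h' j = t j ∧ dd' j = 1)
    (h2 : ∀ j < m, dd j = 0 → t j ≠ x → h j = x → t' j = t j ∧ h' j = h j ∧ dd' j = 1)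
    (h3 : ∀ j < m, (dd j ≠ 0 ∨ (t j ≠ x ∧ h j ≠ x)) → t' j = t j ∧ h' j = h j ∧ dd' j = dd j) :
    Elim m t₀ h₀ kd t' h' dd' := by
  have hne : ∀ i < m, t i ≠ h i := by
    intro i hi e
    rcases H.arcs i hi with ⟨a, b⟩ | ⟨-, a, b⟩
    · exact hloop i hi (by rw [← a, ← b, e])
    · exact hloop i hi (by rw [← a, ← b, e])
  -- old edges, edges that are directed into `x` now, and remaining living edges
  have hcase : ∀ j < m, (dd j ≠ 0 ∧ t' j = t j ∧ h' j = h j ∧ dd' j = dd j) ∨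
      (dd j = 0 ∧ h' j = x ∧ dd' j = 1 ∧ t' j ≠ x ∧ Joins t h j x (t' j)) ∨
      (dd j = 0 ∧ t j ≠ x ∧ h j ≠ x ∧ t' j = t j ∧ h' j = h j ∧ dd' j = 0) := by
    intro j hj
    by_cases hd : dd j = 0
    · right
      by_cases ht : t j = x
      · obtain ⟨a, b, c⟩ := h1 j hj hd ht
        exact .inl ⟨hd, b.trans ht, c, fun e => hne j hj (by rw [ht, ← e, a]),
          .inl ⟨ht, a.symm⟩⟩
      · by_cases hh : h j = x
        · obtain ⟨a, b, c⟩ := h2 j hj hd ht hh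
          exact .inl ⟨hd, b.trans hh, c, by rwa [a], .inr ⟨a.symm, hh⟩⟩
        · obtain ⟨a, b, c⟩ := h3 j hj (.inr ⟨ht, hh⟩)
          exact .inr ⟨hd, ht, hh, a, b, c.trans hd⟩
    · exact .inl ⟨hd, h3 j hj (.inl hd)⟩
  obtain ⟨τ, T, hT, hdead, hrank⟩ := H.rank
  have hlive : ∀ j < m, dd j = 0 → τ (t j) = T ∧ τ (h j) = T := by
    intro j hj hd
    have := (not_congr (hdead j hj)).1 (by simpa using hd)
    have := hT (t j)
    have := hT (h j)
    omega
  have hxT : τ x = T := by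
    obtain ⟨e, he, hd, rfl | rfl⟩ := hend
    · exact (hlive e he hd).1
    · exact (hlive e he hd).2
  -- The head of a dead edge was eliminated before its tail, while x is still present. So edges
  -- directed now never share their head with earlier ones.
  have hdeadx : ∀ j < m, dd j ≠ 0 → h j ≠ x := by
    rintro j hj hd rfl
    have := hrank j hj hd
    have := hT (t j)
    omega
  -- The rank is the time of elimination, with T for the vertices still present. Now x keeps T for
  -- good and the remaining vertices move up to T + 1.
  refine ⟨?_, ⟨fun v => if v = x then T else if τ v = T then T + 1 else τ v, T + 1, ?_, ?_, ?_⟩, ?_⟩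
  · intro i hi
    rcases hcase i hi with ⟨-, a, b, -⟩ | ⟨hd, a, -, -, b⟩ | ⟨-, -, -, a, b, -⟩
    · rw [a, b]; exact H.arcs i hi
    · rcases b with ⟨b, c⟩ | ⟨b, c⟩
      · have hk : kd i ≠ 1 := fun hk => directed_of_not_bad hx hi hd hk b
        rcases H.arcs i hi with ⟨p, q⟩ | ⟨-, p, q⟩
        · exact .inr ⟨hk, by rw [← c, q], by rw [a, ← b, p]⟩
        · exact .inl ⟨by rw [← c, q], by rw [a, ← b, p]⟩
      · rw [a, ← b, ← c]; exact H.arcs i hi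
    · rw [a, b]; exact H.arcs i hi
  · intro v
    have := hT v
    dsimp only
    split_ifs <;> omega
  · intro i hi
    have e1 := hdead i hi
    have e2 := hT (t i)
    have e3 := hT (h i)
    rcases hcase i hi with ⟨hd, a, b, c⟩ | ⟨hd, a, c, hn, b⟩ | ⟨hd, a', b', a, b, c⟩
    · rw [a, b, c]
      simp only [hd, ne_eq, not_false_eq_true, true_iff] at e1 ⊢
      rcases e1 with e1 | e1
      · left
        split_ifs <;> omega
      · right
        split_ifs <;> omega
    · simp [a, c]
    · obtain ⟨f1, f2⟩ := hlive i hi hd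
      simp [a, b, c, a', b', f1, f2]
  · intro i hi hdi
    rcases hcase i hi with ⟨hd, a, b, c⟩ | ⟨hd, a, c, hn, b⟩ | ⟨hd, a', b', a, b, c⟩
    · have e1 := hrank i hi hd
      have e2 := hT (t i)
      have e3 := hdeadx i hi hd
      have e4 : τ (h i) ≠ T := by omega
      rw [a, b]
      simp only [if_neg e3, if_neg e4]
      split_ifs <;> omega
    · have e5 : τ (t' i) = T := by
        obtain ⟨f1, f2⟩ := hlive i hi hd
        rcases b with ⟨-, b⟩ | ⟨b, -⟩ <;> rw [← b] <;> assumption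
      simp [a, hn, e5]
    · exact absurd c hdi
  -- An undirected edge newly directed into x has its tail adjacent to all other living neighbours
  -- of x, so nonadjacent tails force directed kinds.
  · have hnew : ∀ i < m, ∀ j < m, dd i = 0 → Joins t h i x (t' i) → dd j = 0 →
        Joins t h j x (t' j) → t' i ≠ t' j → ¬ Joined m t₀ h₀ (t' i) (t' j) → kd i = 1 := by
      intro i hi j hj hdi hti hdj htj htt hadj
      by_contra hk
      rcases joined_of_not_bad hx hi hdi hk hti hj hdj htj with e | e
      · exact htt e.symm
      · exact hadj ((H.joined_iff _ _).1 e)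
    intro i hi j hj hdi hdj hh htt hadj
    rcases hcase i hi with ⟨hd, a, b, c⟩ | ⟨hd, a, c, hn, b⟩ | ⟨hd, a', b', a, b, c⟩
    · rcases hcase j hj with ⟨hd', p, q, r⟩ | ⟨hd', p, r, hn', q⟩ | ⟨hd', p', q', p, q, r⟩
      · rw [a, p] at htt hadj
        rw [b, q] at hh
        exact H.vstr i hi j hj hd hd' hh htt hadj
      · exact absurd (by rw [← b, hh, p]) (hdeadx i hi hd)
      · exact absurd r hdj
    · rcases hcase j hj with ⟨hd', p, q, r⟩ | ⟨hd', p, r, hn', q⟩ | ⟨hd', p', q', p, q, r⟩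
      · exact absurd (by rw [← q, ← hh, a]) (hdeadx j hj hd')
      · refine ⟨hnew i hi j hj hd b hd' q htt hadj, hnew j hj i hi hd' q hd b htt.symm ?_⟩
        rintro ⟨k, hk, hkj⟩
        exact hadj ⟨k, hk, hkj.symm⟩
      · exact absurd r hdj
    · exact absurd c hdi

/-- A DAG `R` with the skeleton of the edge list that respects its directed edges and has no
other v-structures than those formed by directed edges. -/
structure Extends (m : ℕ) (t₀ h₀ kd : ℕ → ℕ) (R : ℕ → ℕ → Prop) (ρ : ℕ → ℕ) : Prop where
  arc : ∀ i < m, R (t₀ i) (h₀ i) ∨ R (h₀ i) (t₀ i)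
  directed : ∀ i < m, kd i = 1 → R (t₀ i) (h₀ i)
  rank : ∀ u v, R u v → ρ u < ρ v
  vstr : ∀ u v w, R u v → R w v → u ≠ w → ¬ Joined m t₀ h₀ u w →
    ∀ i < m, Joins t₀ h₀ i u v → kd i = 1

/-- Take the end x of a living edge that comes last in the reference DAG `R`. There all living edges
point into x, so a directed edge cannot leave x, and a failure of the neighbour condition would be a
v-structure of `R` with an undirected edge. The directions chosen so far need not agree with `R`:
only living edges are compared. -/
theorem Elim.exists_not_bad {m : ℕ} {t₀ h₀ kd t h dd : ℕ → ℕ} {R : ℕ → ℕ → Prop} {ρ : ℕ → ℕ}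
    (H : Elim m t₀ h₀ kd t h dd) (HR : Extends m t₀ h₀ kd R ρ) (hl : ∃ e < m, dd e = 0) :
    ∃ e < m, dd e = 0 ∧
      (¬ VertexBad m t h kd dd (t e) ∨ ¬ VertexBad m t h kd dd (h e)) := by
  obtain ⟨x, ⟨e, he, hd, hex⟩, hmax⟩ := Set.exists_max_image
    {x | ∃ e < m, dd e = 0 ∧ (t e = x ∨ h e = x)} ρ (by
      refine (((Set.finite_Iio m).image t).union ((Set.finite_Iio m).image h)).subset ?_
      rintro x ⟨e, he, -, h1 | h1⟩
      · exact .inl ⟨e, he, h1⟩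
      · exact .inr ⟨e, he, h1⟩) (by
      obtain ⟨e, he, hd⟩ := hl
      exact ⟨t e, e, he, hd, .inl rfl⟩)
  have hin : ∀ j < m, dd j = 0 → ∀ w, Joins t h j x w → R w x := by
    intro j hj hdj w hw
    have hle : ρ w ≤ ρ x := hmax w ⟨j, hj, hdj, hw.elim (fun a => .inr a.2) fun a => .inl a.1⟩
    have hw' := (H.joins_iff hj x w).1 hw
    have : R w x ∨ R x w := by
      rcases hw' with ⟨rfl, rfl⟩ | ⟨rfl, rfl⟩
      · exact (HR.arc j hj).symm
      · exact HR.arc j hj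
    exact this.resolve_right fun h' => absurd (HR.rank _ _ h') (not_lt.2 hle)
  have hnb : ¬ VertexBad m t h kd dd x := by
    have key : ∀ j < m, dd j = 0 → ∀ y, Joins t h j x y → kd j ≠ 1 →
        ¬ ∃ k < m, dd k = 0 ∧ ((t k = x ∧ ¬ (h k = y ∨ Joined m t h y (h k))) ∨
        (h k = x ∧ ¬ (t k = y ∨ Joined m t h y (t k)))) := by
      intro j hj hdj y hy hk ⟨k, hkm, hdk, hor⟩
      have : ∃ w, Joins t h k x w ∧ ¬ (w = y ∨ Joined m t h y w) := by
        rcases hor with ⟨h1, h2⟩ | ⟨h1, h2⟩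
        · exact ⟨_, .inl ⟨h1, rfl⟩, h2⟩
        · exact ⟨_, .inr ⟨rfl, h1⟩, h2⟩
      obtain ⟨w, hw, hn⟩ := this
      rw [not_or, H.joined_iff] at hn
      exact hk (HR.vstr y x w (hin j hj hdj y hy) (hin k hkm hdk w hw) (Ne.symm hn.1) hn.2 j hj
        ((H.joins_iff hj y x).1 hy.symm))
    rintro ⟨j, hj, hdj, ⟨hxj, ⟨hk, -⟩ | ⟨hk, hb⟩⟩ | ⟨hxj, ⟨-, h0⟩ | ⟨hk, hb⟩⟩⟩
    · have h1 := hin j hj hdj (h j) (.inl ⟨hxj.symm, rfl⟩)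
      rcases H.arcs j hj with ⟨a, b⟩ | ⟨hk', -⟩
      · have h2 := HR.directed j hj hk
        rw [← a, ← b, ← hxj] at h2
        exact absurd (HR.rank _ _ h1) (not_lt.2 (HR.rank _ _ h2).le)
      · exact hk' hk
    · exact key j hj hdj (h j) (.inl ⟨hxj.symm, rfl⟩) hk (by rwa [hxj])
    · simp at h0
    · exact key j hj hdj (t j) (.inr ⟨rfl, hxj.symm⟩) hk (by rwa [hxj])
  refine ⟨e, he, hd, ?_⟩
  rcases hex with rfl | rfl
  · exact .inl hnb
  · exact .inr hnb

/-- One round: eliminate a vertex. -/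
def eliminate : Code := scan ;; pick ;; orient

/-- The number of living edges. -/
def living (m : ℕ) (dd : ℕ → ℕ) : ℕ := ((Finset.range m).filter (fun i => dd i = 0)).card

/-- The stamps in the arrays of marks are not larger than the registers that produce them. -/
def StampsOK (μ : Mem) : Prop :=
  (∀ v, μ.arr aMark v ≤ μ.reg rStamp) ∧ ∀ v, μ.arr aBad v ≤ μ.reg rRound

/-- If a vertex is picked, the living edge on which it was found dies. If none is picked, then every
end of a living edge is bad, so by `Elim.exists_not_bad` no edge is living. -/
theorem run_eliminate (μ : Mem) {t₀ h₀ : ℕ → ℕ} {R : ℕ → ℕ → Prop} {ρ : ℕ → ℕ}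
    (hz : μ.reg rZero = 0) (ho : μ.reg rOne = 1) (hs : StampsOK μ)
    (hloop : ∀ i < μ.reg rM, t₀ i ≠ h₀ i) (HR : Extends (μ.reg rM) t₀ h₀ (μ.arr aKind) R ρ)
    (H : Elim (μ.reg rM) t₀ h₀ (μ.arr aKind) (μ.arr aTail) (μ.arr aHead) (μ.arr aDead)) :
    StampsOK (eliminate.run μ) ∧
    Elim (μ.reg rM) t₀ h₀ (μ.arr aKind) ((eliminate.run μ).arr aTail)
      ((eliminate.run μ).arr aHead) ((eliminate.run μ).arr aDead) ∧
    (living (μ.reg rM) ((eliminate.run μ).arr aDead) < living (μ.reg rM) (μ.arr aDead) ∨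
      living (μ.reg rM) ((eliminate.run μ).arr aDead) = 0) := by
  have hrun : eliminate.run μ = orient.run (pick.run (scan.run μ)) := rfl
  rw [hrun]
  clear hrun
  obtain ⟨a1, a2, a3⟩ := run_scan μ hz ho hs.1 hs.2
  have A := agree_run scan μ
  generalize scan.run μ = μ₁ at *
  have b1 := run_pick μ₁ ((A.reg _ (by decide)).trans hz)
  have B := agree_run pick μ₁
  generalize pick.run μ₁ = μ₂ at *
  have hz2 : μ₂.reg rZero = 0 := ((B.reg _ (by decide)).trans (A.reg _ (by decide))).trans hz
  have ho2 : μ₂.reg rOne = 1 := ((B.reg _ (by decide)).trans (A.reg _ (by decide))).trans ho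
  have hm2 : μ₂.reg rM = μ.reg rM := (B.reg _ (by decide)).trans (A.reg _ (by decide))
  have e0 : μ₂.arr aTail = μ.arr aTail := (B.arr _ (by decide)).trans (A.arr _ (by decide))
  have e1 : μ₂.arr aHead = μ.arr aHead := (B.arr _ (by decide)).trans (A.arr _ (by decide))
  have e2 : μ₂.arr aDead = μ.arr aDead := (B.arr _ (by decide)).trans (A.arr _ (by decide))
  have C := agree_run orient μ₂
  have hs2 : StampsOK (orient.run μ₂) := by
    constructor
    · intro v
      rw [C.arr _ (by decide), C.reg _ (by decide), B.arr _ (by decide), B.reg _ (by decide)]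
      exact a2 v
    · intro v
      rw [C.arr _ (by decide), C.reg _ (by decide), B.arr _ (by decide), B.reg _ (by decide), a1]
      exact (a3 v).1
  refine ⟨hs2, ?_⟩
  rw [A.reg rM (by decide), A.arr aDead (by decide), A.arr aTail (by decide),
    A.arr aHead (by decide), a1] at b1
  rcases b1 with ⟨hf, hb, e, he, hde, hend⟩ | ⟨hf, hall⟩
  · have hnb : ¬ VertexBad (μ.reg rM) (μ.arr aTail) (μ.arr aHead) (μ.arr aKind) (μ.arr aDead)
        (μ₂.reg rX) := fun h => hb ((a3 _).2.2 h)
    have key := run_orient μ₂ hz2 ho2 hf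
    rw [hm2, e0, e1, e2] at key
    refine ⟨H.step hnb ⟨e, he, hde, hend⟩ hloop (fun j hj => (key j hj).1)
      (fun j hj => (key j hj).2.1) (fun j hj => (key j hj).2.2), .inl ?_⟩
    refine Finset.card_lt_card ⟨?_, ?_⟩
    · intro j hj
      simp only [Finset.mem_filter, Finset.mem_range] at hj ⊢
      refine ⟨hj.1, ?_⟩
      by_contra hd
      rw [((key j hj.1).2.2 (.inl hd)).2.2] at hj
      exact hd hj.2
    · intro hsub
      have := hsub (Finset.mem_filter.2 ⟨Finset.mem_range.2 he, hde⟩)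
      simp only [Finset.mem_filter, Finset.mem_range] at this
      have h1 : (orient.run μ₂).arr aDead e = 1 := by
        by_cases ht : μ.arr aTail e = μ₂.reg rX
        · exact ((key e he).1 hde ht).2.2
        · exact ((key e he).2.1 hde ht (hend.resolve_left ht)).2.2
      omega
  · have hno : orient.run μ₂ = μ₂ := by
      simp [orient, run, Test.On, hf, ho2]
    rw [hno, e0, e1, e2]
    refine ⟨H, .inr ?_⟩
    rw [living, Finset.card_eq_zero, Finset.filter_eq_empty_iff]
    intro i hi hd
    obtain ⟨e, he, hde, h'⟩ := H.exists_not_bad HR ⟨i, Finset.mem_range.1 hi, hd⟩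
    obtain ⟨c1, c2⟩ := hall e he hde
    rcases h' with h' | h'
    · exact h' ((a3 _).2.1 c1)
    · exact h' ((a3 _).2.1 c2)

/-- Direct all edges. -/
def extend : Code := .rep rR eliminate

/-- Each round kills a living edge while there is one, so as many rounds as edges suffice; counting
rounds by edges keeps the cost independent of the number of vertices. -/
theorem run_extend (μ : Mem) {R : ℕ → ℕ → Prop} {ρ : ℕ → ℕ}
    (hz : μ.reg rZero = 0) (ho : μ.reg rOne = 1) (hs : StampsOK μ)
    (hd : ∀ i, μ.arr aDead i = 0)
    (hloop : ∀ i < μ.reg rM, μ.arr aTail i ≠ μ.arr aHead i)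
    (HR : Extends (μ.reg rM) (μ.arr aTail) (μ.arr aHead) (μ.arr aKind) R ρ) :
    StampsOK (extend.run μ) ∧ ∃ dd : ℕ → ℕ, (∀ i < μ.reg rM, dd i ≠ 0) ∧
    Elim (μ.reg rM) (μ.arr aTail) (μ.arr aHead) (μ.arr aKind) ((extend.run μ).arr aTail)
      ((extend.run μ).arr aHead) dd := by
  have key := rep_induction (i := rR) (P := eliminate) (by decide) μ (fun k ν => StampsOK ν ∧
    Elim (μ.reg rM) (μ.arr aTail) (μ.arr aHead) (μ.arr aKind) (ν.arr aTail) (ν.arr aHead)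
      (ν.arr aDead) ∧ living (μ.reg rM) (ν.arr aDead) ≤ μ.reg rM - k) ?_ ?_
  · refine ⟨key.1, _, ?_, key.2.1⟩
    have h0 := key.2.2
    rw [Nat.sub_self, Nat.le_zero, living, Finset.card_eq_zero, Finset.filter_eq_empty_iff] at h0
    exact fun i hi => h0 (Finset.mem_range.2 hi)
  -- At the start no vertex is eliminated: all ranks equal T = 0.
  · refine ⟨⟨?_, ?_⟩, ⟨fun i _ => .inl ⟨rfl, rfl⟩, ⟨fun _ => 0, 0, by simp, ?_, ?_⟩, ?_⟩, ?_⟩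
    · simpa using hs.1
    · simpa using hs.2
    · simp [hd]
    · simp [hd]
    · simp [hd]
    · refine (Finset.card_filter_le _ _).trans ?_
      simp
  · intro k hk ν hA hi ⟨h1, h2, h3⟩
    have e0 : ν.arr aKind = μ.arr aKind := hA.arr aKind (by decide)
    have e1 : ν.reg rM = μ.reg rM := hA.reg rM (by decide)
    have h4 := run_eliminate ν (t₀ := μ.arr aTail) (h₀ := μ.arr aHead) (R := R) (ρ := ρ)
      ((hA.reg _ (by decide)).trans hz) ((hA.reg _ (by decide)).trans ho) h1
      (by rwa [e1]) (by rwa [e0, e1]) (by rwa [e0, e1])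
    rw [e0, e1] at h4
    refine ⟨⟨?_, ?_⟩, ?_, ?_⟩
    · simpa using h4.1.1
    · simpa using h4.1.2
    · simpa using h4.2.1
    · simp only [Mem.setReg_arr]
      omega

end Extension

/-! ### From the edge list of the CPDAG to a member of the class -/

section Input

variable {n : ℕ}

/-- The graph with arcs `t i → h i` for `i < m`. -/
def arcGraph (n m : ℕ) (t h : ℕ → ℕ) : Digraph (Fin n) where
  Adj u v := ∃ i < m, t i = u ∧ h i = v

/-- The edge list `t₀, h₀` with kinds `kd` is the CPDAG of the class `M`. -/
structure Lists (M : Set (Digraph (Fin n))) (m : ℕ) (t₀ h₀ kd : ℕ → ℕ) : Prop where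
  ends : ∀ i < m, ∃ u v : Fin n, t₀ i = u ∧ h₀ i = v ∧ (∀ D ∈ M, Adjacent D u v) ∧
    (kd i = 1 ↔ ∀ D ∈ M, D.Adj u v) ∧ ∃ D ∈ M, D.Adj u v
  edge : ∀ D ∈ M, ∀ u v : Fin n, Adjacent D u v → ∃ i < m, Joins t₀ h₀ i u v
  inj : ∀ i < m, ∀ j < m, ∀ u v : ℕ, Joins t₀ h₀ i u v → Joins t₀ h₀ j u v → i = j

/-- All members share the skeleton, so an edge without the opposite arc in the union has the listed
direction in every member. -/
theorem IsEdgeList.lists {M : Set (Digraph (Fin n))} (hM : IsMEC M)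
    {es : List (Fin n × Fin n × Bool)} (hes : IsEdgeList (cpdag M) es) :
    Lists M es.length ((initialState n es).arr aTail) ((initialState n es).arr aHead)
      ((initialState n es).arr aKind) := by
  obtain ⟨h1, h2, h3⟩ := hes
  have hget : ∀ i (hi : i < es.length), (initialState n es).arr aTail i = es[i].1 ∧
      (initialState n es).arr aHead i = es[i].2.1 ∧
      (initialState n es).arr aKind i = es[i].2.2.toNat := by
    intro i hi
    simp [initialState, List.getElem?_eq_getElem hi]
  have hadj : ∀ u v, (cpdag M).Adj u v → ∀ D ∈ M, Adjacent D u v := by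
    intro u v huv D hD
    obtain ⟨D', hD', h⟩ := cpdag_adj.1 huv
    exact ((hM.similar hD hD').skel u v).2 (.inl h)
  refine ⟨?_, ?_, ?_⟩
  · intro i hi
    obtain ⟨g1, g2, g3⟩ := hget i hi
    obtain ⟨a1, a2⟩ := h2 es[i] (List.getElem_mem hi)
    refine ⟨es[i].1, es[i].2.1, g1, g2, hadj _ _ a1, ?_, cpdag_adj.1 a1⟩
    have : (initialState n es).arr aKind i = 1 ↔ es[i].2.2 = true := by
      rw [g3]; cases es[i].2.2 <;> simp
    rw [this, a2, cpdag_adj]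
    constructor
    · intro hn D hD
      exact (hadj _ _ a1 D hD).resolve_right fun h => hn ⟨D, hD, h⟩
    · rintro hall ⟨D, hD, h⟩
      exact (hM.isDAG hD).asymm (hall D hD) h
  · intro D hD u v huv
    have : ∃ e ∈ es, s(e.1, e.2.1) = s(u, v) := by
      rcases huv with h | h
      · exact h3 u v (cpdag_adj.2 ⟨D, hD, h⟩)
      · rw [Sym2.eq_swap]
        exact h3 v u (cpdag_adj.2 ⟨D, hD, h⟩)
    obtain ⟨e, he, heq⟩ := this
    obtain ⟨i, hi, rfl⟩ := List.getElem_of_mem he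
    obtain ⟨g1, g2, g3⟩ := hget i hi
    refine ⟨i, hi, ?_⟩
    simp only [Joins, g1, g2]
    rcases Sym2.eq_iff.1 heq with ⟨a, b⟩ | ⟨a, b⟩
    · exact .inl ⟨by rw [a], by rw [b]⟩
    · exact .inr ⟨by rw [a], by rw [b]⟩
  · have key : ∀ i (hi : i < es.length) j (hj : j < es.length), i < j → ∀ u v : ℕ,
        Joins ((initialState n es).arr aTail) ((initialState n es).arr aHead) i u v →
        Joins ((initialState n es).arr aTail) ((initialState n es).arr aHead) j u v → False := by
      intro i hi j hj hij u v hu hv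
      have := List.pairwise_iff_getElem.1 h1 i j hi hj hij
      obtain ⟨g1, g2, g3⟩ := hget i hi
      obtain ⟨g1', g2', g3'⟩ := hget j hj
      simp only [Joins, g1, g2, g1', g2'] at hu hv
      apply this
      rw [Sym2.eq_iff]
      simp only [Fin.ext_iff]
      omega
    intro i hi j hj u v hu hv
    rcases lt_trichotomy i j with h | h | h
    · exact (key i hi j hj h u v hu hv).elim
    · exact h
    · exact (key j hj i hi h u v hv hu).elim

theorem IsEdgeList.length_eq {G : Digraph (Fin n)} {es : List (Fin n × Fin n × Bool)}
    (hes : IsEdgeList G es) : es.length = edgeCount G := by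
  obtain ⟨h1, h2, h3⟩ := hes
  have hnd : (es.map fun e => s(e.1, e.2.1)).Nodup := by
    rw [List.nodup_iff_pairwise_ne, List.pairwise_map]
    exact h1
  have : {e : Sym2 (Fin n) | ∃ u v, G.Adj u v ∧ e = s(u, v)} =
      ((es.map fun e => s(e.1, e.2.1)).toFinset : Set (Sym2 (Fin n))) := by
    ext e
    simp only [Set.mem_ofPred_eq, List.coe_toFinset, List.mem_map]
    constructor
    · rintro ⟨u, v, h, rfl⟩
      exact h3 u v h
    · rintro ⟨f, hf, rfl⟩
      exact ⟨_, _, (h2 f hf).1, rfl⟩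
  rw [edgeCount, this, Set.ncard_coe_finset, List.toFinset_card_of_nodup hnd, List.length_map]

variable {M : Set (Digraph (Fin n))} {m : ℕ} {t₀ h₀ kd : ℕ → ℕ}

theorem Lists.loopless (H : Lists M m t₀ h₀ kd) (hM : IsMEC M) (i : ℕ) (hi : i < m) :
    t₀ i ≠ h₀ i := by
  obtain ⟨u, v, h1, h2, h3, -⟩ := H.ends i hi
  obtain ⟨D, hD⟩ := hM.nonempty
  rw [h1, h2]
  intro e
  have e := Fin.ext e
  subst e
  exact (hM.isDAG hD).irrefl u ((h3 D hD).elim id id)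

theorem Lists.joined_iff (H : Lists M m t₀ h₀ kd) {D : Digraph (Fin n)} (hD : D ∈ M)
    (u v : Fin n) : Joined m t₀ h₀ u v ↔ Adjacent D u v := by
  constructor
  · rintro ⟨i, hi, hj⟩
    obtain ⟨a, b, h1, h2, h3, -⟩ := H.ends i hi
    simp only [Joins, h1, h2, ← Fin.ext_iff] at hj
    rcases hj with ⟨rfl, rfl⟩ | ⟨rfl, rfl⟩
    · exact h3 D hD
    · exact (h3 D hD).symm
  · exact H.edge D hD u v

/-- An edge of a v-structure is directed in the CPDAG. -/
theorem Lists.kind_of_vStruct (H : Lists M m t₀ h₀ kd) (hM : IsMEC M) {D : Digraph (Fin n)}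
    (hD : D ∈ M) {a b c : Fin n} (hv : VStruct D a b c) {i : ℕ} (hi : i < m)
    (hj : Joins t₀ h₀ i a b) : kd i = 1 ∧ t₀ i = a ∧ h₀ i = b := by
  obtain ⟨u, v, h1, h2, h3, h4, D₁, hD₁, h5⟩ := H.ends i hi
  have hall : ∀ D' ∈ M, D'.Adj a b := fun D' hD' => (((hM.similar hD hD').vstr a b c).1 hv).1
  simp only [Joins, h1, h2, ← Fin.ext_iff] at hj
  rcases hj with ⟨rfl, rfl⟩ | ⟨rfl, rfl⟩
  · exact ⟨h4.2 hall, h1, h2⟩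
  · exact absurd h5 ((hM.isDAG hD₁).asymm (hall D₁ hD₁))

/-- Any member of the class can serve as the reference DAG: edges of its v-structures are directed
alike in all members, hence listed as directed. -/
theorem Lists.exists_extends (H : Lists M m t₀ h₀ kd) (hM : IsMEC M) :
    ∃ R ρ, Extends m t₀ h₀ kd R ρ := by
  obtain ⟨D, hD⟩ := hM.nonempty
  obtain ⟨ρ, hρ⟩ := (hM.isDAG hD).exists_rank
  -- The default rank 0 outside the vertex set is harmless, as no arc ends or starts there.
  refine ⟨fun u v => ∃ (hu : u < n) (hv : v < n), D.Adj ⟨u, hu⟩ ⟨v, hv⟩,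
    fun u => if hu : u < n then ρ ⟨u, hu⟩ else 0, ?_, ?_, ?_, ?_⟩
  · intro i hi
    obtain ⟨u, v, h1, h2, h3, -⟩ := H.ends i hi
    rw [h1, h2]
    exact (h3 D hD).imp (fun h => ⟨u.2, v.2, h⟩) fun h => ⟨v.2, u.2, h⟩
  · intro i hi hk
    obtain ⟨u, v, h1, h2, -, h4, -⟩ := H.ends i hi
    rw [h1, h2]
    exact ⟨u.2, v.2, h4.1 hk D hD⟩
  · rintro u v ⟨hu, hv, h⟩
    simpa [hu, hv] using hρ _ _ h
  · rintro u v w ⟨hu, hv, h⟩ ⟨hw, _, h'⟩ huw hn i hi hj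
    refine (H.kind_of_vStruct (a := ⟨u, hu⟩) (b := ⟨v, hv⟩) (c := ⟨w, hw⟩) hM hD
      ⟨h, h', by simpa using huw, fun ha => hn ?_⟩ hi hj).1
    exact (H.joined_iff hD ⟨u, hu⟩ ⟨w, hw⟩).2 ha

/-- A complete elimination yields a member of the class. -/
theorem Lists.arcGraph_mem (H : Lists M m t₀ h₀ kd) (hM : IsMEC M) {t h dd : ℕ → ℕ}
    (hE : Elim m t₀ h₀ kd t h dd) (hdd : ∀ i < m, dd i ≠ 0) : arcGraph n m t h ∈ M := by
  obtain ⟨D, hD⟩ := hM.nonempty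
  have hadj : ∀ u v : Fin n, Adjacent (arcGraph n m t h) u v ↔ Joined m t₀ h₀ u v := by
    intro u v
    rw [← hE.joined_iff]
    constructor
    · rintro (⟨i, hi, a, b⟩ | ⟨i, hi, a, b⟩)
      · exact ⟨i, hi, .inl ⟨a, b⟩⟩
      · exact ⟨i, hi, .inr ⟨a, b⟩⟩
    · rintro ⟨i, hi, a | a⟩
      · exact .inl ⟨i, hi, a⟩
      · exact .inr ⟨i, hi, a⟩
  have hskel : ∀ u v, Adjacent D u v ↔ Adjacent (arcGraph n m t h) u v := fun u v => by
    rw [hadj, H.joined_iff hD]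
  obtain ⟨τ, T, hT, -, hr⟩ := hE.rank
  -- Arcs point to the vertex eliminated earlier, so T - τ is a topological numbering.
  refine hM.mem_of_similar hD (IsDAG.of_rank (fun v => T - τ v) ?_) ⟨hskel, ?_⟩
  · rintro u v ⟨i, hi, h1, h2⟩
    have := hr i hi (hdd i hi)
    have := hT (t i)
    rw [h1, h2] at *
    omega
  · intro a b c
    constructor
    · rintro ⟨h1, h2, h3, h4⟩
      have key : ∀ a c : Fin n, VStruct D a b c → (arcGraph n m t h).Adj a b := by
        intro a c hv
        obtain ⟨i, hi, hj⟩ := H.edge D hD a b (.inl hv.1)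
        obtain ⟨g1, g2, g3⟩ := H.kind_of_vStruct hM hD hv hi hj
        rcases hE.arcs i hi with ⟨e1, e2⟩ | ⟨e, -⟩
        · exact ⟨i, hi, e1.trans g2, e2.trans g3⟩
        · exact absurd g1 e
      exact ⟨key a c ⟨h1, h2, h3, h4⟩, key c a ⟨h2, h1, h3.symm, fun h => h4 h.symm⟩, h3,
        fun h => h4 ((hskel a c).2 h)⟩
    · rintro ⟨⟨i, hi, h1, h2⟩, ⟨j, hj, h3, h4⟩, h5, h6⟩
      have hk := hE.vstr i hi j hj (hdd i hi) (hdd j hj) (h2.trans h4.symm)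
        (by rw [h1, h3]; exact fun e => h5 (Fin.ext e)) (by rw [h1, h3, ← hadj]; exact h6)
      have key : ∀ (k : ℕ) (u : Fin n), k < m → kd k = 1 → t k = u → h k = b → D.Adj u b := by
        intro k u hk hkd hu hb
        obtain ⟨p, q, e1, e2, -, e4, -⟩ := H.ends k hk
        rcases hE.arcs k hk with ⟨f1, f2⟩ | ⟨f, -⟩
        · have hp : p = u := Fin.ext (by rw [← e1, ← f1, hu])
          have hq : q = b := Fin.ext (by rw [← e2, ← f2, hb])
          subst hp hq
          exact e4.1 hkd D hD
        · exact absurd hkd f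
      exact ⟨key i a hi hk.1 h1 h2, key j c hj hk.2 h3 h4, h5, fun h => h6 ((hskel a c).1 h)⟩

end Input

/-! ### Linear-time subroutines: covered test, reversal, queue, trie -/

section Subroutines

open Code

/-- Mark the vertex in `rX` and the parents of the vertex in `q` with a new stamp. -/
def markParents (q : ℕ) : Code :=
  .inc rStamp ;; .store aMark rX rStamp ;;
  .rep rK (.load rB aHead rK ;;
    .ite (.eq rB q) (.load rA aTail rK ;; .store aMark rA rStamp) .skip)

theorem run_markParents (q : ℕ) (hq : q = rX ∨ q = rY) (μ : Mem)
    (hμ : ∀ v, μ.arr aMark v ≤ μ.reg rStamp) :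
    ((markParents q).run μ).reg rStamp = μ.reg rStamp + 1 ∧
    ∀ v, ((markParents q).run μ).arr aMark v ≤ μ.reg rStamp + 1 ∧
      (((markParents q).run μ).arr aMark v = μ.reg rStamp + 1 ↔
        v = μ.reg rX ∨ ∃ i < μ.reg rM, μ.arr aHead i = μ.reg q ∧ μ.arr aTail i = v) := by
  refine rep_induction (by rcases hq with rfl | rfl <;> decide) _
    (fun k ν => ν.reg rStamp = μ.reg rStamp + 1 ∧
    ∀ v, ν.arr aMark v ≤ μ.reg rStamp + 1 ∧ (ν.arr aMark v = μ.reg rStamp + 1 ↔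
      v = μ.reg rX ∨ ∃ i < k, μ.arr aHead i = μ.reg q ∧ μ.arr aTail i = v)) ?_ ?_
  · simp [run]
    intro v
    have := hμ v
    rw [Function.update_apply]
    split_ifs with h
    · simp [h]
    · simp [h]; omega
  · intro k hk ν hA hi ⟨h1, h2⟩
    have e0 := hA.arr aTail (by rcases hq with rfl | rfl <;> decide)
    have e1 := hA.arr aHead (by rcases hq with rfl | rfl <;> decide)
    have e2 := hA.reg q (by rcases hq with rfl | rfl <;> decide)
    have hqs : q ≠ rStamp := by rcases hq with rfl | rfl <;> decide
    have hqB : q ≠ rB := by rcases hq with rfl | rfl <;> decide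
    simp [run, hqs] at e0 e1 e2
    simp only [exists_lt_succ_iff]
    clear hA
    generalize μ.arr aTail = t at *
    generalize μ.arr aHead = h at *
    generalize μ.reg q = y at *
    generalize μ.reg rX = x at *
    generalize μ.reg rStamp + 1 = S at *
    simp [run, Test.On, e0, e1, e2, hi, h1, hqB, Mem.ite_arr, Mem.ite_reg]
    intro v
    obtain ⟨h3, h4⟩ := h2 v
    generalize (∃ i < k, h i = y ∧ t i = v) = E at *
    simp only [Function.update_apply, ite_apply]
    grind

/-- Raise the flag if some parent of the vertex in `p` lacks the current stamp. -/
def checkParents (p : ℕ) : Code :=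
  .rep rK (.load rB aHead rK ;;
    .ite (.eq rB p) (.load rA aTail rK ;; .load rQ aMark rA ;;
      .ite (.eq rQ rStamp) .skip (.const rFlag 1)) .skip)

theorem run_checkParents (p : ℕ) (hp : p = rX ∨ p = rY) (μ : Mem) :
    ((checkParents p).run μ).reg rFlag = 0 ↔ μ.reg rFlag = 0 ∧
      ¬ ∃ i < μ.reg rM, μ.arr aHead i = μ.reg p ∧ μ.arr aMark (μ.arr aTail i) ≠ μ.reg rStamp := by
  refine rep_induction (by rcases hp with rfl | rfl <;> decide) _
    (fun k ν => ν.reg rFlag = 0 ↔ μ.reg rFlag = 0 ∧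
      ¬ ∃ i < k, μ.arr aHead i = μ.reg p ∧ μ.arr aMark (μ.arr aTail i) ≠ μ.reg rStamp) ?_ ?_
  · simp
  · intro k hk ν hA hi h1
    have e0 := hA.arr aTail (by rcases hp with rfl | rfl <;> decide)
    have e1 := hA.arr aHead (by rcases hp with rfl | rfl <;> decide)
    have e2 := hA.arr aMark (by rcases hp with rfl | rfl <;> decide)
    have e3 := hA.reg p (by rcases hp with rfl | rfl <;> decide)
    have e4 := hA.reg rStamp (by rcases hp with rfl | rfl <;> decide)
    have hpB : p ≠ rB := by rcases hp with rfl | rfl <;> decide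
    simp only [exists_lt_succ_iff]
    clear hA
    generalize μ.arr aTail = t at *
    generalize μ.arr aHead = h at *
    generalize μ.arr aMark = mk at *
    generalize μ.reg p = y at *
    generalize μ.reg rStamp = S at *
    simp only [run, Test.On, e0, e1, e2, e3, e4, hi, hpB, Mem.ite_reg, Mem.setReg_reg,
      Mem.setReg_arr]
    generalize (∃ i < k, _) = E at *
    by_cases g1 : h k = y <;> by_cases g2 : mk (t k) = S <;> simp [g1, g2, h1]

/-- The edge `i` is covered. -/
def CoveredAt (m : ℕ) (t h : ℕ → ℕ) (i : ℕ) : Prop :=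
  (∀ k < m, h k = h i → t k = t i ∨ ∃ j < m, h j = t i ∧ t j = t k) ∧
    ∀ k < m, h k = t i → t k = t i ∨ ∃ j < m, h j = h i ∧ t j = t k

/-- Raise the flag if the current edge is not covered. -/
def checkCovered : Code :=
  .load rX aTail rCur ;; .load rY aHead rCur ;;
  markParents rX ;; checkParents rY ;; markParents rY ;; checkParents rX

/-- The two inclusions between Pa(x) ∪ {x} and Pa(y) are tested one after the other, each by
stamping one set and looking up the members of the other. The routine `markParents` stamps x in both
passes; in the second one this is superfluous but harmless, because x is a parent of y. -/
theorem run_checkCovered (μ : Mem) (hμ : ∀ v, μ.arr aMark v ≤ μ.reg rStamp) :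
    (∀ v, (checkCovered.run μ).arr aMark v ≤ (checkCovered.run μ).reg rStamp) ∧
    ((checkCovered.run μ).reg rFlag = 0 ↔
      μ.reg rFlag = 0 ∧ CoveredAt (μ.reg rM) (μ.arr aTail) (μ.arr aHead) (μ.reg rCur)) := by
  have hrun : checkCovered.run μ = (checkParents rX).run ((markParents rY).run
    ((checkParents rY).run ((markParents rX).run
      ((.load rX aTail rCur ;; .load rY aHead rCur : Code).run μ)))) := rfl
  rw [hrun]
  clear hrun
  have r0 : ((.load rX aTail rCur ;; .load rY aHead rCur : Code).run μ).arr = μ.arr := by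
    simp [run]
  have rx : ((.load rX aTail rCur ;; .load rY aHead rCur : Code).run μ).reg rX =
    μ.arr aTail (μ.reg rCur) := by simp [run]
  have ry : ((.load rX aTail rCur ;; .load rY aHead rCur : Code).run μ).reg rY =
    μ.arr aHead (μ.reg rCur) := by simp [run]
  have r1 : ∀ z, z ≠ rX → z ≠ rY →
      ((.load rX aTail rCur ;; .load rY aHead rCur : Code).run μ).reg z = μ.reg z := by
    intro z h1 h2
    simp [run, h1, h2]
  generalize (.load rX aTail rCur ;; .load rY aHead rCur : Code).run μ = μ₁ at *
  have hS : μ₁.reg rStamp = μ.reg rStamp := r1 _ (by decide) (by decide)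
  have hF : μ₁.reg rFlag = μ.reg rFlag := r1 _ (by decide) (by decide)
  have hm : μ₁.reg rM = μ.reg rM := r1 _ (by decide) (by decide)
  obtain ⟨a1, a2⟩ := run_markParents rX (.inl rfl) μ₁ (by rw [r0, hS]; exact hμ)
  have A := agree_run (markParents rX) μ₁
  generalize (markParents rX).run μ₁ = μ₂ at *
  have b1 := run_checkParents rY (.inr rfl) μ₂
  have B := agree_run (checkParents rY) μ₂
  generalize (checkParents rY).run μ₂ = μ₃ at *
  obtain ⟨c1, c2⟩ := run_markParents rY (.inr rfl) μ₃ (by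
    rw [B.arr _ (by decide), B.reg _ (by decide), a1]
    exact fun v => (a2 v).1)
  have C := agree_run (markParents rY) μ₃
  generalize (markParents rY).run μ₃ = μ₄ at *
  have d1 := run_checkParents rX (.inl rfl) μ₄
  have D := agree_run (checkParents rX) μ₄
  generalize (checkParents rX).run μ₄ = μ₅ at *
  constructor
  · intro v
    rw [D.arr _ (by decide), D.reg _ (by decide), c1]
    exact (c2 v).1
  · rw [d1, C.reg rFlag (by decide), b1, A.reg rFlag (by decide), hF, and_assoc]
    refine and_congr_right fun _ => ?_
    have hx2 : μ₂.reg rX = μ.arr aTail (μ.reg rCur) := (A.reg _ (by decide)).trans rx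
    have hy2 : μ₂.reg rY = μ.arr aHead (μ.reg rCur) := (A.reg _ (by decide)).trans ry
    have hx3 : μ₃.reg rX = μ.arr aTail (μ.reg rCur) := (B.reg _ (by decide)).trans hx2
    have hy3 : μ₃.reg rY = μ.arr aHead (μ.reg rCur) := (B.reg _ (by decide)).trans hy2
    have hx4 : μ₄.reg rX = μ.arr aTail (μ.reg rCur) := (C.reg _ (by decide)).trans hx3
    have hm2 : μ₂.reg rM = μ.reg rM := (A.reg _ (by decide)).trans hm
    have hm3 : μ₃.reg rM = μ.reg rM := (B.reg _ (by decide)).trans hm2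
    have hm4 : μ₄.reg rM = μ.reg rM := (C.reg _ (by decide)).trans hm3
    have h2 : μ₂.arr aHead = μ.arr aHead := (A.arr _ (by decide)).trans (by rw [r0])
    have t2 : μ₂.arr aTail = μ.arr aTail := (A.arr _ (by decide)).trans (by rw [r0])
    have h3 : μ₃.arr aHead = μ.arr aHead := (B.arr _ (by decide)).trans h2
    have t3 : μ₃.arr aTail = μ.arr aTail := (B.arr _ (by decide)).trans t2
    have h4 : μ₄.arr aHead = μ.arr aHead := (C.arr _ (by decide)).trans h3
    have t4 : μ₄.arr aTail = μ.arr aTail := (C.arr _ (by decide)).trans t3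
    have a2' := fun v => (a2 v).2
    have c2' := fun v => (c2 v).2
    rw [rx, r0, hm] at a2'
    rw [hx3, hy3, h3, t3, hm3] at c2'
    rw [hm2, h2, t2, hy2, a1, hm4, h4, t4, hx4, c1]
    simp only [ne_eq, a2', c2', CoveredAt]
    push Not
    rfl

/-- Reverse the current edge. -/
def flipEdge : Code :=
  .load rA aTail rCur ;; .load rB aHead rCur ;; .store aTail rCur rB ;; .store aHead rCur rA ;;
  .load rQ aRev rCur ;; .ite (.eq rQ rZero) (.store aRev rCur rOne) (.store aRev rCur rZero)

theorem run_flipEdge (μ : Mem) (hz : μ.reg rZero = 0) (ho : μ.reg rOne = 1) :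
    (flipEdge.run μ).arr aTail =
      Function.update (μ.arr aTail) (μ.reg rCur) (μ.arr aHead (μ.reg rCur)) ∧
    (flipEdge.run μ).arr aHead =
      Function.update (μ.arr aHead) (μ.reg rCur) (μ.arr aTail (μ.reg rCur)) ∧
    (flipEdge.run μ).arr aRev = Function.update (μ.arr aRev) (μ.reg rCur)
      (if μ.arr aRev (μ.reg rCur) = 0 then 1 else 0) := by
  simp [flipEdge, run, Test.On, hz, ho, Mem.ite_arr]
  split_ifs <;> rfl

/-- Append the current arcs to the queue. -/
def enqueue : Code :=
  .rep rK (.load rA aTail rK ;; .store aQueue rWrite rA ;; .inc rWrite ;;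
    .load rA aHead rK ;; .store aQueue rWrite rA ;; .inc rWrite)

/-- The arcs `t i → h i` for `i < m`, written out. -/
def arcWord (m : ℕ) (t h : ℕ → ℕ) : List ℕ := (List.range m).flatMap fun i => [t i, h i]

theorem arcWord_succ (m : ℕ) (t h : ℕ → ℕ) : arcWord (m + 1) t h = arcWord m t h ++ [t m, h m] := by
  simp [arcWord, List.range_succ]

theorem length_arcWord (m : ℕ) (t h : ℕ → ℕ) : (arcWord m t h).length = 2 * m := by
  induction m with
  | zero => rfl
  | succ m ih => rw [arcWord_succ, List.length_append, ih]; simp; omega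

theorem map_range_update (f : ℕ → ℕ) (k v : ℕ) :
    (List.range (k + 1)).map (Function.update f k v) = (List.range k).map f ++ [v] := by
  rw [List.range_succ, List.map_append]
  congr 1
  · refine List.map_congr_left fun i hi => ?_
    rw [Function.update_of_ne (List.mem_range.1 hi).ne]
  · simp

theorem run_enqueue (μ : Mem) :
    (List.range ((enqueue.run μ).reg rWrite)).map ((enqueue.run μ).arr aQueue) =
      (List.range (μ.reg rWrite)).map (μ.arr aQueue) ++
        arcWord (μ.reg rM) (μ.arr aTail) (μ.arr aHead) := by
  refine rep_induction (by decide) _ (fun k ν =>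
    (List.range (ν.reg rWrite)).map (ν.arr aQueue) =
      (List.range (μ.reg rWrite)).map (μ.arr aQueue) ++
        arcWord k (μ.arr aTail) (μ.arr aHead)) ?_ ?_
  · simp [arcWord]
  · intro k hk ν hA hi h
    have e0 := hA.arr aTail (by decide)
    have e1 := hA.arr aHead (by decide)
    rw [arcWord_succ, ← List.append_assoc, ← h]
    simp [run, e0, e1, hi, map_range_update]

/-- Write out the next word of the queue. -/
def emitWord : Code :=
  .rep rK (.load rA aQueue rRead ;; .emit rA ;; .inc rRead ;;
    .load rA aQueue rRead ;; .emit rA ;; .inc rRead)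

theorem run_emitWord (μ : Mem) :
    (emitWord.run μ).reg rRead = μ.reg rRead + 2 * μ.reg rM ∧
    (emitWord.run μ).buf = μ.buf ++
      (List.range (2 * μ.reg rM)).map fun j => μ.arr aQueue (μ.reg rRead + j) := by
  refine rep_induction (by decide) _ (fun k ν => ν.reg rRead = μ.reg rRead + 2 * k ∧
    ν.buf = μ.buf ++ (List.range (2 * k)).map fun j => μ.arr aQueue (μ.reg rRead + j)) ?_ ?_
  · simp
  · intro k hk ν hA hi ⟨h1, h2⟩
    have e0 := hA.arr aQueue (by decide)
    have e1 : 2 * (k + 1) = 2 * k + 1 + 1 := by ring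
    rw [e1, List.range_succ, List.range_succ]
    simp [run, e0, h1, h2, add_assoc]

/-! ### The trie of visited DAGs -/

/-- The first `k` values of `r`. -/
def keyOf (r : ℕ → Bool) (k : ℕ) : List Bool := (List.range k).map r

theorem keyOf_succ (r : ℕ → Bool) (k : ℕ) : keyOf r (k + 1) = keyOf r k ++ [r k] := by
  simp [keyOf, List.range_succ]

theorem length_keyOf (r : ℕ → Bool) (k : ℕ) : (keyOf r k).length = k := by simp [keyOf]

/-- The array `A` with first fresh cell `c` is a trie with the set `P` of nodes. The node `l` is
stored at the cells `f l` and `f l + 1`, which point to its children. -/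
structure TrieAt (A : ℕ → ℕ) (c : ℕ) (P : Set (List Bool)) (f : List Bool → ℕ) : Prop where
  root : f [] = 0
  nil_mem : [] ∈ P
  closed : ∀ l b, l ++ [b] ∈ P → l ∈ P
  lt : ∀ l ∈ P, f l + 1 < c
  inj : ∀ l ∈ P, ∀ l' ∈ P, ∀ b b' : Bool, f l + b.toNat = f l' + b'.toNat → l = l' ∧ b = b'
  child : ∀ l ∈ P, ∀ b : Bool, l ++ [b] ∈ P → A (f l + b.toNat) = f (l ++ [b])
  none : ∀ l ∈ P, ∀ b : Bool, l ++ [b] ∉ P → A (f l + b.toNat) = 0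
  fresh : ∀ i, c ≤ i → A i = 0

/-- Only the root lives at cell 0, so 0 can serve as the null pointer. -/
theorem TrieAt.ne_zero {A : ℕ → ℕ} {c : ℕ} {P : Set (List Bool)} {f : List Bool → ℕ}
    (H : TrieAt A c P f) {l : List Bool} {b : Bool} (hl : l ++ [b] ∈ P) : f (l ++ [b]) ≠ 0 := by
  intro h
  have := H.inj _ hl _ H.nil_mem false false (by rw [h, H.root])
  simp at this

/-- The new node occupies the cells c and c + 1, which contain 0 and so already say that it has no
children; only the pointer of its parent is written. -/
theorem TrieAt.insert {A : ℕ → ℕ} {c : ℕ} {P : Set (List Bool)} {f : List Bool → ℕ}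
    (H : TrieAt A c P f) {l : List Bool} {b : Bool} (hl : l ∈ P) (hlb : l ++ [b] ∉ P) :
    TrieAt (Function.update A (f l + b.toNat) c) (c + 2) (insert (l ++ [b]) P)
      (Function.update f (l ++ [b]) c) := by
  have hlt : ∀ l ∈ P, ∀ b : Bool, f l + b.toNat < c := by
    intro l hl b
    have := H.lt l hl
    have := Bool.toNat_le b
    omega
  have hf : ∀ l' ∈ P, Function.update f (l ++ [b]) c l' = f l' := fun l' hl' =>
    Function.update_of_ne (fun e => by subst e; exact hlb hl') _ _
  have hb1 : ∀ b : Bool, b.toNat ≤ 1 := Bool.toNat_le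
  refine ⟨?_, .inr H.nil_mem, ?_, ?_, ?_, ?_, ?_, ?_⟩
  · rw [hf _ H.nil_mem, H.root]
  · rintro l' b' (h | h)
    · obtain ⟨rfl, -⟩ := List.append_inj' h rfl
      exact .inr hl
    · exact .inr (H.closed _ _ h)
  · rintro l' (rfl | h)
    · simp
    · rw [hf _ h]
      have := H.lt l' h
      omega
  · rintro l₁ (rfl | h₁) l₂ (rfl | h₂) b₁ b₂ h
    · refine ⟨rfl, ?_⟩
      cases b₁ <;> cases b₂ <;> simp at h ⊢
    · rw [hf _ h₂, Function.update_self] at h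
      have := hlt l₂ h₂ b₂
      omega
    · rw [hf _ h₁, Function.update_self] at h
      have := hlt l₁ h₁ b₁
      omega
    · rw [hf _ h₁, hf _ h₂] at h
      exact H.inj _ h₁ _ h₂ _ _ h
  · rintro l' (rfl | h') b' h
    · exfalso
      rcases h with h | h
      · have := congrArg List.length h
        simp at this
      · exact hlb (H.closed _ _ h)
    · rw [hf _ h']
      by_cases he : l' = l ∧ b' = b
      · obtain ⟨rfl, rfl⟩ := he
        simp
      · have hne : l' ++ [b'] ≠ l ++ [b] := by
          intro e
          obtain ⟨e1, e2⟩ := List.append_inj' e rfl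
          exact he ⟨e1, by simpa using e2⟩
        rw [Function.update_of_ne (fun e => he (H.inj _ h' _ hl _ _ e)),
          Function.update_of_ne hne]
        exact H.child _ h' _ (h.resolve_left hne)
  · rintro l' (rfl | h') b' h
    · rw [Function.update_self, Function.update_of_ne (by have := hlt l hl b; omega)]
      exact H.fresh _ (by omega)
    · rw [hf _ h', Function.update_of_ne]
      · exact H.none _ h' _ fun e => h (.inr e)
      · intro e
        obtain ⟨rfl, rfl⟩ := H.inj _ h' _ hl _ _ e
        exact h (.inl rfl)
  · intro i hi
    rw [Function.update_of_ne (by have := hlt l hl b; omega)]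
    exact H.fresh _ (by omega)

/-- Insert the current flags into the trie; `rNew` tells whether they were new. -/
def trieInsert : Code :=
  .const rNew 0 ;; .const rNode 0 ;; .rep rK (
    .copy rX rNode ;; .load rQ aRev rK ;; .ite (.eq rQ rOne) (.inc rX) .skip ;;
    .load rY aTrie rX ;; .ite (.eq rY rZero) (.const rNew 1 ;; .copy rY rFresh ;;
      .store aTrie rX rY ;; .inc rFresh ;; .inc rFresh) .skip ;; .copy rNode rY)

/-- The loop descends along the key and creates missing nodes. As the old set of nodes is closed
under prefixes, the key leaves it at most once, so `rNew` tells at every stage whether the part read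
so far was an old node. -/
theorem run_trieInsert (μ : Mem) (hz : μ.reg rZero = 0) (ho : μ.reg rOne = 1) {r : ℕ → Bool}
    (hr : ∀ k, μ.arr aRev k = (r k).toNat) {P : Set (List Bool)}
    (hP : ∃ f, TrieAt (μ.arr aTrie) (μ.reg rFresh) P f) :
    (∃ f, TrieAt ((trieInsert.run μ).arr aTrie) ((trieInsert.run μ).reg rFresh)
      (P ∪ {l | l <+: keyOf r (μ.reg rM)}) f) ∧
    (((trieInsert.run μ).reg rNew = 0 ∧ keyOf r (μ.reg rM) ∈ P) ∨
      ((trieInsert.run μ).reg rNew = 1 ∧ keyOf r (μ.reg rM) ∉ P)) := by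
  have hcl : ∀ l b, l ++ [b] ∈ P → l ∈ P := hP.choose_spec.closed
  have key := rep_induction (i := rK) (P := .copy rX rNode ;; .load rQ aRev rK ;;
    .ite (.eq rQ rOne) (.inc rX) .skip ;;
    .load rY aTrie rX ;; .ite (.eq rY rZero) (.const rNew 1 ;; .copy rY rFresh ;;
      .store aTrie rX rY ;; .inc rFresh ;; .inc rFresh) .skip ;; .copy rNode rY) (by decide)
    ((.const rNew 0 ;; .const rNode 0 : Code).run μ) (fun k ν =>
      (∃ f, TrieAt (ν.arr aTrie) (ν.reg rFresh) (P ∪ {l | l <+: keyOf r k}) f ∧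
        ν.reg rNode = f (keyOf r k)) ∧
      ((ν.reg rNew = 0 ∧ keyOf r k ∈ P) ∨ (ν.reg rNew = 1 ∧ keyOf r k ∉ P))) ?_ ?_
  · exact ⟨key.1.imp fun f hf => hf.1, key.2⟩
  · obtain ⟨f, hf⟩ := hP
    have : P ∪ {l | l <+: keyOf r 0} = P := by
      ext l
      simp [keyOf]
      rintro rfl
      exact hf.nil_mem
    rw [this]
    refine ⟨⟨f, ?_, ?_⟩, ?_⟩
    · simpa [run] using hf
    · simp [run, keyOf, hf.root]
    · simp [run, keyOf, hf.nil_mem]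
  · rintro k hk ν hA hi ⟨⟨f, hf, hn⟩, hnew⟩
    have e0 := hA.arr aRev (by decide)
    have e1 := hA.reg rZero (by decide)
    have e2 := hA.reg rOne (by decide)
    simp [run] at e0 e1 e2
    rw [hz] at e1
    rw [ho] at e2
    have hmem : keyOf r k ∈ P ∪ {l | l <+: keyOf r k} := .inr List.prefix_rfl
    have hset : P ∪ {l | l <+: keyOf r (k + 1)} =
        insert (keyOf r k ++ [r k]) (P ∪ {l | l <+: keyOf r k}) := by
      ext l
      simp only [keyOf_succ, Set.mem_union, Set.mem_ofPred_eq, Set.mem_insert_iff,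
        List.prefix_concat_iff]
      tauto
    -- The child is longer than every prefix inserted so far, so if it is present it was present
    -- before the call.
    have hin : keyOf r k ++ [r k] ∈ P ∪ {l | l <+: keyOf r k} ↔ keyOf r k ++ [r k] ∈ P := by
      constructor
      · rintro (h | h)
        · exact h
        · have := List.IsPrefix.length_le h
          simp at this
      · exact .inl
    have hq : (if r k = true then f (keyOf r k) + 1 else f (keyOf r k)) =
        f (keyOf r k) + (r k).toNat := by
      cases r k <;> simp
    by_cases hmk : keyOf r k ++ [r k] ∈ P
    · have h1 := hf.child _ hmem _ (hin.2 hmk)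
      have h2 := hf.ne_zero (hin.2 hmk)
      have hkP : keyOf r k ∈ P := hcl _ _ hmk
      rw [hset, Set.insert_eq_of_mem (hin.2 hmk), keyOf_succ]
      refine ⟨⟨f, ?_, ?_⟩, .inl ⟨?_, hmk⟩⟩
      · simpa [run, Test.On, e0, e1, e2, hi, hr, hn, hq, h1, h2, Mem.ite_reg, Mem.ite_arr]
          using hf
      · simp [run, Test.On, e0, e1, e2, hi, hr, hn, hq, h1, h2, Mem.ite_reg, Mem.ite_arr]
      · have : ν.reg rNew = 0 := by simpa [hkP] using hnew
        simp [run, Test.On, e0, e1, e2, hi, hr, hn, hq, h1, h2, Mem.ite_reg, Mem.ite_arr, this]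
    · have h1 := hf.none _ hmem _ (fun h => hmk (hin.1 h))
      rw [hset, keyOf_succ]
      refine ⟨⟨Function.update f (keyOf r k ++ [r k]) (ν.reg rFresh), ?_, ?_⟩, .inr ⟨?_, hmk⟩⟩
      · have := hf.insert hmem (fun h => hmk (hin.1 h))
        simpa [run, Test.On, e0, e1, e2, hi, hr, hn, hq, h1, Mem.ite_reg, Mem.ite_arr, add_assoc]
          using this
      · simp [run, Test.On, e0, e1, e2, hi, hr, hn, hq, h1, Mem.ite_reg, Mem.ite_arr]
      · simp [run, Test.On, e0, e1, e2, hi, hr, hn, hq, h1, Mem.ite_reg, Mem.ite_arr]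

end Subroutines

/-! ### Members of the class as sets of reversed edges; the search as a transition system -/

section DepthFirst

/-- The tail of edge `k` after reversing the edges in `r`. -/
def dirTail (t h : ℕ → ℕ) (r : ℕ → Bool) (k : ℕ) : ℕ := if r k then h k else t k

/-- The head of edge `k` after reversing the edges in `r`. -/
def dirHead (t h : ℕ → ℕ) (r : ℕ → Bool) (k : ℕ) : ℕ := if r k then t k else h k

def flipAt (r : ℕ → Bool) (i : ℕ) : ℕ → Bool := Function.update r i (!r i)

theorem flipAt_flipAt (r : ℕ → Bool) (i : ℕ) : flipAt (flipAt r i) i = r := by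
  simp [flipAt]

theorem flipAt_inj {r : ℕ → Bool} {i j : ℕ} (h : flipAt r i = flipAt r j) : i = j := by
  by_contra hne
  have := congrFun h i
  simp [flipAt, Function.update_of_ne hne] at this

/-- No edge outside the edge list is reversed. -/
def Supp (m : ℕ) (r : ℕ → Bool) : Prop := ∀ k, m ≤ k → r k = false

theorem Supp.flipAt {m : ℕ} {r : ℕ → Bool} (hr : Supp m r) {i : ℕ} (hi : i < m) :
    Supp m (flipAt r i) := fun k hk => by
  rw [Chickering.flipAt, Function.update_of_ne (by omega)]
  exact hr k hk

/-- The DAG in which the edges in `r` are reversed. -/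
def revGraph (n m : ℕ) (t h : ℕ → ℕ) (r : ℕ → Bool) : Digraph (Fin n) :=
  arcGraph n m (dirTail t h r) (dirHead t h r)

/-- The arcs `t i → h i` for `i < m` are those of a member of the class `M`, without repetition. -/
structure IsBase {n : ℕ} (M : Set (Digraph (Fin n))) (m : ℕ) (t h : ℕ → ℕ) : Prop where
  mec : IsMEC M
  mem : arcGraph n m t h ∈ M
  lt : ∀ i < m, t i < n ∧ h i < n
  inj : ∀ i < m, ∀ j < m, ∀ u v : ℕ, Joins t h i u v → Joins t h j u v → i = j

variable {n m : ℕ} {M : Set (Digraph (Fin n))} {t h : ℕ → ℕ}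

theorem revGraph_false : revGraph n m t h (fun _ => false) = arcGraph n m t h := by
  rfl

theorem joins_dir (r : ℕ → Bool) (i : ℕ) : Joins t h i (dirTail t h r i) (dirHead t h r i) := by
  simp only [Joins, dirTail, dirHead]
  split_ifs <;> simp

theorem IsBase.exists_ends (H : IsBase M m t h) (r : ℕ → Bool) {i : ℕ} (hi : i < m) :
    ∃ u v : Fin n, dirTail t h r i = u ∧ dirHead t h r i = v := by
  obtain ⟨h1, h2⟩ := H.lt i hi
  simp only [dirTail, dirHead]
  split_ifs
  · exact ⟨⟨_, h2⟩, ⟨_, h1⟩, rfl, rfl⟩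
  · exact ⟨⟨_, h1⟩, ⟨_, h2⟩, rfl, rfl⟩

theorem IsBase.dir_unique (H : IsBase M m t h) (r : ℕ → Bool) {i j : ℕ} (hi : i < m) (hj : j < m)
    (h1 : dirTail t h r i = dirTail t h r j) (h2 : dirHead t h r i = dirHead t h r j) : i = j :=
  H.inj i hi j hj _ _ (joins_dir r i) (by rw [h1, h2]; exact joins_dir r j)

/-- The clause allowing t k = t i in both halves of `CoveredAt` is needed for parents of v; for
parents of u it changes nothing, since u itself is a parent of v. -/
theorem coveredAt_iff {t h : ℕ → ℕ} (hlt : ∀ k < m, t k < n) {i : ℕ} (hi : i < m) {u v : Fin n}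
    (hu : t i = u) (hv : h i = v) :
    CoveredAt m t h i ↔ Covered (arcGraph n m t h) u v := by
  have huv : (arcGraph n m t h).Adj u v := ⟨i, hi, hu, hv⟩
  simp only [CoveredAt, Covered, huv, true_and, hu, hv, Set.ext_iff, parents, Set.mem_union,
    Set.mem_ofPred_eq, Set.mem_singleton_iff]
  constructor
  · rintro ⟨h1, h2⟩ w
    constructor
    · rintro (⟨k, hk, e1, e2⟩ | rfl)
      · rcases h2 k hk e2 with e | ⟨j, hj, e3, e4⟩
        · rw [e1] at e
          rw [Fin.ext e]
          exact huv
        · exact ⟨j, hj, e4.trans e1, e3⟩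
      · exact huv
    · rintro ⟨k, hk, e1, e2⟩
      rcases h1 k hk e2 with e | ⟨j, hj, e3, e4⟩
      · exact .inr (Fin.ext (e1.symm.trans e))
      · exact .inl ⟨j, hj, e4.trans e1, e3⟩
  · intro H
    constructor
    · intro k hk e
      rcases (H ⟨t k, hlt k hk⟩).2 ⟨k, hk, rfl, e⟩ with ⟨j, hj, e1, e2⟩ | e1
      · exact .inr ⟨j, hj, e2, e1⟩
      · exact .inl (congrArg Fin.val e1)
    · intro k hk e
      obtain ⟨j, hj, e1, e2⟩ := (H ⟨t k, hlt k hk⟩).1 (.inl ⟨k, hk, rfl, e⟩)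
      exact .inr ⟨j, hj, e2, e1⟩

theorem IsBase.reverseEdge_eq (H : IsBase M m t h) (r : ℕ → Bool) {i : ℕ} (hi : i < m)
    {u v : Fin n} (hu : dirTail t h r i = u) (hv : dirHead t h r i = v) :
    reverseEdge (revGraph n m t h r) u v = revGraph n m t h (flipAt r i) := by
  have hi' : dirTail t h (flipAt r i) i = v ∧ dirHead t h (flipAt r i) i = u := by
    rw [← hu, ← hv]
    simp only [dirTail, dirHead, flipAt, Function.update_self]
    cases r i <;> simp
  have hk' : ∀ k, k ≠ i → dirTail t h (flipAt r i) k = dirTail t h r k ∧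
      dirHead t h (flipAt r i) k = dirHead t h r k := by
    intro k hk
    simp [dirTail, dirHead, flipAt, Function.update_of_ne hk]
  ext a b
  constructor
  · rintro (⟨⟨k, hk, e1, e2⟩, hn⟩ | ⟨rfl, rfl⟩)
    · have hki : k ≠ i := by
        rintro rfl
        exact hn ⟨Fin.ext (e1.symm.trans hu), Fin.ext (e2.symm.trans hv)⟩
      exact ⟨k, hk, (hk' k hki).1.trans e1, (hk' k hki).2.trans e2⟩
    · exact ⟨i, hi, hi'⟩
  · rintro ⟨k, hk, e1, e2⟩
    by_cases hki : k = i
    · subst hki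
      exact .inr ⟨Fin.ext (e1.symm.trans hi'.1), Fin.ext (e2.symm.trans hi'.2)⟩
    · rw [(hk' k hki).1] at e1
      rw [(hk' k hki).2] at e2
      refine .inl ⟨⟨k, hk, e1, e2⟩, ?_⟩
      rintro ⟨rfl, rfl⟩
      exact hki (H.dir_unique r hk hi (e1.trans hu.symm) (e2.trans hv.symm))

/-- If the flags differ at an edge, the common graph contains that edge in both directions, which no
DAG does; beyond m both are false. -/
theorem IsBase.revGraph_inj (H : IsBase M m t h) {r r' : ℕ → Bool} (hr : Supp m r)
    (hr' : Supp m r') (hM : revGraph n m t h r ∈ M)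
    (he : revGraph n m t h r = revGraph n m t h r') : r = r' := by
  funext i
  by_cases hi : i < m
  · by_contra hne
    obtain ⟨u, v, hu, hv⟩ := H.exists_ends r hi
    have h1 : (revGraph n m t h r).Adj u v := ⟨i, hi, hu, hv⟩
    have h2 : (revGraph n m t h r').Adj v u := by
      refine ⟨i, hi, ?_, ?_⟩
      · rw [← hv]
        simp only [dirTail, dirHead]
        cases h3 : r i <;> cases h4 : r' i <;> simp_all
      · rw [← hu]
        simp only [dirTail, dirHead]
        cases h3 : r i <;> cases h4 : r' i <;> simp_all
    exact (H.mec.isDAG hM).asymm h1 (he ▸ h2)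
  · rw [hr i (by omega), hr' i (by omega)]

/-- All members have the skeleton of the base, so it suffices to flag the edges on which they
disagree. -/
theorem IsBase.exists_revGraph (H : IsBase M m t h) {D : Digraph (Fin n)} (hD : D ∈ M) :
    ∃ r, Supp m r ∧ revGraph n m t h r = D := by
  classical
  have hdag := H.mec.isDAG hD
  have hsk := (H.mec.similar H.mem hD).skel
  set r : ℕ → Bool := fun k => decide (k < m ∧ ∃ u v : Fin n, t k = u ∧ h k = v ∧ D.Adj v u)
    with hr
  have key : ∀ k < m, ∀ u v : Fin n, t k = u → h k = v →
      (D.Adj u v ∨ D.Adj v u) ∧ (r k = true ↔ D.Adj v u) := by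
    intro k hk u v hu hv
    refine ⟨(hsk u v).1 (.inl ⟨k, hk, hu, hv⟩), ?_⟩
    simp only [hr, decide_eq_true_eq, hk, true_and]
    refine ⟨?_, fun h' => ⟨u, v, hu, hv, h'⟩⟩
    rintro ⟨a, b, ha, hb, hab⟩
    rwa [← Fin.ext (ha.symm.trans hu), ← Fin.ext (hb.symm.trans hv)]
  refine ⟨r, fun k hk => by simp [hr, Nat.not_lt.2 hk], ?_⟩
  ext a b
  constructor
  · rintro ⟨k, hk, e1, e2⟩
    obtain ⟨u, v, hu, hv⟩ : ∃ u v : Fin n, t k = u ∧ h k = v :=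
      ⟨⟨_, (H.lt k hk).1⟩, ⟨_, (H.lt k hk).2⟩, rfl, rfl⟩
    obtain ⟨g1, g2⟩ := key k hk u v hu hv
    simp only [dirTail, dirHead, hu, hv] at e1 e2
    split_ifs at e1 e2 with hvu
    · rw [← Fin.ext e1, ← Fin.ext e2]; exact g2.1 hvu
    · rw [← Fin.ext e1, ← Fin.ext e2]; exact g1.resolve_right fun h' => hvu (g2.2 h')
  · intro hab
    have : ∃ k < m, Joins t h k a b := by
      rcases (hsk a b).2 (.inl hab) with ⟨k, hk, e1, e2⟩ | ⟨k, hk, e1, e2⟩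
      · exact ⟨k, hk, .inl ⟨e1, e2⟩⟩
      · exact ⟨k, hk, .inr ⟨e1, e2⟩⟩
    obtain ⟨k, hk, ⟨e1, e2⟩ | ⟨e1, e2⟩⟩ := this
    · have g2 : ¬ r k = true := fun h' => hdag.asymm hab ((key k hk a b e1 e2).2.1 h')
      exact ⟨k, hk, by simp only [dirTail, if_neg g2, e1], by simp only [dirHead, if_neg g2, e2]⟩
    · have g2 : r k = true := (key k hk b a e1 e2).2.2 hab
      exact ⟨k, hk, by simp only [dirTail, if_pos g2, e2], by simp only [dirHead, if_pos g2, e1]⟩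

/-- The reversal of edge `i` is considered in the call for the DAG given by `r`. -/
def Tried (once : Bool) (m : ℕ) (t h : ℕ → ℕ) (r : ℕ → Bool) (i : ℕ) : Prop :=
  (once = true → r i = false) ∧ CoveredAt m (dirTail t h r) (dirHead t h r) i

variable {once : Bool}

theorem IsBase.covered_iff (H : IsBase M m t h) (r : ℕ → Bool) {i : ℕ} (hi : i < m) {u v : Fin n}
    (hu : dirTail t h r i = u) (hv : dirHead t h r i = v) :
    CoveredAt m (dirTail t h r) (dirHead t h r) i ↔ Covered (revGraph n m t h r) u v :=
  coveredAt_iff (fun k hk => by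
    obtain ⟨u, v, hu, -⟩ := H.exists_ends r hk
    rw [hu]; exact u.2) hi hu hv

theorem IsBase.flip_mem (H : IsBase M m t h) {r : ℕ → Bool} {i : ℕ} (hi : i < m)
    (hM : revGraph n m t h r ∈ M) (hc : Tried once m t h r i) :
    revGraph n m t h (flipAt r i) ∈ M := by
  obtain ⟨u, v, hu, hv⟩ := H.exists_ends r hi
  rw [← H.reverseEdge_eq r hi hu hv]
  exact H.mec.reverse_mem hM ((H.covered_iff r hi hu hv).1 hc.2)

/-- An edge still has its initial direction exactly if its flag is false, so the restriction of the
bounded version is a lookup in the flags. -/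
theorem IsBase.candidate_iff (H : IsBase M m t h) (r : ℕ → Bool) (D' : Digraph (Fin n)) :
    Candidate once (arcGraph n m t h) (revGraph n m t h r) D' ↔
      ∃ i < m, Tried once m t h r i ∧ revGraph n m t h (flipAt r i) = D' := by
  have hbase := H.mec.isDAG H.mem
  have hdir : ∀ i < m, ∀ u v : Fin n, dirTail t h r i = u → dirHead t h r i = v →
      ((arcGraph n m t h).Adj u v ↔ r i = false) := by
    intro i hi u v hu hv
    cases hr : r i
    · simp only [dirTail, dirHead, hr] at hu hv
      exact ⟨fun _ => rfl, fun _ => ⟨i, hi, hu, hv⟩⟩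
    · simp only [dirTail, dirHead, hr] at hu hv
      have : (arcGraph n m t h).Adj v u := ⟨i, hi, hv, hu⟩
      simpa using hbase.asymm this
  constructor
  · rintro ⟨x, y, hcov, ho, rfl⟩
    obtain ⟨i, hi, hu, hv⟩ := hcov.1
    refine ⟨i, hi, ⟨fun h' => (hdir i hi x y hu hv).1 (ho h'), ?_⟩, ?_⟩
    · exact (H.covered_iff r hi hu hv).2 hcov
    · exact (H.reverseEdge_eq r hi hu hv).symm
  · rintro ⟨i, hi, ⟨h1, h2⟩, rfl⟩
    obtain ⟨u, v, hu, hv⟩ := H.exists_ends r hi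
    exact ⟨u, v, (H.covered_iff r hi hu hv).1 h2, fun h' => (hdir i hi u v hu hv).2 (h1 h'),
      (H.reverseEdge_eq r hi hu hv).symm⟩

open Classical in
/-- The DAGs over which the loop in the call for `r` ranges from edge `i` on. -/
noncomputable def triedFrom (once : Bool) (n m : ℕ) (t h : ℕ → ℕ) (r : ℕ → Bool) (i : ℕ) :
    List (Digraph (Fin n)) :=
  ((List.range' i (m - i)).filter (fun j => Tried once m t h r j)).map
    fun j => revGraph n m t h (flipAt r j)

theorem triedFrom_of_le {r : ℕ → Bool} {i : ℕ} (hi : m ≤ i) : triedFrom once n m t h r i = [] := by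
  simp [triedFrom, Nat.sub_eq_zero_of_le hi]

theorem triedFrom_of_lt {r : ℕ → Bool} {i : ℕ} (hi : i < m) [Decidable (Tried once m t h r i)] :
    triedFrom once n m t h r i = if Tried once m t h r i then
      revGraph n m t h (flipAt r i) :: triedFrom once n m t h r (i + 1)
      else triedFrom once n m t h r (i + 1) := by
  have : m - i = (m - (i + 1)) + 1 := by omega
  rw [triedFrom, this, List.range'_succ, List.filter_cons]
  split_ifs <;> simp_all [triedFrom]

open Classical in
/-- The order of the loops: by the positions of the edges. -/
noncomputable def edgeOrder (once : Bool) (n m : ℕ) (t h : ℕ → ℕ) (D : Digraph (Fin n)) :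
    List (Digraph (Fin n)) :=
  if hD : ∃ r, Supp m r ∧ revGraph n m t h r = D then triedFrom once n m t h hD.choose 0 else []

theorem IsBase.edgeOrder_eq (H : IsBase M m t h) {r : ℕ → Bool} (hr : Supp m r)
    (hM : revGraph n m t h r ∈ M) :
    edgeOrder once n m t h (revGraph n m t h r) = triedFrom once n m t h r 0 := by
  have hD : ∃ r', Supp m r' ∧ revGraph n m t h r' = revGraph n m t h r := ⟨r, hr, rfl⟩
  rw [edgeOrder, dif_pos hD]
  congr 1
  -- Flags are determined by the graph, so the chosen representative is `r` itself.
  exact (H.revGraph_inj hr hD.choose_spec.1 hM hD.choose_spec.2.symm).symm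

theorem IsBase.isOrder (H : IsBase M m t h) :
    IsOrder once (arcGraph n m t h) M (edgeOrder once n m t h) := by
  intro D hD
  obtain ⟨r, hr, rfl⟩ := H.exists_revGraph hD
  rw [H.edgeOrder_eq hr hD]
  constructor
  · refine List.Nodup.map_on ?_ (List.Nodup.filter _ List.nodup_range')
    intro i hi j hj hij
    simp only [List.mem_filter, List.mem_range'_1, decide_eq_true_eq] at hi hj
    exact flipAt_inj (H.revGraph_inj (hr.flipAt (by omega)) (hr.flipAt (by omega))
      (H.flip_mem (by omega) hD hi.2) hij)
  · intro D'
    rw [H.candidate_iff]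
    simp only [triedFrom, List.mem_map, List.mem_filter, List.mem_range'_1, decide_eq_true_eq]
    constructor
    · rintro ⟨i, ⟨hi, hc⟩, rfl⟩
      exact ⟨i, by omega, hc, rfl⟩
    · rintro ⟨i, hi, hc, rfl⟩
      exact ⟨i, ⟨by omega, hc⟩, rfl⟩

/-- A configuration of the depth-first search: the reversed edges, the current edge, the reversals
on the branch, and the DAGs found so far. -/
structure Config where
  rev : ℕ → Bool
  cur : ℕ
  stack : List ℕ
  found : List (ℕ → Bool)

/-- The steps of the depth-first search. -/
inductive SearchStep (once : Bool) (m : ℕ) (t h : ℕ → ℕ) : Config → Config → Prop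
  | pass {r : ℕ → Bool} {i : ℕ} {stk : List ℕ} {F : List (ℕ → Bool)} : i < m →
      ¬ (Tried once m t h r i ∧ flipAt r i ∉ F) →
      SearchStep once m t h ⟨r, i, stk, F⟩ ⟨r, i + 1, stk, F⟩
  | descend {r : ℕ → Bool} {i : ℕ} {stk : List ℕ} {F : List (ℕ → Bool)} : i < m →
      Tried once m t h r i → flipAt r i ∉ F →
      SearchStep once m t h ⟨r, i, stk, F⟩ ⟨flipAt r i, 0, i :: stk, F ++ [flipAt r i]⟩
  | ascend {r : ℕ → Bool} {e : ℕ} {stk : List ℕ} {F : List (ℕ → Bool)} :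
      SearchStep once m t h ⟨r, m, e :: stk, F⟩ ⟨flipAt r e, e + 1, stk, F⟩

/-- Edges that are not tried are absent from the list of the loop, but the search spends a step on
each. This bridges the gap to the next tried edge or to the end. -/
theorem search_skip {r : ℕ → Bool} {stk : List ℕ} {F : List (ℕ → Bool)} (k : ℕ) : ∀ i, i + k = m →
    (triedFrom once n m t h r i = [] ∧
      Relation.ReflTransGen (SearchStep once m t h) ⟨r, i, stk, F⟩ ⟨r, m, stk, F⟩) ∨
    ∃ j, i ≤ j ∧ j < m ∧ Tried once m t h r j ∧ triedFrom once n m t h r i =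
      revGraph n m t h (flipAt r j) :: triedFrom once n m t h r (j + 1) ∧
      Relation.ReflTransGen (SearchStep once m t h) ⟨r, i, stk, F⟩ ⟨r, j, stk, F⟩ := by
  classical
  induction k with
  | zero =>
    rintro i rfl
    exact .inl ⟨triedFrom_of_le le_rfl, .refl⟩
  | succ k ih =>
    intro i hi
    by_cases hc : Tried once m t h r i
    · refine .inr ⟨i, le_rfl, by omega, hc, ?_, .refl⟩
      rw [triedFrom_of_lt (by omega), if_pos hc]
    · have hstep : SearchStep once m t h ⟨r, i, stk, F⟩ ⟨r, i + 1, stk, F⟩ :=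
        .pass (by omega) fun h' => hc h'.1
      rw [triedFrom_of_lt (by omega), if_neg hc]
      rcases ih (i + 1) (by omega) with ⟨h1, h2⟩ | ⟨j, h1, h2, h3, h4, h5⟩
      · exact .inl ⟨h1, .head hstep h2⟩
      · exact .inr ⟨j, by omega, h2, h3, h4, .head hstep h5⟩

/-- The search carries out the loops of the algorithm. -/
theorem IsBase.search_of_loop (H : IsBase M m t h) {L out : List (Digraph (Fin n))}
    {vis vis' : Set (Digraph (Fin n))} {d : ℕ}
    (hl : Loop (edgeOrder once n m t h) L vis out vis' d) :
    ∀ (r : ℕ → Bool) (i : ℕ) (stk : List ℕ) (F : List (ℕ → Bool)), Supp m r →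
      revGraph n m t h r ∈ M → i ≤ m → L = triedFrom once n m t h r i →
      (∀ r' ∈ F, Supp m r' ∧ revGraph n m t h r' ∈ M) →
      vis = {D | D ∈ F.map (revGraph n m t h)} →
      ∃ F', Relation.ReflTransGen (SearchStep once m t h) ⟨r, i, stk, F⟩ ⟨r, m, stk, F'⟩ ∧
        (∀ r' ∈ F', Supp m r' ∧ revGraph n m t h r' ∈ M) ∧
        F'.map (revGraph n m t h) = F.map (revGraph n m t h) ++ out ∧
        vis' = {D | D ∈ F'.map (revGraph n m t h)} := by
  induction hl with
  | nil vis =>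
    intro r i stk F hr hM hi hL hF hvis
    rcases search_skip (n := n) (m := m) (once := once) (t := t) (h := h) (r := r) (stk := stk) (F := F)
      (m - i) i (by omega) with ⟨-, h2⟩ | ⟨j, -, -, -, h4, -⟩
    · exact ⟨F, h2, hF, by simp, hvis⟩
    · rw [h4] at hL
      cases hL
  | @skip D L out vis vis' d hD _ ih =>
    intro r i stk F hr hM hi hL hF hvis
    rcases search_skip (n := n) (m := m) (once := once) (t := t) (h := h) (r := r) (stk := stk) (F := F)
      (m - i) i (by omega) with ⟨h1, -⟩ | ⟨j, hij, hjm, hc, h4, h5⟩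
    · rw [h1] at hL
      cases hL
    · rw [h4] at hL
      obtain ⟨rfl, rfl⟩ := List.cons.inj hL
      have hin : flipAt r j ∈ F := by
        rw [hvis] at hD
        obtain ⟨r', hr', he⟩ := List.mem_map.1 hD
        rwa [← H.revGraph_inj (hF r' hr').1 (hr.flipAt hjm) (hF r' hr').2 he]
      obtain ⟨F', g1, g2, g3, g4⟩ := ih r (j + 1) stk F hr hM hjm rfl hF hvis
      exact ⟨F', (h5.tail (.pass hjm fun h' => h'.2 hin)).trans g1, g2, g3, g4⟩
  | @call D L out₁ out₂ vis vis₁ vis₂ d₁ d₂ hD _ _ ih₁ ih₂ =>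
    intro r i stk F hr hM hi hL hF hvis
    rcases search_skip (n := n) (m := m) (once := once) (t := t) (h := h) (r := r) (stk := stk) (F := F)
      (m - i) i (by omega) with ⟨h1, -⟩ | ⟨j, hij, hjm, hc, h4, h5⟩
    · rw [h1] at hL
      cases hL
    · rw [h4] at hL
      obtain ⟨rfl, rfl⟩ := List.cons.inj hL
      have hnin : flipAt r j ∉ F := by
        intro hin
        rw [hvis] at hD
        exact hD (List.mem_map_of_mem hin)
      have hfM := H.flip_mem hjm hM hc
      have hfS := hr.flipAt hjm
      obtain ⟨F₁, g1, g2, g3, g4⟩ := ih₁ (flipAt r j) 0 (j :: stk) (F ++ [flipAt r j]) hfS hfM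
        (Nat.zero_le _) (H.edgeOrder_eq hfS hfM) (by
          intro r' hr'
          rcases List.mem_append.1 hr' with h' | h'
          · exact hF r' h'
          · rw [List.mem_singleton.1 h']
            exact ⟨hfS, hfM⟩) (by
          rw [hvis]
          ext E
          simp only [List.map_append, List.mem_append, List.map_cons, List.map_nil,
            List.mem_singleton, Set.mem_insert_iff, Set.mem_ofPred_eq]
          tauto)
      obtain ⟨F', k1, k2, k3, k4⟩ := ih₂ r (j + 1) stk F₁ hr hM hjm rfl g2 g4
      refine ⟨F', ?_, k2, ?_, k4⟩
      -- The stack stores only the edge: flipping it once more restores the DAG of the caller.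
      · have hasc : SearchStep once m t h ⟨flipAt r j, m, j :: stk, F₁⟩ ⟨r, j + 1, stk, F₁⟩ := by
          have := SearchStep.ascend (once := once) (m := m) (t := t) (h := h) (r := flipAt r j)
            (e := j) (stk := stk) (F := F₁)
          rwa [flipAt_flipAt] at this
        exact ((h5.tail (.descend hjm hc hnin)).trans (g1.tail hasc)).trans k1
      · rw [k3, g3]
        simp

end DepthFirst

/-! ### The machine simulates one step of the search at a time -/

section Implementation

open Code

/-- Raise the flag if the reversal of the current edge is not to be considered. -/
def testEdge (once : Bool) : Code :=
  .const rFlag 0 ;;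
  (if once = true then .load rQ aRev rCur ;; .ite (.eq rQ rOne) (.const rFlag 1) .skip else .skip) ;;
  checkCovered

def tryEdge (once : Bool) : Code :=
  testEdge once ;; .ite (.eq rFlag rZero)
    (flipEdge ;; trieInsert ;; .ite (.eq rNew rOne)
      (.store aStack rDepth rCur ;; .inc rDepth ;; enqueue ;; .const rCur 0)
      (flipEdge ;; .inc rCur))
    (.inc rCur)

/-- Return from a call. -/
def ascend : Code := .dec rDepth ;; .load rCur aStack rDepth ;; flipEdge ;; .inc rCur

/-- One step of the depth-first search. -/
def step (once : Bool) : Code :=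
  .inc rCount ;;
  .ite (.lt rCur rM) (tryEdge once) (.ite (.lt rZero rDepth) ascend (.const rRun 0))

/-- The memory `μ` represents the state of the search: the reversed edges `r`, the current edge `i`
and the reversals on the branch. -/
structure Represents (m : ℕ) (t h : ℕ → ℕ) (r : ℕ → Bool) (i : ℕ) (stk : List ℕ) (μ : Mem) :
    Prop where
  edges : μ.reg rM = m
  zero : μ.reg rZero = 0
  one : μ.reg rOne = 1
  cur : μ.reg rCur = i
  depth : μ.reg rDepth = stk.length
  stack : (List.range stk.length).map (μ.arr aStack) = stk.reverse
  tail : μ.arr aTail = dirTail t h r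
  head : μ.arr aHead = dirHead t h r
  flag : ∀ k, μ.arr aRev k = (r k).toNat
  stamp : ∀ v, μ.arr aMark v ≤ μ.reg rStamp

def foundKeys (m : ℕ) (F : List (ℕ → Bool)) : Set (List Bool) :=
  {l | ∃ r ∈ F, l <+: keyOf r m}

/-- The trie in the memory `μ` holds the list `F`. -/
def TrieHolds (m : ℕ) (F : List (ℕ → Bool)) (μ : Mem) : Prop :=
  ∃ f, TrieAt (μ.arr aTrie) (μ.reg rFresh) (foundKeys m F) f

/-- The arcs of the DAG in which the edges in `r` are reversed, written out. -/
def revWord (m : ℕ) (t h : ℕ → ℕ) (r : ℕ → Bool) : List ℕ :=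
  arcWord m (dirTail t h r) (dirHead t h r)

/-- The queue in the memory `μ` holds the list `F`. -/
def QueueHolds (m : ℕ) (t h : ℕ → ℕ) (F : List (ℕ → Bool)) (μ : Mem) : Prop :=
  (List.range (μ.reg rWrite)).map (μ.arr aQueue) = F.flatMap (revWord m t h)

variable {m : ℕ} {t h : ℕ → ℕ} {r : ℕ → Bool} {i : ℕ} {stk : List ℕ} {F : List (ℕ → Bool)}
  {μ ν : Mem} {once : Bool}

theorem TrieHolds.agree (H : TrieHolds m F μ) {P : Code} (hA : Agree P μ ν)
    (hr : rFresh ∉ P.writes) (ha : aTrie ∉ P.stores) : TrieHolds m F ν := by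
  rw [TrieHolds, hA.reg _ hr, hA.arr _ ha]
  exact H

theorem QueueHolds.agree (H : QueueHolds m t h F μ) {P : Code} (hA : Agree P μ ν)
    (hr : rWrite ∉ P.writes) (ha : aQueue ∉ P.stores) : QueueHolds m t h F ν := by
  rw [QueueHolds, hA.reg _ hr, hA.arr _ ha]
  exact H

theorem Represents.agree (H : Represents m t h r i stk μ) {P : Code} (hA : Agree P μ ν)
    (hr : ∀ x ∈ [rM, rZero, rOne, rCur, rDepth], x ∉ P.writes)
    (ha : ∀ a ∈ [aStack, aTail, aHead, aRev], a ∉ P.stores)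
    (hs : ∀ v, ν.arr aMark v ≤ ν.reg rStamp) : Represents m t h r i stk ν := by
  simp only [List.forall_mem_cons] at hr ha
  obtain ⟨r1, r2, r3, r4, r5, -⟩ := hr
  obtain ⟨a1, a2, a3, a4, -⟩ := ha
  refine ⟨?_, ?_, ?_, ?_, ?_, ?_, ?_, ?_, ?_, hs⟩
  · rw [hA.reg _ r1, H.edges]
  · rw [hA.reg _ r2, H.zero]
  · rw [hA.reg _ r3, H.one]
  · rw [hA.reg _ r4, H.cur]
  · rw [hA.reg _ r5, H.depth]
  · rw [hA.arr _ a1, H.stack]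
  · rw [hA.arr _ a2, H.tail]
  · rw [hA.arr _ a3, H.head]
  · rw [hA.arr _ a4]; exact H.flag

theorem Represents.agree_of_stamp (H : Represents m t h r i stk μ) {P : Code} (hA : Agree P μ ν)
    (hr : ∀ x ∈ [rM, rZero, rOne, rCur, rDepth, rStamp], x ∉ P.writes)
    (ha : ∀ a ∈ [aStack, aTail, aHead, aRev, aMark], a ∉ P.stores) :
    Represents m t h r i stk ν := by
  refine H.agree hA (fun x hx => hr x (by simp at hx ⊢; tauto))
    (fun x hx => ha x (by simp at hx ⊢; tauto)) ?_
  rw [hA.arr _ (ha _ (by simp)), hA.reg _ (hr _ (by simp))]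
  exact H.stamp

theorem run_testEdge (H : Represents m t h r i stk μ) :
    Represents m t h r i stk ((testEdge once).run μ) ∧
      (((testEdge once).run μ).reg rFlag = 0 ↔ Tried once m t h r i) := by
  have key : ∀ P : Code, (∀ x ∈ P.writes, x = rFlag ∨ x = rQ) → P.stores = [] →
      ((P.run μ).reg rFlag = 0 ↔ (once = true → r i = false)) →
      Represents m t h r i stk (checkCovered.run (P.run μ)) ∧
      ((checkCovered.run (P.run μ)).reg rFlag = 0 ↔ Tried once m t h r i) := by
    intro P hw hs hf
    have hP : Represents m t h r i stk (P.run μ) := by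
      refine H.agree_of_stamp (agree_run P μ) ?_ (by simp [hs])
      intro x hx hxP
      rcases hw x hxP with rfl | rfl <;> simp at hx
    obtain ⟨h1, h2⟩ := run_checkCovered (P.run μ) hP.stamp
    refine ⟨hP.agree (agree_run _ _) (by decide) (by decide) h1, ?_⟩
    rw [h2, hf, hP.edges, hP.tail, hP.head, hP.cur, Tried]
  cases once
  · exact key (.const rFlag 0 ;; .skip) (by simp [writes]) rfl (by simp [run])
  · refine key (.const rFlag 0 ;; .load rQ aRev rCur ;; .ite (.eq rQ rOne) (.const rFlag 1) .skip)
      (by simp [writes]) rfl ?_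
    simp [run, Test.On, H.flag, H.cur, H.one, Mem.ite_reg]

theorem dirTail_flipAt : dirTail t h (flipAt r i) = Function.update (dirTail t h r) i
    (dirHead t h r i) := by
  funext k
  by_cases hk : k = i
  · subst hk
    cases hr : r k <;> simp [dirTail, dirHead, flipAt, hr]
  · simp [dirTail, flipAt, Function.update_of_ne hk]

theorem dirHead_flipAt : dirHead t h (flipAt r i) = Function.update (dirHead t h r) i
    (dirTail t h r i) := by
  funext k
  by_cases hk : k = i
  · subst hk
    cases hr : r k <;> simp [dirTail, dirHead, flipAt, hr]
  · simp [dirHead, flipAt, Function.update_of_ne hk]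

theorem run_flipEdge_represents (H : Represents m t h r i stk μ) :
    Represents m t h (flipAt r i) i stk (flipEdge.run μ) := by
  have hA := agree_run flipEdge μ
  obtain ⟨h1, h2, h3⟩ := run_flipEdge μ H.zero H.one
  refine ⟨?_, ?_, ?_, ?_, ?_, ?_, ?_, ?_, ?_, ?_⟩
  · rw [hA.reg _ (by decide), H.edges]
  · rw [hA.reg _ (by decide), H.zero]
  · rw [hA.reg _ (by decide), H.one]
  · rw [hA.reg _ (by decide), H.cur]
  · rw [hA.reg _ (by decide), H.depth]
  · rw [hA.arr _ (by decide), H.stack]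
  · rw [h1, dirTail_flipAt, H.tail, H.head, H.cur]
  · rw [h2, dirHead_flipAt, H.tail, H.head, H.cur]
  · intro k
    rw [h3, H.cur, H.flag, flipAt, Function.update_apply, Function.update_apply]
    split_ifs with hk h0 <;> cases hr : r i <;> simp_all [H.flag]
  · rw [hA.reg _ (by decide), hA.arr _ (by decide)]
    exact H.stamp

theorem Represents.setCur (H : Represents m t h r i stk μ) (j : ℕ) :
    Represents m t h r j stk (μ.setReg rCur j) := by
  refine ⟨?_, ?_, ?_, ?_, ?_, H.stack, H.tail, H.head, H.flag, ?_⟩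
  · simpa using H.edges
  · simpa using H.zero
  · simpa using H.one
  · simp
  · simpa using H.depth
  · simpa using H.stamp

theorem foundKeys_append (F : List (ℕ → Bool)) (r : ℕ → Bool) :
    foundKeys m (F ++ [r]) = foundKeys m F ∪ {l | l <+: keyOf r m} := by
  ext l
  simp [foundKeys, or_and_right, exists_or]

/-- The nodes of the trie are prefixes of keys, but all full keys have the same length, so a full
key is a node only if it was inserted. -/
theorem keyOf_mem_foundKeys (hF : ∀ r ∈ F, Supp m r) (hr : Supp m r) :
    keyOf r m ∈ foundKeys m F ↔ r ∈ F := by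
  constructor
  · rintro ⟨r', hr', hp⟩
    have he := hp.eq_of_length (by rw [length_keyOf, length_keyOf])
    have : r = r' := by
      funext k
      by_cases hk : k < m
      · exact List.map_inj_left.1 he k (List.mem_range.2 hk)
      · rw [hr k (by omega), hF r' hr' k (by omega)]
    exact this ▸ hr'
  · exact fun h => ⟨r, h, List.prefix_rfl⟩

theorem foundKeys_append_of_mem (h : r ∈ F) : foundKeys m (F ++ [r]) = foundKeys m F := by
  rw [foundKeys_append]
  exact Set.union_eq_self_of_subset_right fun l hl => ⟨r, h, hl⟩

theorem run_trieInsert_holds (H : Represents m t h r i stk μ) (hT : TrieHolds m F μ)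
    (hF : ∀ r ∈ F, Supp m r) (hr : Supp m r) :
    TrieHolds m (F ++ [r]) (trieInsert.run μ) ∧
      ((trieInsert.run μ).reg rNew = 1 ↔ r ∉ F) := by
  obtain ⟨h1, h2⟩ := run_trieInsert μ H.zero H.one H.flag hT
  rw [H.edges, ← foundKeys_append] at h1
  rw [H.edges, keyOf_mem_foundKeys hF hr] at h2
  refine ⟨h1, ?_⟩
  rcases h2 with ⟨h2, h3⟩ | ⟨h2, h3⟩ <;> simp [h2, h3]

theorem run_enqueue_holds (H : Represents m t h r i stk μ) (hQ : QueueHolds m t h F μ) :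
    QueueHolds m t h (F ++ [r]) (enqueue.run μ) := by
  rw [QueueHolds, run_enqueue, hQ, H.edges, H.tail, H.head, List.flatMap_append]
  simp [revWord]

/-- What the memory holds in a configuration of the search. -/
structure Holds (m : ℕ) (t h : ℕ → ℕ) (c : Config) (μ : Mem) : Prop where
  rep : Represents m t h c.rev c.cur c.stack μ
  trie : TrieHolds m c.found μ
  queue : QueueHolds m t h c.found μ
  supp : Supp m c.rev
  supp_found : ∀ r ∈ c.found, Supp m r
  cur_le : c.cur ≤ m
  stack_lt : ∀ e ∈ c.stack, e < m

theorem Holds.agree {c : Config} (H : Holds m t h c μ) {P : Code} (hA : Agree P μ ν)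
    (hr : ∀ x ∈ [rM, rZero, rOne, rCur, rDepth, rStamp, rFresh, rWrite], x ∉ P.writes)
    (ha : ∀ a ∈ [aStack, aTail, aHead, aRev, aMark, aTrie, aQueue], a ∉ P.stores) :
    Holds m t h c ν :=
  ⟨H.rep.agree_of_stamp hA (fun x hx => hr x (by simp at hx ⊢; tauto))
    (fun x hx => ha x (by simp at hx ⊢; tauto)),
    H.trie.agree hA (hr _ (by simp)) (ha _ (by simp)),
    H.queue.agree hA (hr _ (by simp)) (ha _ (by simp)),
    H.supp, H.supp_found, H.cur_le, H.stack_lt⟩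

/-- A tried edge is flipped before its novelty is known: the flags in place form the key for the
trie, and if the key was old the flip is undone. -/
theorem Holds.run_step {c c' : Config} (hstep : SearchStep once m t h c c')
    (H : Holds m t h c μ) : Holds m t h c' ((step once).run μ) := by
  replace H : Holds m t h c ((Code.inc rCount).run μ) :=
    H.agree (agree_run (.inc rCount) μ) (by decide) (by decide)
  have hrun : (step once).run μ = (Code.ite (.lt rCur rM) (tryEdge once)
    (.ite (.lt rZero rDepth) ascend (.const rRun 0))).run ((Code.inc rCount).run μ) := rfl
  rw [hrun]
  clear hrun
  generalize (Code.inc rCount).run μ = μ at H ⊢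
  have htest : ∀ {r i stk F}, Holds m t h ⟨r, i, stk, F⟩ μ →
      Holds m t h ⟨r, i, stk, F⟩ ((testEdge once).run μ) := by
    intro r i stk F H
    have hA := agree_run (testEdge once) μ
    exact ⟨(run_testEdge H.rep).1,
      H.trie.agree hA (by cases once <;> decide) (by cases once <;> decide),
      H.queue.agree hA (by cases once <;> decide) (by cases once <;> decide),
      H.supp, H.supp_found, H.cur_le, H.stack_lt⟩
  have hflip : ∀ {r i stk F ν}, i < m → Holds m t h ⟨r, i, stk, F⟩ ν →
      Holds m t h ⟨flipAt r i, i, stk, F⟩ (flipEdge.run ν) := by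
    intro r i stk F ν hi H
    have hA := agree_run flipEdge ν
    exact ⟨run_flipEdge_represents H.rep, H.trie.agree hA (by decide) (by decide),
      H.queue.agree hA (by decide) (by decide), H.supp.flipAt hi, H.supp_found, H.cur_le,
      H.stack_lt⟩
  have hinc : ∀ {r i stk F ν}, i < m → Holds m t h ⟨r, i, stk, F⟩ ν →
      Holds m t h ⟨r, i + 1, stk, F⟩ ((Code.inc rCur).run ν) := by
    intro r i stk F ν hi H
    have hA := agree_run (.inc rCur) ν
    refine ⟨?_, H.trie.agree hA (by decide) (by decide), H.queue.agree hA (by decide) (by decide),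
      H.supp, H.supp_found, hi, H.stack_lt⟩
    have := H.rep.setCur (ν.reg rCur + 1)
    rw [H.rep.cur] at this
    simpa only [run, H.rep.cur] using this
  cases hstep with
  | @pass r i stk F hi hn =>
    have hlt : (Test.lt rCur rM).On μ := by
      simp only [Test.On, H.rep.cur, H.rep.edges]
      exact hi
    have H1 := htest H
    have h1 := (run_testEdge (once := once) H.rep).2
    rw [run, if_pos hlt]
    have hrun : (tryEdge once).run μ = (Code.ite (.eq rFlag rZero)
      (flipEdge ;; trieInsert ;; .ite (.eq rNew rOne)
        (.store aStack rDepth rCur ;; .inc rDepth ;; enqueue ;; .const rCur 0)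
        (flipEdge ;; .inc rCur)) (.inc rCur)).run ((testEdge once).run μ) := rfl
    rw [hrun]
    clear hrun
    generalize (testEdge once).run μ = μ₁ at H1 h1 ⊢
    by_cases hf : (Test.eq rFlag rZero).On μ₁
    · have H2 := hflip hi H1
      obtain ⟨h2, h3⟩ := run_trieInsert_holds H2.rep H2.trie H2.supp_found H2.supp
      have hA := agree_run trieInsert (flipEdge.run μ₁)
      have H3 := H2.rep.agree_of_stamp hA (by decide) (by decide)
      have hin : flipAt r i ∈ F := by
        by_contra hin
        refine hn ⟨h1.1 (hf.trans H1.rep.zero), hin⟩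
      have hnew : ¬ (Test.eq rNew rOne).On (trieInsert.run (flipEdge.run μ₁)) := fun e =>
        h3.1 (e.trans H3.one) hin
      -- Inserting a known key leaves the set of nodes unchanged.
      rw [TrieHolds, foundKeys_append_of_mem hin] at h2
      rw [run, if_pos hf, run, run, run, if_neg hnew]
      have H4 := hinc hi (hflip hi (ν := trieInsert.run (flipEdge.run μ₁)) ⟨H3, h2,
        H2.queue.agree hA (by decide) (by decide), H2.supp, H2.supp_found, H2.cur_le, H2.stack_lt⟩)
      rwa [flipAt_flipAt] at H4
    · rw [run, if_neg hf]
      exact hinc hi H1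
  | @descend r i stk F hi ht hnF =>
    have hlt : (Test.lt rCur rM).On μ := by
      simp only [Test.On, H.rep.cur, H.rep.edges]
      exact hi
    have H1 := htest H
    have h1 := (run_testEdge (once := once) H.rep).2.2 ht
    have H2 := hflip hi H1
    obtain ⟨h2, h3⟩ := run_trieInsert_holds H2.rep H2.trie H2.supp_found H2.supp
    have hA := agree_run trieInsert (flipEdge.run ((testEdge once).run μ))
    have H3 := H2.rep.agree_of_stamp hA (by decide) (by decide)
    have h4 := h3.2 hnF
    have h5 := H2.queue.agree hA (by decide) (by decide)
    rw [run, if_pos hlt]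
    simp only [run, if_true, tryEdge, Test.On, H1.rep.zero, h1, H3.one, h4]
    generalize trieInsert.run (flipEdge.run ((testEdge once).run μ)) = μ₂ at H3 h2 h5 ⊢
    have H6 : Represents m t h (flipAt r i) i (i :: stk)
        ((μ₂.setArr aStack (μ₂.reg rDepth) (μ₂.reg rCur)).setReg rDepth (μ₂.reg rDepth + 1)) := by
      refine ⟨?_, ?_, ?_, ?_, ?_, ?_, ?_, ?_, ?_, ?_⟩
      · simpa using H3.edges
      · simpa using H3.zero
      · simpa using H3.one
      · simpa using H3.cur
      · simpa using H3.depth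
      · simp [H3.depth, H3.cur, map_range_update, H3.stack]
      · simpa using H3.tail
      · simpa using H3.head
      · simpa using H3.flag
      · simpa using H3.stamp
    have h7 : TrieHolds m (F ++ [flipAt r i])
        ((μ₂.setArr aStack (μ₂.reg rDepth) (μ₂.reg rCur)).setReg rDepth (μ₂.reg rDepth + 1)) := by
      simpa [TrieHolds] using h2
    have h8 : QueueHolds m t h F
        ((μ₂.setArr aStack (μ₂.reg rDepth) (μ₂.reg rCur)).setReg rDepth (μ₂.reg rDepth + 1)) := by
      simpa [QueueHolds] using h5
    simp only [Mem.setArr_reg]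
    generalize (μ₂.setArr aStack (μ₂.reg rDepth) (μ₂.reg rCur)).setReg rDepth
      (μ₂.reg rDepth + 1) = μ₃ at H6 h7 h8 ⊢
    have hB := agree_run enqueue μ₃
    have h9 := run_enqueue_holds H6 h8
    refine ⟨(H6.agree_of_stamp hB (by decide) (by decide)).setCur 0,
      (h7.agree hB (by decide) (by decide)).agree (agree_run (.const rCur 0) _)
        (by decide) (by decide),
      h9.agree (agree_run (.const rCur 0) _) (by decide) (by decide), H2.supp, ?_, Nat.zero_le _,
      ?_⟩
    · intro r' hr'
      rcases List.mem_append.1 hr' with h' | h'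
      · exact H.supp_found r' h'
      · rw [List.mem_singleton.1 h']
        exact H2.supp
    · exact List.forall_mem_cons.2 ⟨hi, H.stack_lt⟩
  | @ascend r e stk F =>
    have hge : ¬ (Test.lt rCur rM).On μ := by
      simp only [Test.On, H.rep.cur, H.rep.edges]
      exact lt_irrefl m
    have hpos : (Test.lt rZero rDepth).On μ := by
      simp [Test.On, H.rep.zero, H.rep.depth]
    obtain ⟨he, hstk⟩ := List.forall_mem_cons.1 H.stack_lt
    have hst := H.rep.stack
    simp only [List.length_cons, List.range_succ, List.map_append, List.map_cons, List.map_nil,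
      List.reverse_cons] at hst
    obtain ⟨s1, s2⟩ := List.append_inj' hst rfl
    simp only [List.cons.injEq, and_true] at s2
    have hd := H.rep.depth
    simp only [List.length_cons] at hd
    simp only [run, hge, hpos, if_true, if_false, ascend]
    refine hinc he (hflip he ?_)
    have hA := agree_run (.dec rDepth ;; .load rCur aStack rDepth : Code) μ
    refine ⟨⟨?_, ?_, ?_, ?_, ?_, ?_, ?_, ?_, ?_, ?_⟩,
      H.trie.agree hA (by decide) (by decide), H.queue.agree hA (by decide) (by decide),
      H.supp, H.supp_found, he.le, hstk⟩
    · simpa using H.rep.edges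
    · simpa using H.rep.zero
    · simpa using H.rep.one
    · simp [hd, s2]
    · simp [hd]
    · simpa using s1
    · simpa using H.rep.tail
    · simpa using H.rep.head
    · simpa using H.rep.flag
    · simpa using H.rep.stamp

theorem Holds.run_last (H : Holds m t h ⟨r, m, [], F⟩ μ) :
    Holds m t h ⟨r, m, [], F⟩ ((step once).run μ) ∧ ((step once).run μ).reg rRun = 0 := by
  have h1 := H.rep.cur
  have h2 := H.rep.edges
  have h3 := H.rep.depth
  have h4 := H.rep.zero
  simp at h1 h2 h3 h4
  have hrun : (step once).run μ = (.inc rCount ;; .const rRun 0 : Code).run μ := by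
    simp [step, run, Test.On, h1, h2, h3, h4]
  rw [hrun]
  exact ⟨H.agree (agree_run _ _) (by decide) (by decide), by simp [run]⟩

theorem run_step_count : ((step once).run μ).reg rCount = μ.reg rCount + 1 ∧
    ((step once).run μ).reg rRead = μ.reg rRead ∧ ((step once).run μ).buf = μ.buf := by
  have hA := agree_run (step once) μ
  refine ⟨?_, hA.reg _ (by cases once <;> decide), hA.buf (by cases once <;> decide)⟩
  have hrun : (step once).run μ = (Code.ite (.lt rCur rM) (tryEdge once)
    (.ite (.lt rZero rDepth) ascend (.const rRun 0))).run ((Code.inc rCount).run μ) := rfl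
  rw [hrun, (agree_run _ _).reg _ (by cases once <;> decide)]
  simp [run]

theorem run_step_run (h : (Test.lt rCur rM).On μ ∨ (Test.lt rZero rDepth).On μ) :
    ((step once).run μ).reg rRun = μ.reg rRun := by
  have h' : (Test.lt rCur rM).On ((Code.inc rCount).run μ) ∨
      (Test.lt rZero rDepth).On ((Code.inc rCount).run μ) := by
    simpa [Test.On, run] using h
  have hrun : (step once).run μ = (Code.ite (.lt rCur rM) (tryEdge once)
    (.ite (.lt rZero rDepth) ascend (.const rRun 0))).run ((Code.inc rCount).run μ) := rfl
  have h1 : ((Code.inc rCount).run μ).reg rRun = μ.reg rRun := by simp [run]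
  rw [hrun, ← h1]
  clear hrun h1
  generalize (Code.inc rCount).run μ = ν at h' ⊢
  rw [run]
  split_ifs with h2
  · rw [(agree_run _ _).reg _ (by cases once <;> decide)]
  · rw [run, if_pos (h'.resolve_left h2), (agree_run _ _).reg _ (by decide)]

end Implementation

/-! ### Amortisation: releasing the queue at a steady rate -/

section Pacing

open Code

/-- Once every `m + 1` steps of the search, write out the next DAG of the queue. -/
def release : Prog :=
  .cond (.lt rM rCount)
    (.seq emitWord.toProg (.seq (.instr .finish) (.instr (.const rCount 0)))) (.instr .skip)

/-- The number of steps that the search makes before the next output beyond those it has found. -/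
def Config.left (m : ℕ) (c : Config) : ℕ := (m - c.cur + 1) + (c.stack.map fun e => m - e).sum

/-- The outputs so far are a prefix of `F` with delay at most `B`, in pace with the counter, where
`L` steps are left and the clock has `x` steps to spare. -/
def Paced (m : ℕ) (t h : ℕ → ℕ) (B T K : ℕ) (F : List (ℕ → Bool)) (L x : ℕ) (s : State) : Prop :=
  ∃ rel last, s.reg rRead = 2 * m * rel ∧ rel * (m + 1) + s.reg rCount + L = (m + 1) * F.length ∧
    s.outs.map Prod.snd = (F.take rel).map (revWord m t h) ∧ s.buf = [] ∧
    (∀ τ ≤ last + B, (0 :: (s.outs.map Prod.fst ++ [τ])).IsChain fun a b => b ≤ a + B) ∧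
    s.time + x ≤ last + T + s.reg rCount * K

/-- All words have the same length k, so the word with index j starts at position k · j and no
separators are needed. -/
theorem map_range_eq_of_flatMap {α : Type*} {w : α → List ℕ} {k : ℕ} (hw : ∀ a, (w a).length = k)
    {F : List α} {q : ℕ → ℕ} {W : ℕ} (he : (List.range W).map q = F.flatMap w) {j : ℕ}
    (hj : j < F.length) : (List.range k).map (fun i => q (k * j + i)) = w F[j] := by
  have hlen : ((F.take j).flatMap w).length = k * j := by
    rw [List.length_flatMap, List.map_congr_left (g := fun _ => k) (fun a _ => hw a)]
    simp [hj.le, mul_comm]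
  have hsplit : F.flatMap w = (F.take j).flatMap w ++ (w F[j] ++ (F.drop (j + 1)).flatMap w) := by
    rw [← List.flatMap_cons, ← List.drop_eq_getElem_cons hj, ← List.flatMap_append,
      List.take_append_drop]
  refine List.ext_getElem (by simp [hw]) fun i hi hi' => ?_
  have h1 : (F.flatMap w)[k * j + i]? = some (w F[j])[i] := by
    rw [hsplit, List.getElem?_append_right (by omega), hlen, Nat.add_sub_cancel_left,
      List.getElem?_append_left hi', List.getElem?_eq_getElem hi']
  rw [← he, List.getElem?_map] at h1
  obtain ⟨a, ha, h2⟩ := Option.map_eq_some_iff.1 h1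
  obtain ⟨hlt, h3⟩ := List.getElem?_eq_some_iff.1 ha
  simp only [List.getElem_range] at h3
  simp [h3, h2]

variable {m B T K L : ℕ} {t h : ℕ → ℕ} {F : List (ℕ → Bool)}

/-- The step identity in `Paced` guarantees that the queue holds an unreleased word when the counter
overflows. The 3 in the spare time stands for the test, the `finish` and the reset of the counter.
-/
theorem exec_release {s : State} (hm : s.reg rM = m) (hQ : QueueHolds m t h F s.mem)
    (hP : Paced m t h B T K F L (emitWord.cost m + 3) s) (hc : s.reg rCount ≤ m + 1)
    (hT : 1 ≤ T) (hB : T + (m + 1) * K ≤ B) :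
    ∃ s', Exec release s s' ∧ Paced m t h B T K F L 0 s' ∧ s'.reg rCount ≤ m ∧
      Agree (emitWord ;; .const rCount 0) s.mem s'.mem := by
  obtain ⟨rel, last, h1, h2, h3, h4, h5, h6⟩ := hP
  by_cases hlt : m < s.reg rCount
  · have hcm : s.reg rCount = m + 1 := by omega
    have hrel : rel < F.length := by
      rw [hcm] at h2
      by_contra hge
      have := Nat.mul_le_mul_left (m + 1) (not_lt.1 hge)
      rw [mul_comm rel] at h2
      omega
    obtain ⟨s₁, e1, e2, e3, e4⟩ := exec_toProg emitWord (by decide) s.tick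
    obtain ⟨g1, g2⟩ := run_emitWord s.tick.mem
    have hA := agree_run emitWord s.tick.mem
    rw [← e2] at g1 g2 hA
    change s₁.reg rRead = s.reg rRead + 2 * s.reg rM at g1
    change s₁.buf = s.buf ++ (List.range (2 * s.reg rM)).map
      (fun j => s.mem.arr aQueue (s.reg rRead + j)) at g2
    rw [h1, hm] at g1 g2
    rw [h4, List.nil_append, map_range_eq_of_flatMap (fun r => length_arcWord m _ _) hQ hrel] at g2
    change s₁.outs = s.outs at e3
    change s₁.time ≤ s.time + 1 + emitWord.cost (s.reg rM) at e4
    rw [hm] at e4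
    have e5 : s₁.time + 1 ≤ last + B := by
      rw [hcm] at h6
      omega
    refine ⟨Instr.exec (Instr.exec s₁ .finish) (.const rCount 0), .cond_true ?_
      (.seq e1 (.seq (.instr _ _) (.instr _ _))), ⟨rel + 1, s₁.time + 1, ?_, ?_, ?_, ?_, ?_, ?_⟩,
      ?_, ?_, ?_, ?_⟩
    · simpa [Test.Holds, hm] using hlt
    · simp only [Instr.exec, State.setReg, State.tick,
        Function.update_of_ne (show rRead ≠ rCount by decide)]
      rw [g1]
      ring
    · simp only [Instr.exec, State.setReg, State.tick, Function.update_self]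
      rw [← h2, hcm]
      ring
    · simp only [Instr.exec, State.setReg, State.tick, e3, List.map_append, h3, g2,
        List.take_add_one, List.getElem?_eq_getElem hrel]
      rfl
    · rfl
    · intro τ hτ
      simp only [Instr.exec, State.setReg, State.tick, e3, List.map_append, List.map_cons,
        List.map_nil, List.append_assoc, List.cons_append, List.nil_append]
      have := h5 (s₁.time + 1) e5
      rw [← List.cons_append] at this ⊢
      rw [List.isChain_split]
      exact ⟨this, by simpa using hτ⟩
    -- The counter is reset one step after the output is completed; this step is paid by T ≥ 1.
    · simp only [Instr.exec, State.setReg, State.tick, Function.update_self]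
      omega
    · simp [Instr.exec, State.setReg, State.tick]
    · intro x hx
      have hx1 : x ∉ emitWord.writes := fun h' => hx (by simp [writes, h'])
      have hx2 : x ≠ rCount := fun h' => hx (by simp [writes, h'])
      rw [← show s.tick.mem = s.mem from rfl, ← hA.reg x hx1]
      simp only [Instr.exec, State.setReg, State.tick, State.mem, Function.update_of_ne hx2]
    · intro a ha
      exact hA.arr a fun h' => ha (by simp [stores, h'])
    · intro h'
      exact absurd h' (by decide)
  · refine ⟨_, .cond_false ?_ (.instr _ _), ⟨rel, last, h1, h2, h3, h4, h5, ?_⟩, ?_, ?_⟩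
    · simpa [Test.Holds, hm] using hlt
    · simp only [Instr.exec, State.tick]
      omega
    · simpa [Instr.exec, State.tick] using hlt
    · exact ⟨fun _ _ => rfl, fun _ _ => rfl, fun _ => rfl⟩

/-- The body of the main loop. -/
def body (once : Bool) : Prog := .seq (step once).toProg release

/-- The time allotted to one round of the main loop. -/
def roundCost (once : Bool) (m : ℕ) : ℕ := (step once).cost m + emitWord.cost m + 4

variable {once : Bool}

/-- The last hypothesis is the balance of the potential: a step uses up one unit, and every newly
found DAG brings m + 1. -/
theorem exec_body {s : State} {L' : ℕ} {F' : List (ℕ → Bool)} (hm : s.reg rM = m)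
    (hQ : QueueHolds m t h F' ((step once).run s.mem))
    (hP : Paced m t h B T (roundCost once m) F L 0 s) (hc : s.reg rCount ≤ m)
    (hT : 1 ≤ T) (hB : T + (m + 1) * roundCost once m ≤ B) (hF : F <+: F')
    (hL : L' + (m + 1) * F.length + 1 = L + (m + 1) * F'.length) :
    ∃ s', Exec (body once) s.tick s' ∧ Paced m t h B T (roundCost once m) F' L' 0 s' ∧
      s'.reg rCount ≤ m ∧ Agree (emitWord ;; .const rCount 0) ((step once).run s.mem) s'.mem := by
  obtain ⟨rel, last, h1, h2, h3, h4, h5, h6⟩ := hP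
  obtain ⟨s₁, e1, e2, e3, e4⟩ := exec_toProg (step once) (by cases once <;> decide) s.tick
  obtain ⟨c1, c2, c3⟩ := run_step_count (once := once) (μ := s.mem)
  change s₁.mem = (step once).run s.mem at e2
  rw [← e2] at c1 c2 c3 hQ ⊢
  change s₁.reg rCount = s.reg rCount + 1 at c1
  change s₁.reg rRead = s.reg rRead at c2
  change s₁.buf = s.buf at c3
  change s₁.outs = s.outs at e3
  change s₁.time ≤ s.time + 1 + (step once).cost (s.reg rM) at e4
  have hm1 : s₁.reg rM = m := by
    rw [← hm]
    have := (agree_run (step once) s.mem).reg rM (by cases once <;> decide)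
    rw [← e2] at this
    exact this
  have hrel : rel ≤ F.length := by
    by_contra hlt
    have := Nat.mul_lt_mul_of_pos_left (not_le.1 hlt) (Nat.succ_pos m)
    rw [mul_comm rel] at h2
    simp only [Nat.succ_eq_add_one] at this
    omega
  obtain ⟨s₂, g1, g2, g3, g4⟩ := exec_release hm1 hQ (B := B) (T := T) (K := roundCost once m)
    (L := L') ⟨rel, last, by rw [c2, h1], by rw [c1]; omega, by
      obtain ⟨G, rfl⟩ := hF
      rw [e3, h3, List.take_append_of_le_length hrel], by rw [c3, h4], by rw [e3]; exact h5, by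
      -- The counter has grown by one, which releases another `roundCost`; its summand 4 covers the
      -- test of the main loop and the 3 steps of a release around the word.
      rw [c1, add_mul, one_mul, roundCost]
      rw [roundCost] at h6
      rw [hm] at e4
      omega⟩ (by omega) hT hB
  exact ⟨s₂, .seq e1 g1, g2, g3, g4⟩

/-- When the search is over the potential is 0 and the counter is at most m, so the step identity
forces the counter to be 0 and every DAG found to be released: no flushing phase is needed. -/
theorem Exec.loop_run {r : ℕ → Bool} {F : List (ℕ → Bool)}
    (hT : 1 ≤ T) (hB : T + (m + 1) * roundCost once m ≤ B) {c : Config}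
    (hc : Relation.ReflTransGen (SearchStep once m t h) c ⟨r, m, [], F⟩) :
    ∀ s : State, Holds m t h c s.mem → s.reg rRun = 1 →
      Paced m t h B T (roundCost once m) c.found (c.left m) 0 s → s.reg rCount ≤ m →
      ∃ s', Exec (.loop (.eq rRun rOne) (body once)) s s' ∧
        s'.outs.map Prod.snd = F.map (revWord m t h) ∧ DelayAtMost s' B := by
  induction hc using Relation.ReflTransGen.head_induction_on with
  | refl =>
    intro s hH hr hP hcount
    obtain ⟨k1, k2⟩ := hH.run_last (once := once)
    have hone : s.reg rOne = 1 := hH.rep.one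
    obtain ⟨s', e1, ⟨rel, last, h1, h2, h3, h4, h5, h6⟩, e3, e4⟩ := exec_body (L' := 0) hH.rep.edges
      k1.queue hP hcount hT hB List.prefix_rfl (by simp [Config.left]; omega)
    have hrel : rel = F.length ∧ s'.reg rCount = 0 := by
      simp only [add_zero] at h2
      rw [mul_comm rel] at h2
      have h7 : rel ≤ F.length := by
        by_contra hlt
        have := Nat.mul_le_mul_left (m + 1) (not_le.1 hlt)
        rw [Nat.mul_succ] at this
        omega
      have h8 : F.length ≤ rel := by
        by_contra hlt
        have := Nat.mul_le_mul_left (m + 1) (not_le.1 hlt)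
        rw [Nat.mul_succ] at this
        omega
      have h9 : rel = F.length := le_antisymm h7 h8
      subst h9
      exact ⟨rfl, by omega⟩
    have hdone : ¬ (Test.eq rRun rOne).Holds s' := by
      have h7 : s'.reg rRun = 0 := (e4.reg rRun (by decide)).trans k2
      have h8 : s'.reg rOne = 1 := (e4.reg rOne (by decide)).trans k1.rep.one
      simp [Test.Holds, h7, h8]
    refine ⟨_, .loop_true ?_ e1 (.loop_false hdone), ?_, ?_⟩
    · simp [Test.Holds, hr, hone]
    · show s'.outs.map Prod.snd = _
      rw [h3, hrel.1, List.take_length]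
    · refine h5 _ ?_
      have : 1 ≤ (m + 1) * roundCost once m :=
        Nat.mul_pos (Nat.succ_pos m) (by rw [roundCost]; omega)
      rw [hrel.2] at h6
      simp only [State.tick]
      omega
  | @head c c' hstep _ ih =>
    intro s hH hr hP hcount
    have hH' := hH.run_step hstep
    have hone : s.reg rOne = 1 := hH.rep.one
    have hrun : ((step once).run s.mem).reg rRun = 1 := by
      rw [run_step_run]
      · exact hr
      · have h1 := hH.rep.cur
        have h2 := hH.rep.edges
        have h3 := hH.rep.depth
        have h4 := hH.rep.zero
        cases hstep with
        | pass hi => exact .inl (by simpa [Test.On, h1, h2] using hi)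
        | descend hi => exact .inl (by simpa [Test.On, h1, h2] using hi)
        | ascend => exact .inr (by simp [Test.On, h3, h4])
    have hF : c.found <+: c'.found := by
      cases hstep with
      | pass => exact List.prefix_rfl
      | descend => exact List.prefix_append _ _
      | ascend => exact List.prefix_rfl
    have hL : c'.left m + (m + 1) * c.found.length + 1 = c.left m + (m + 1) * c'.found.length := by
      have := hH.stack_lt
      cases hstep with
      | pass hi => simp only [Config.left]; omega
      | descend hi =>
        simp only [Config.left, List.map_cons, List.sum_cons, List.length_append,
          List.length_singleton]
        rw [mul_add]
        omega
      | ascend =>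
        simp only [List.forall_mem_cons] at this
        simp only [Config.left, List.map_cons, List.sum_cons]
        omega
    obtain ⟨s', e1, e2, e3, e4⟩ := exec_body hH.rep.edges hH'.queue hP hcount hT hB hF hL
    obtain ⟨s₂, g1, g2⟩ := ih s' (hH'.agree e4 (by decide) (by decide))
      ((e4.reg rRun (by decide)).trans hrun) e2 e3
    exact ⟨s₂, .loop_true (by simp [Test.Holds, hr, hone]) e1 g1, g2⟩

end Pacing

/-! ### The whole program: start-up followed by the paced search -/

section Program

open Code

/-- Compute a DAG of the class and begin the search there. -/
def prelude : Code :=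
  .const rOne 1 ;; extend ;; .const rFresh 2 ;; trieInsert ;; enqueue ;; .const rRun 1

/-- The implementation of `chickering-enum`. -/
def program (once : Bool) : Prog :=
  .seq prelude.toProg (.loop (.eq rRun rOne) (body once))

/-- A memory in which only the number of edges and the edge list are stored. -/
structure Blank (μ : Mem) : Prop where
  reg : ∀ x, 1 < x → μ.reg x = 0
  arr : ∀ a, 2 < a → ∀ i, μ.arr a i = 0

/-- The root occupies the cells 0 and 1, so allocation starts at 2, the constant that `prelude` puts
into `rFresh`. -/
theorem trieAt_empty {A : ℕ → ℕ} (hA : ∀ i, A i = 0) : TrieAt A 2 {[]} fun _ => 0 := by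
  refine ⟨rfl, rfl, ?_, ?_, ?_, ?_, fun _ _ _ _ => hA _, fun _ _ => hA _⟩
  · intro l b h
    simp at h
  · intro l _
    decide
  · rintro l rfl l' rfl b b' h
    refine ⟨rfl, ?_⟩
    cases b <;> cases b' <;> simp at h ⊢
  · intro l _ b h
    simp at h

theorem foundKeys_singleton (m : ℕ) (r : ℕ → Bool) :
    foundKeys m [r] = {[]} ∪ {l | l <+: keyOf r m} := by
  ext l
  simp only [foundKeys, List.mem_singleton, exists_eq_left, Set.mem_union, Set.mem_singleton_iff,
    Set.mem_ofPred_eq]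
  exact ⟨.inr, by rintro (rfl | h); exacts [List.nil_prefix, h]⟩

/-- The orientation found becomes the base, relative to which the blank array of flags represents
the start itself. The start counts as found: it is in the trie and in the queue before the search
begins. -/
theorem run_prelude {μ : Mem} (hμ : Blank μ) {R : ℕ → ℕ → Prop} {ρ : ℕ → ℕ}
    (hloop : ∀ i < μ.reg rM, μ.arr aTail i ≠ μ.arr aHead i)
    (HR : Extends (μ.reg rM) (μ.arr aTail) (μ.arr aHead) (μ.arr aKind) R ρ) :
    ∃ t h dd : ℕ → ℕ, (∀ i < μ.reg rM, dd i ≠ 0) ∧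
      Elim (μ.reg rM) (μ.arr aTail) (μ.arr aHead) (μ.arr aKind) t h dd ∧
      Holds (μ.reg rM) t h ⟨fun _ => false, 0, [], [fun _ => false]⟩ (prelude.run μ) ∧
      (prelude.run μ).reg rRun = 1 ∧ (prelude.run μ).reg rCount = 0 ∧
      (prelude.run μ).reg rRead = 0 ∧ (prelude.run μ).buf = μ.buf := by
  have hA0 := agree_run (.const rOne 1) μ
  have h1 : ((Code.const rOne 1).run μ).reg rOne = 1 := by simp [run]
  have hrun : prelude.run μ = (enqueue ;; .const rRun 1).run (trieInsert.run
    ((Code.const rFresh 2).run (extend.run ((Code.const rOne 1).run μ)))) := rfl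
  have hC := agree_run prelude μ
  have hrest : (prelude.run μ).reg rCount = 0 ∧ (prelude.run μ).reg rRead = 0 ∧
      (prelude.run μ).buf = μ.buf :=
    ⟨(hC.reg _ (by decide)).trans (hμ.reg _ (by decide)),
      (hC.reg _ (by decide)).trans (hμ.reg _ (by decide)), hC.buf (by decide)⟩
  rw [and_iff_left hrest, hrun]
  clear hrest hC hrun
  have hreg : ∀ x, 1 < x → x ≠ rOne → ((Code.const rOne 1).run μ).reg x = 0 := fun x hx hx' =>
    (hA0.reg x (by simpa [writes] using hx')).trans (hμ.reg x hx)
  have harr : ((Code.const rOne 1).run μ).arr = μ.arr := rfl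
  have hm : ((Code.const rOne 1).run μ).reg rM = μ.reg rM := hA0.reg _ (by decide)
  generalize (Code.const rOne 1).run μ = μ₁ at h1 hreg harr hm ⊢
  have hstart : StampsOK μ₁ := by
    constructor <;> intro v
    · rw [harr, hμ.arr _ (by decide)]; exact Nat.zero_le _
    · rw [harr, hμ.arr _ (by decide)]; exact Nat.zero_le _
  obtain ⟨h2, dd, h3, h4⟩ := run_extend μ₁ (R := R) (ρ := ρ) (hreg _ (by decide) (by decide)) h1
    hstart (by rw [harr]; exact hμ.arr _ (by decide)) (by rw [hm, harr]; exact hloop)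
    (by rw [hm, harr]; exact HR)
  rw [hm] at h3
  rw [hm, harr] at h4
  refine ⟨_, _, dd, h3, h4, ?_⟩
  have hA : Agree (extend ;; .const rFresh 2) μ₁ ((Code.const rFresh 2).run (extend.run μ₁)) :=
    agree_run _ μ₁
  have hfresh : ((Code.const rFresh 2).run (extend.run μ₁)).reg rFresh = 2 := by simp [run]
  have hstamp : ∀ v, ((Code.const rFresh 2).run (extend.run μ₁)).arr aMark v ≤
      ((Code.const rFresh 2).run (extend.run μ₁)).reg rStamp := by
    simpa [run] using h2.1
  have ht : (extend.run μ₁).arr = ((Code.const rFresh 2).run (extend.run μ₁)).arr := rfl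
  rw [ht]
  clear h2 h3 h4 ht
  generalize (Code.const rFresh 2).run (extend.run μ₁) = μ₂ at hA hfresh hstamp ⊢
  have hzero : ∀ x, 1 < x → x ≠ rOne → x ∉ (extend ;; .const rFresh 2).writes → μ₂.reg x = 0 :=
    fun x h h' h'' => (hA.reg x h'').trans (hreg x h h')
  have hblank : ∀ a, 2 < a → a ∉ (extend ;; .const rFresh 2).stores → ∀ i, μ₂.arr a i = 0 :=
    fun a h h' i => by rw [hA.arr a h', harr, hμ.arr a h]
  have hrep : Represents (μ.reg rM) (μ₂.arr aTail) (μ₂.arr aHead) (fun _ => false) 0 [] μ₂ :=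
    ⟨(hA.reg _ (by decide)).trans hm, hzero _ (by decide) (by decide) (by decide),
      (hA.reg _ (by decide)).trans h1, hzero _ (by decide) (by decide) (by decide),
      hzero _ (by decide) (by decide) (by decide), rfl, rfl, rfl,
      hblank _ (by decide) (by decide), hstamp⟩
  have htrie : TrieHolds (μ.reg rM) [fun _ => false] (trieInsert.run μ₂) := by
    have := (run_trieInsert μ₂ hrep.zero hrep.one hrep.flag (P := {[]}) ⟨_, by
      rw [hfresh]
      exact trieAt_empty (hblank _ (by decide) (by decide))⟩).1
    rwa [hrep.edges, ← foundKeys_singleton] at this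
  have hB := agree_run trieInsert μ₂
  have hrep' := hrep.agree_of_stamp hB (by decide) (by decide)
  have hqueue : QueueHolds (μ.reg rM) (μ₂.arr aTail) (μ₂.arr aHead) [] (trieInsert.run μ₂) := by
    rw [QueueHolds, hB.reg _ (by decide), hzero _ (by decide) (by decide) (by decide)]
    rfl
  generalize trieInsert.run μ₂ = μ₃ at htrie hrep' hqueue ⊢
  have hC := agree_run (enqueue ;; .const rRun 1) μ₃
  refine ⟨⟨hrep'.agree_of_stamp hC (by decide) (by decide), htrie.agree hC (by decide) (by decide),
    (run_enqueue_holds hrep' hqueue).agree (agree_run (.const rRun 1) _) (by decide) (by decide),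
    fun _ _ => rfl, ?_, Nat.zero_le _, by simp⟩, by simp [run]⟩
  intro r hr
  rw [List.mem_singleton.1 hr]
  exact fun _ _ => rfl

/-! ### Running time -/

namespace Code

/-- The nesting depth of loops. -/
def nesting : Code → ℕ
  | seq P Q => max P.nesting Q.nesting
  | ite _ P Q => max P.nesting Q.nesting
  | rep _ P => P.nesting + 1
  | _ => 0

/-- The length of the code. -/
def size : Code → ℕ
  | seq P Q => P.size + Q.size
  | ite _ P Q => P.size + Q.size + 1
  | rep _ P => P.size + 2
  | _ => 1

/-- Every loop runs m times, so the time is polynomial of degree the nesting of loops. -/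
theorem cost_le (m : ℕ) (P : Code) : P.cost m ≤ P.size * (m + 1) ^ P.nesting := by
  have hpos : ∀ k, 1 ≤ (m + 1) ^ k := fun k => Nat.one_le_pow _ _ (Nat.succ_pos m)
  have hmono : ∀ c {k l : ℕ}, k ≤ l → c * (m + 1) ^ k ≤ c * (m + 1) ^ l := fun c k l h =>
    Nat.mul_le_mul_left _ (Nat.pow_le_pow_right (Nat.succ_pos m) h)
  induction P with
  | seq P Q ihP ihQ =>
    simp only [cost, size, nesting, add_mul]
    exact add_le_add (ihP.trans (hmono _ (le_max_left _ _))) (ihQ.trans (hmono _ (le_max_right _ _)))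
  | ite b P Q ihP ihQ =>
    simp only [cost, size, nesting, add_mul, one_mul]
    have h1 := ihP.trans (hmono P.size (le_max_left P.nesting Q.nesting))
    have h2 := ihQ.trans (hmono Q.size (le_max_right P.nesting Q.nesting))
    have h3 := hpos (max P.nesting Q.nesting)
    omega
  | rep i P ih =>
    simp only [cost, size, nesting]
    have h1 := hpos P.nesting
    calc m * (P.cost m + 2) + 2 ≤ (m + 1) * (P.cost m + 2) := by nlinarith [Nat.zero_le (P.cost m)]
      _ ≤ (m + 1) * ((P.size + 2) * (m + 1) ^ P.nesting) := by
        refine Nat.mul_le_mul_left _ ?_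
        rw [add_mul]
        omega
      _ = (P.size + 2) * (m + 1) ^ (P.nesting + 1) := by ring
  | _ => simp [cost, size, nesting]

end Code

/-- The delay of the program. -/
def delay (once : Bool) (m : ℕ) : ℕ := prelude.cost m + 1 + (m + 1) * roundCost once m

/-- Only the start-up has loops nested three deep. A round of the search has nesting one, and m + 1
rounds between releases are quadratic. -/
theorem exists_delay_le (once : Bool) : ∃ C, ∀ m, delay once m ≤ C * (m ^ 3 + 1) := by
  refine ⟨4 * (prelude.size + 1 + ((step once).size + emitWord.size + 4)), fun m => ?_⟩
  have h1 := prelude.cost_le m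
  have h2 := (step once).cost_le m
  have h3 := emitWord.cost_le m
  have n1 : prelude.nesting = 3 := rfl
  have n2 : (step once).nesting = 1 := by cases once <;> rfl
  have n3 : emitWord.nesting = 1 := rfl
  rw [n1] at h1
  rw [n2, pow_one] at h2
  rw [n3, pow_one] at h3
  rw [delay, roundCost]
  generalize prelude.cost m = a at *
  generalize prelude.size = a' at *
  generalize (step once).cost m = b at *
  generalize (step once).size = b' at *
  generalize emitWord.cost m = c at *
  generalize emitWord.size = c' at *
  have h4 : b + c + 4 ≤ (b' + c' + 4) * (m + 1) := by
    simp only [add_mul]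
    omega
  have h5 : (m + 1) ^ 2 ≤ (m + 1) ^ 3 := Nat.pow_le_pow_right (Nat.succ_pos m) (by norm_num)
  have h6 : 1 ≤ (m + 1) ^ 3 := Nat.one_le_pow _ _ (Nat.succ_pos m)
  -- The difference of the two sides is 3 (m - 1)² (m + 1).
  have h7 : (m + 1) ^ 3 ≤ 4 * (m ^ 3 + 1) := by
    zify
    nlinarith [mul_nonneg (Int.natCast_nonneg m) (sq_nonneg ((m : ℤ) - 1)),
      sq_nonneg ((m : ℤ) - 1)]
  calc a + 1 + (m + 1) * (b + c + 4)
      ≤ a' * (m + 1) ^ 3 + (m + 1) ^ 3 + (m + 1) * ((b' + c' + 4) * (m + 1)) :=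
        add_le_add (add_le_add h1 h6) (Nat.mul_le_mul_left _ h4)
    _ = a' * (m + 1) ^ 3 + (m + 1) ^ 3 + (b' + c' + 4) * (m + 1) ^ 2 := by ring
    _ ≤ a' * (m + 1) ^ 3 + (m + 1) ^ 3 + (b' + c' + 4) * (m + 1) ^ 3 :=
        Nat.add_le_add_left (Nat.mul_le_mul_left _ h5) _
    _ = (a' + 1 + (b' + c' + 4)) * (m + 1) ^ 3 := by ring
    _ ≤ (a' + 1 + (b' + c' + 4)) * (4 * (m ^ 3 + 1)) := Nat.mul_le_mul_left _ h7
    _ = 4 * (a' + 1 + (b' + c' + 4)) * (m ^ 3 + 1) := by ring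

/-! ### Correctness -/

variable {n m : ℕ} {M : Set (Digraph (Fin n))} {t h t₀ h₀ kd dd : ℕ → ℕ}

theorem Lists.isBase (H : Lists M m t₀ h₀ kd) (hM : IsMEC M) (hE : Elim m t₀ h₀ kd t h dd)
    (hdd : ∀ i < m, dd i ≠ 0) : IsBase M m t h := by
  refine ⟨hM, H.arcGraph_mem hM hE hdd, ?_, ?_⟩
  · intro i hi
    obtain ⟨u, v, hu, hv, -⟩ := H.ends i hi
    rcases hE.arcs i hi with ⟨h1, h2⟩ | ⟨-, h1, h2⟩
    · rw [h1, h2, hu, hv]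
      exact ⟨u.2, v.2⟩
    · rw [h1, h2, hu, hv]
      exact ⟨v.2, u.2⟩
  · intro i hi j hj u v h1 h2
    exact H.inj i hi j hj u v ((hE.joins_iff hi u v).1 h1) ((hE.joins_iff hj u v).1 h2)

theorem IsBase.isWordOf (H : IsBase M m t h) (r : ℕ → Bool) :
    IsWordOf (revGraph n m t h r) (revWord m t h r) := by
  have hends : ∀ i : Fin m, ∃ e : Fin n × Fin n, dirTail t h r i = e.1 ∧ dirHead t h r i = e.2 := by
    intro i
    obtain ⟨u, v, h1, h2⟩ := H.exists_ends r i.2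
    exact ⟨(u, v), h1, h2⟩
  choose e he using hends
  refine ⟨List.ofFn e, ?_, ?_, ?_⟩
  · refine List.nodup_ofFn.2 fun i j hij => Fin.ext (H.dir_unique r i.2 j.2 ?_ ?_)
    · rw [(he i).1, (he j).1, hij]
    · rw [(he i).2, (he j).2, hij]
  · intro u v
    rw [List.mem_ofFn]
    constructor
    · rintro ⟨i, hi⟩
      exact ⟨i, i.2, by rw [(he i).1, hi], by rw [(he i).2, hi]⟩
    · rintro ⟨i, hi, h1, h2⟩
      refine ⟨⟨i, hi⟩, Prod.ext (Fin.ext ?_) (Fin.ext ?_)⟩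
      · exact (he ⟨i, hi⟩).1.symm.trans h1
      · exact (he ⟨i, hi⟩).2.symm.trans h2
  · rw [revWord, arcWord, ← List.map_coe_finRange_eq_range, List.ofFn_eq_map, List.flatMap_map,
      List.flatMap_map]
    exact congrArg (fun f => List.flatMap f _) (funext fun i => by rw [(he i).1, (he i).2])

theorem blank_initialState (es : List (Fin n × Fin n × Bool)) : Blank (initialState n es).mem := by
  constructor
  · intro x hx
    have h0 : x ≠ 0 := by omega
    have h1 : x ≠ 1 := by omega
    simp [initialState, State.mem, h0, h1]
  · intro a ha i
    have h0 : a ≠ 0 := by omega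
    have h1 : a ≠ 1 := by omega
    have h2 : a ≠ 2 := by omega
    simp only [initialState, State.mem, h0, h1, h2, if_false]
    split <;> rfl

/-- The run exists abstractly by termination; the search follows it and the machine follows the
search. The queue releases the DAGs in the order in which they were found, which is the order of the
run. -/
theorem program_outputs (once : Bool) (hM : IsMEC M) {es : List (Fin n × Fin n × Bool)}
    (hes : IsEdgeList (cpdag M) es) : ∃ D₀ ∈ M, ∃ order : Digraph (Fin n) → List (Digraph (Fin n)),
      IsOrder once D₀ M order ∧ ∃ out d, Run order D₀ out d ∧
        OutputsWithDelay (program once) es out (delay once es.length) := by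
  have hl := hes.lists hM
  obtain ⟨R, ρ, HR⟩ := hl.exists_extends hM
  obtain ⟨t, h, dd, hdd, hE, hH, hrun, hcount, hread, hbuf⟩ :=
    run_prelude (blank_initialState es) (hl.loopless hM) HR
  have hB : IsBase M es.length t h := hl.isBase hM hE hdd
  have ho : IsOrder once (arcGraph n es.length t h) M (edgeOrder once n es.length t h) := hB.isOrder
  obtain ⟨out, d, hr⟩ := ho.exists_run hM hB.mem
  refine ⟨_, hB.mem, _, ho, out, d, hr, ?_⟩
  obtain ⟨rest, vis, hloop, rfl⟩ := hr
  have hsupp : Supp es.length fun _ => false := fun _ _ => rfl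
  obtain ⟨F, hF, -, hFout, -⟩ := hB.search_of_loop hloop (fun _ => false) 0 [] [fun _ => false]
    hsupp hB.mem (Nat.zero_le _) (hB.edgeOrder_eq hsupp hB.mem) (by
      intro r hr
      rw [List.mem_singleton.1 hr]
      exact ⟨hsupp, hB.mem⟩) (by
      ext D
      simp [revGraph_false])
  obtain ⟨s, e1, e2, e3, e4⟩ := exec_toProg prelude (by decide) (initialState n es)
  rw [← e2] at hH hrun hcount hread hbuf
  change s.time ≤ 0 + prelude.cost es.length at e4
  -- The allowance T covers the start-up, so the uniform bound is this cost plus the m + 1 rounds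
  -- before a release.
  obtain ⟨s', g1, g2, g3⟩ := Exec.loop_run (B := delay once es.length)
    (T := prelude.cost es.length + 1) (Nat.le_add_left _ _) le_rfl hF s hH hrun
    ⟨0, 0, hread, by
      change s.reg rCount = 0 at hcount
      simp [hcount, Config.left], by rw [e3]; rfl, hbuf, by
      rw [e3]
      intro τ hτ
      simpa [initialState] using hτ, by omega⟩ (by
      change s.reg rCount = 0 at hcount
      omega)
  refine ⟨s', .seq e1 g1, ?_, g3⟩
  rw [List.map_singleton, revGraph_false, List.singleton_append] at hFout
  rw [g2, ← hFout, List.forall₂_map_left_iff, List.forall₂_map_right_iff, List.forall₂_same]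
  exact fun r _ => hB.isWordOf r

end Program
end Chickering

/-! ### Correctness and delay, for both versions of the algorithm -/

theorem mainTheorem12 (once : Bool) :
    -- for every start and every order of the loops, the algorithm terminates and lists the class
    (∀ (n : ℕ) (M : Set (Digraph (Fin n))), Chickering.IsMEC M →
      ∀ D₀ ∈ M, ∀ order : Digraph (Fin n) → List (Digraph (Fin n)),
        Chickering.IsOrder once D₀ M order →
          (∃ out d, Chickering.Run order D₀ out d) ∧
          ∀ out d, Chickering.Run order D₀ out d →
            out.Nodup ∧ (∀ D, D ∈ out ↔ D ∈ M) ∧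
            (once = true → d ≤ Chickering.edgeCount (Chickering.cpdag M))) ∧
    -- it has an implementation with cubic delay, on input the CPDAG
    (∃ (P : Chickering.Prog) (C : ℕ),
      ∀ (n : ℕ) (M : Set (Digraph (Fin n))), Chickering.IsMEC M →
        ∀ es : List (Fin n × Fin n × Bool), Chickering.IsEdgeList (Chickering.cpdag M) es →
          ∃ D₀ ∈ M, ∃ order : Digraph (Fin n) → List (Digraph (Fin n)),
            Chickering.IsOrder once D₀ M order ∧
            ∃ out d, Chickering.Run order D₀ out d ∧
              Chickering.OutputsWithDelay P es out
                (C * (Chickering.edgeCount (Chickering.cpdag M) ^ 3 + 1))) := by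
  constructor
  · intro n M hM D₀ hD₀ order ho
    refine ⟨ho.exists_run hM hD₀, fun out d hr => ?_⟩
    obtain ⟨h1, h2⟩ := ho.run_spec hM hD₀ hr
    refine ⟨h1, h2, fun honce => ?_⟩
    subst honce
    exact ho.depth_le hM hD₀ hr
  · obtain ⟨C, hC⟩ := Chickering.exists_delay_le once
    refine ⟨Chickering.program once, C, fun n M hM es hes => ?_⟩
    obtain ⟨D₀, hD₀, order, ho, out, d, hr, s, h1, h2, h3⟩ :=
      Chickering.program_outputs once hM hes
    refine ⟨D₀, hD₀, order, ho, out, d, hr, s, h1, h2, h3.imp fun a b hab => hab.trans ?_⟩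
    rw [← hes.length_eq]
    exact Nat.add_le_add_left (hC _) _
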